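/- Let $\mu>0$ and $c\in\mathbb R$. A function $\varphi\in H^1_{loc}(\mathbb R)$ (identified with its continuous representative) is called a \emph{traveling wave} of speed $c$ of the equation $-u_{txx}=-2\mu u_x+2u_xu_{xx}+uu_{xxx}$, with $u(t,x)=\varphi(x-ct)$, if for some $a\in\mathbb R$ $$\varphi_x^2=-4\mu\varphi+\big((\varphi-c)^2\big)_{xx}+a\qquad\text{in the sense of distributions.}$$ It has the parameters $(m,M)$ if $\varphi_x^2=\dfrac{2\mu(M-\varphi)(\varphi-m)}{c-\varphi}$ wherever $\varphi\neq c$. A cusp (anticusp) is a point at which $\varphi$ is continuous, on both sides of which $\varphi$ is smooth, and at which $\varphi_x$ tends to $+\infty$ from the left and $-\infty$ from the right (respectively $-\infty$ and $+\infty$); at a peak the one-sided limits of $\varphi_x$ are $l$ and $-l$ with $0<l<\infty$. A periodic wave is called cusped (anticusped, peaked) if it attains the value $c$ exactly once per period, has a cusp (anticusp, peak) there, and is smooth elsewhere. Then the following hold. (a) (Smooth periodic) If $m<M<c$, there is, uniquely up to translation, a smooth periodic traveling wave with parameters $(m,M)$, $\min\varphi=m$ and $\max\varphi=M$. (a') (Peaked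 periodic) If $m<M=c$, there is, uniquely up to translation, a peaked periodic traveling wave with parameters $(m,c)$, $\min\varphi=m$ and $\max\varphi=c$. (b) (Cusped periodic) If $m<c<M$, there is, uniquely up to translation, a cusped periodic traveling wave with parameters $(m,M)$, $\min\varphi=m$ and $\max\varphi=c$. (c) (Anticusped periodic) If $c<m<M$, there is, uniquely up to translation, an anticusped periodic traveling wave with parameters $(m,M)$, $\min\varphi=c$ and $\max\varphi=m$. (d) (Anticusped on the line) If $c<m=M$, there is, uniquely up to translation, a traveling wave with parameters $(m,m)$ that attains the value $c$ at exactly one point, has an anticusp there and is smooth elsewhere, with $\min\varphi=c$ and $\lim_{x\to\pm\infty}\varphi(x)=\sup\varphi=m$. (e), (f) (Composite waves and plateaus) Call $\varphi:\mathbb R\to\mathbb R$ a composite wave with sum $S$ if on every connected component $E$ of $\{\varphi\neq c\}$ it coincides with a wave $w$ from (a')--(d) whose parameters satisfy $m+M=S$ and for which $E$ is a connected component of $\{w\neq c\}$ (the parameters may depend on $E$; there are at most countably many components). A composite wave with sum $S$ that is not identically $c$ is a traveling wave if and only if the set $\{\varphi=c\}$ has Lebesgue measure zero or $S=2c$. In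 particular segments may be glued at their crests (the points of height $c$) whenever their values of $m+M$ agree, and plateaus, i.e. intervals on which $\varphi\equiv c$, may occur exactly when $m+M=2c$. (Completeness) A bounded function $\varphi:\mathbb R\to\mathbb R$ is a traveling wave of speed $c$ if and only if it is constant, or a smooth periodic wave as in (a), or a composite wave with some sum $S$ such that $\{\varphi=c\}$ has Lebesgue measure zero or $S=2c$. -/

import Mathlib

open Set Filter Topology MeasureTheory
open scoped ContDiff

namespace MuHS

/-- Test functions on the line: smooth and compactly supported. -/
def IsTestFunction (ψ : ℝ → ℝ) : Prop :=
  ContDiff ℝ ∞ ψ ∧ HasCompactSupport ψ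

/-- Membership in `L²_loc(ℝ)`. -/
def MemL2Loc (f : ℝ → ℝ) : Prop :=
  ∀ K : Set ℝ, IsCompact K → MemLp f 2 (volume.restrict K)

/-- `g` is the distributional derivative of `f`. -/
def IsWeakDeriv (f g : ℝ → ℝ) : Prop :=
  LocallyIntegrable f ∧ LocallyIntegrable g ∧
    ∀ ψ : ℝ → ℝ, IsTestFunction ψ → ∫ x, f x * deriv ψ x = -∫ x, g x * ψ x

/-- `φ ∈ H¹_loc(ℝ)` with weak derivative `g`. Elements of `H¹_loc(ℝ)` are identified, as usual,
with their continuous representatives. -/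
def IsH1LocWithDeriv (φ g : ℝ → ℝ) : Prop :=
  Continuous φ ∧ MemL2Loc φ ∧ MemL2Loc g ∧ IsWeakDeriv φ g

/-- `φ ∈ H¹_loc(ℝ)` is the profile of a traveling wave `φ (x - c t)` of speed `c` of
`-u_txx = -2 μ u_x + 2 u_x u_xx + u u_xxx`: for some real `a`,
`φ_x² = -4 μ φ + ((φ - c)²)_xx + a` in the sense of distributions. -/
def IsTravelingWave (μ c : ℝ) (φ : ℝ → ℝ) : Prop :=
  ∃ g : ℝ → ℝ, IsH1LocWithDeriv φ g ∧
    ∃ a : ℝ, ∀ ψ : ℝ → ℝ, IsTestFunction ψ →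
      ∫ x, (g x) ^ 2 * ψ x =
        (∫ x, (-4 * μ * φ x + a) * ψ x) + ∫ x, (φ x - c) ^ 2 * deriv (deriv ψ) x

/-- `φ` has the parameters `(m, M)`: where `φ ≠ c` it is differentiable and
`φ_x² = 2 μ (M - φ) (φ - m) / (c - φ)`. -/
def HasParameters (μ c m M : ℝ) (φ : ℝ → ℝ) : Prop :=
  ∀ x, φ x ≠ c → DifferentiableAt ℝ φ x ∧
    (deriv φ x) ^ 2 = 2 * μ * (M - φ x) * (φ x - m) / (c - φ x)

/-- `φ` is smooth near `x`, on each side of `x`. -/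
def SmoothOnBothSides (φ : ℝ → ℝ) (x : ℝ) : Prop :=
  ∃ ε > 0, ContDiffOn ℝ ∞ φ (Ioo (x - ε) x) ∧ ContDiffOn ℝ ∞ φ (Ioo x (x + ε))

/-- A cusp pointing upwards. -/
def HasCuspAt (φ : ℝ → ℝ) (x : ℝ) : Prop :=
  ContinuousAt φ x ∧ SmoothOnBothSides φ x ∧
    Tendsto (deriv φ) (𝓝[<] x) atTop ∧ Tendsto (deriv φ) (𝓝[>] x) atBot

/-- A cusp pointing downwards. -/
def HasAnticuspAt (φ : ℝ → ℝ) (x : ℝ) : Prop :=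
  ContinuousAt φ x ∧ SmoothOnBothSides φ x ∧
    Tendsto (deriv φ) (𝓝[<] x) atBot ∧ Tendsto (deriv φ) (𝓝[>] x) atTop

/-- A corner pointing upwards, with opposite finite one-sided slopes. -/
def HasPeakAt (φ : ℝ → ℝ) (x : ℝ) : Prop :=
  ContinuousAt φ x ∧ SmoothOnBothSides φ x ∧
    ∃ l > 0, Tendsto (deriv φ) (𝓝[<] x) (𝓝 l) ∧ Tendsto (deriv φ) (𝓝[>] x) (𝓝 (-l))

/-- `φ` is periodic, reaches the height `c` exactly once per period, is smooth elsewhere, and has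
a singularity of the kind `Q` at each point of height `c`. -/
def IsPeriodicWithCrests (c : ℝ) (Q : (ℝ → ℝ) → ℝ → Prop) (φ : ℝ → ℝ) : Prop :=
  ∃ x₀ T : ℝ, 0 < T ∧ Function.Periodic φ T ∧
    (∀ x, φ x = c ↔ ∃ k : ℤ, x = x₀ + k * T) ∧
    ContDiffOn ℝ ∞ φ {x | φ x ≠ c} ∧ ∀ x, φ x = c → Q φ x

/-- Smooth periodic traveling wave with parameters `(m, M)`, minimum `m`, maximum `M`. -/
structure IsSmoothPeriodicWave (μ c m M : ℝ) (φ : ℝ → ℝ) : Prop where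
  wave : IsTravelingWave μ c φ
  parameters : HasParameters μ c m M φ
  smooth : ContDiff ℝ ∞ φ
  periodic : ∃ T > 0, Function.Periodic φ T
  minimum : IsLeast (range φ) m
  maximum : IsGreatest (range φ) M

/-- Peaked periodic traveling wave with parameters `(m, c)`, minimum `m`, maximum `c`. -/
structure IsPeakedPeriodicWave (μ c m : ℝ) (φ : ℝ → ℝ) : Prop where
  wave : IsTravelingWave μ c φ
  parameters : HasParameters μ c m c φ
  peaks : IsPeriodicWithCrests c HasPeakAt φ
  minimum : IsLeast (range φ) m
  maximum : IsGreatest (range φ) c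

/-- Cusped periodic traveling wave with parameters `(m, M)`, minimum `m`, maximum `c`. -/
structure IsCuspedPeriodicWave (μ c m M : ℝ) (φ : ℝ → ℝ) : Prop where
  wave : IsTravelingWave μ c φ
  parameters : HasParameters μ c m M φ
  cusps : IsPeriodicWithCrests c HasCuspAt φ
  minimum : IsLeast (range φ) m
  maximum : IsGreatest (range φ) c

/-- Anticusped periodic traveling wave with parameters `(m, M)`, minimum `c`, maximum `m`. -/
structure IsAnticuspedPeriodicWave (μ c m M : ℝ) (φ : ℝ → ℝ) : Prop where
  wave : IsTravelingWave μ c φ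
  parameters : HasParameters μ c m M φ
  anticusps : IsPeriodicWithCrests c HasAnticuspAt φ
  minimum : IsLeast (range φ) c
  maximum : IsGreatest (range φ) m

/-- Anticusped traveling wave on the line with parameters `(m, m)`: one anticusp, at height `c`
(the minimum), and limit `m` (the supremum) at both ends. -/
structure IsAnticuspedLineWave (μ c m : ℝ) (φ : ℝ → ℝ) : Prop where
  wave : IsTravelingWave μ c φ
  parameters : HasParameters μ c m m φ
  smooth : ContDiffOn ℝ ∞ φ {x | φ x ≠ c}
  anticusp : ∃ x₀, (∀ x, φ x = c ↔ x = x₀) ∧ HasAnticuspAt φ x₀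
  minimum : IsLeast (range φ) c
  supremum : IsLUB (range φ) m
  limit_right : Tendsto φ atTop (𝓝 m)
  limit_left : Tendsto φ atBot (𝓝 m)

/-- There is a profile with the property `P`, and the profiles with the property `P` are exactly
its translates. -/
def ExistsUniqueUpToTranslation (P : (ℝ → ℝ) → Prop) : Prop :=
  ∃ φ, P φ ∧ ∀ ψ, P ψ ↔ ∃ s : ℝ, ∀ x, ψ x = φ (x + s)

/-- `w` is a wave that reaches the height `c`, with parameters `(m, M)`. -/
def IsElementaryWave (μ c m M : ℝ) (w : ℝ → ℝ) : Prop :=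
  (m < c ∧ M = c ∧ IsPeakedPeriodicWave μ c m w) ∨
  (m < c ∧ c < M ∧ IsCuspedPeriodicWave μ c m M w) ∨
  (c < m ∧ m < M ∧ IsAnticuspedPeriodicWave μ c m M w) ∨
  (c < m ∧ m = M ∧ IsAnticuspedLineWave μ c m w)

/-- `φ` is glued together, at the height `c`, from segments of elementary waves that all have
`m + M = S`: on each connected component of `{φ ≠ c}` it coincides with such a wave `w`, and
that component is a component of `{w ≠ c}`, i.e. reaches from one crest of `w` to the next. -/
def IsComposite (μ c S : ℝ) (φ : ℝ → ℝ) : Prop :=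
  ∀ x, φ x ≠ c → ∃ (m M : ℝ) (w : ℝ → ℝ), m + M = S ∧ IsElementaryWave μ c m M w ∧
    connectedComponentIn {y | φ y ≠ c} x = connectedComponentIn {y | w y ≠ c} x ∧
    EqOn φ w (connectedComponentIn {y | φ y ≠ c} x)

end MuHS

/-!
Where `φ ≠ c`, the equation of a traveling wave is the ordinary differential equation
`2 (φ - c) φ'' + φ'² = 4 μ φ - a`, whose first integral `(φ - c) φ'² - 2 μ φ² + a φ` determines the
parameters: `m` and `M` are the roots of `2 μ t² - a t + b`, where `b` is its value. Conversely, let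
`φ` be continuous and solve this equation off the height `c`. Testing the equation of `(φ - c)²`
with functions cut off near the zeros of `φ - c` shows that `φ'² ∈ L¹_loc` and that the weak
equation fails exactly by the density `4 μ c - a` on the set `{φ = c}`. So `φ` is a traveling wave
if and only if this set is a null set or `a = 4 μ c`, which reads `m + M = 2 c`.

The change of the independent variable `dx = √|φ - c| dy` linearizes the equation and yields the
waves explicitly, in terms of `cos`, `cosh` and `exp`; their uniqueness is that of the initial value
problem, by which two solutions that agree to first order at a point agree on the whole component of
`{φ ≠ c}`. If `φ` is composite, `|φ - c| φ'²` is bounded near each point of height `c`, uniformly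
over the possibly infinitely many components there, so `|φ - c|^(3/2)` is Lipschitz and `φ` is
continuous. Finally, at each point off the height `c` a traveling wave that is bounded above agrees
to first order with one of the listed waves: otherwise the first integral keeps `(φ - c) φ'²`
away from `0` above the largest root, and `φ` grows without bound.
-/

namespace MuHS

namespace IsTestFunction

variable {ψ f : ℝ → ℝ}

lemma continuous (h : IsTestFunction ψ) : Continuous ψ :=
  h.1.continuous

lemma hasDerivAt (h : IsTestFunction ψ) (x : ℝ) : HasDerivAt ψ (deriv ψ x) x :=
  (h.1.differentiable (by simp) x).hasDerivAt

protected lemma deriv (h : IsTestFunction ψ) : IsTestFunction (deriv ψ) :=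
  ⟨(contDiff_infty_iff_deriv.1 h.1).2, HasCompactSupport.deriv h.2⟩

lemma integrable (h : IsTestFunction ψ) : Integrable ψ :=
  h.continuous.integrable_of_hasCompactSupport h.2

lemma integrable_mul (h : IsTestFunction ψ) (hf : LocallyIntegrable f) :
    Integrable fun x => f x * ψ x := by
  simpa using hf.integrable_smul_right_of_hasCompactSupport h.continuous h.2

lemma integral_mul_deriv {F F' : ℝ → ℝ} (h : IsTestFunction ψ)
    (hF : ∀ x, HasDerivAt F (F' x) x) (hF' : LocallyIntegrable F') :
    ∫ x, F x * deriv ψ x = -∫ x, F' x * ψ x :=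
  have hc : Continuous F := continuous_iff_continuousAt.2 fun x => (hF x).continuousAt
  integral_mul_deriv_eq_deriv_mul_of_integrable (fun x _ => hF x) (fun x _ => h.hasDerivAt x)
    (h.deriv.integrable_mul hc.locallyIntegrable) (h.integrable_mul hF')
    (h.integrable_mul hc.locallyIntegrable)

lemma integral_deriv_eq_zero (h : IsTestFunction ψ) : ∫ x, deriv ψ x = 0 := by
  simpa using h.integral_mul_deriv (fun x => hasDerivAt_const x (1 : ℝ))
    continuous_const.locallyIntegrable

end IsTestFunction

lemma exists_isTestFunction_eq_one (R : ℝ) :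
    ∃ ψ : ℝ → ℝ, IsTestFunction ψ ∧ (∀ x, 0 ≤ ψ x) ∧ ∀ x, |x| ≤ R → ψ x = 1 := by
  let f : ContDiffBump (0 : ℝ) := ⟨|R| + 1, |R| + 2, by positivity, by linarith⟩
  refine ⟨f, ⟨f.contDiff, f.hasCompactSupport⟩, fun x => f.nonneg, fun x hx => ?_⟩
  apply f.one_of_mem_closedBall
  rw [mem_closedBall_zero_iff, Real.norm_eq_abs]
  exact hx.trans ((le_abs_self R).trans (by simp [f]))

lemma ae_eq_zero_of_forall_isTestFunction {f : ℝ → ℝ} (hf : LocallyIntegrable f)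
    (h : ∀ ψ, IsTestFunction ψ → ∫ x, f x * ψ x = 0) : ∀ᵐ x, f x = 0 := by
  refine ae_eq_zero_of_integral_contDiff_smul_eq_zero hf fun ψ h1 h2 => ?_
  rw [← h ψ ⟨h1, h2⟩]
  simp only [smul_eq_mul, mul_comm]

lemma IsWeakDeriv.add_const {f g : ℝ → ℝ} (h : IsWeakDeriv f g) (k : ℝ) :
    IsWeakDeriv (fun x => f x + k) g := by
  refine ⟨h.1.add continuous_const.locallyIntegrable, h.2.1, fun ψ hψ => ?_⟩
  simp only [add_mul]
  rw [integral_add (hψ.deriv.integrable_mul h.1) (hψ.deriv.integrable.const_mul k),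
    integral_const_mul, hψ.integral_deriv_eq_zero, h.2.2 ψ hψ, mul_zero, add_zero]

lemma locallyIntegrable_sq_iff_memL2Loc {f : ℝ → ℝ} (hf : AEStronglyMeasurable f) :
    LocallyIntegrable (fun x => f x ^ 2) ↔ MemL2Loc f := by
  rw [locallyIntegrable_iff]
  exact forall₂_congr fun K _ => (memLp_two_iff_integrable_sq hf.restrict).symm

lemma MemL2Loc.locallyIntegrable_sq {f : ℝ → ℝ} (h : MemL2Loc f) :
    LocallyIntegrable fun x => f x ^ 2 :=
  locallyIntegrable_iff.2 fun K hK => (memLp_two_iff_integrable_sq (h K hK).1).1 (h K hK)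

lemma MemL2Loc.locallyIntegrable {f : ℝ → ℝ} (h : MemL2Loc f) : LocallyIntegrable f := by
  refine locallyIntegrable_iff.2 fun K hK => ?_
  have : IsFiniteMeasure (volume.restrict K) := ⟨by simpa using hK.measure_lt_top⟩
  exact (h K hK).integrable (by norm_num)

lemma tendsto_integral_mul_of_bounded {α : Type*} [MeasurableSpace α] {ν : Measure α}
    {b : ℕ → α → ℝ} {f L : α → ℝ} {B : ℝ} (hf : Integrable f ν)
    (hb : ∀ n, AEStronglyMeasurable (b n) ν) (hB : ∀ n x, |b n x| ≤ B)
    (hL : ∀ x, Tendsto (fun n => b n x * f x) atTop (𝓝 (L x))) :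
    Tendsto (fun n => ∫ x, b n x * f x ∂ν) atTop (𝓝 (∫ x, L x ∂ν)) := by
  refine tendsto_integral_of_dominated_convergence (fun x => B * |f x|)
    (fun n => (hb n).mul hf.1) (hf.abs.const_mul B)
    (fun n => Eventually.of_forall fun x => ?_) (Eventually.of_forall hL)
  rw [Real.norm_eq_abs, abs_mul]
  exact mul_le_mul_of_nonneg_right (hB n x) (abs_nonneg _)

/-! ### Truncation near the zeros of a function -/

/-- A smooth cutoff that rises from `0` on `(-∞, 1]` to `1` on `[2, ∞)`; composed with `k s²` it
switches a function off near the zeros of `s`, less and less so as `k → ∞`. -/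
noncomputable def cutoff (t : ℝ) : ℝ := Real.smoothTransition (t - 1)

/-- The primitive of `v ↦ cutoff (k v)`: a smooth approximation of the identity that vanishes
near `0`. -/
noncomputable def truncation (k v : ℝ) : ℝ := ∫ t in (0 : ℝ)..v, cutoff (k * t)

lemma cutoff_nonneg (t : ℝ) : 0 ≤ cutoff t := Real.smoothTransition.nonneg _

lemma cutoff_le_one (t : ℝ) : cutoff t ≤ 1 := Real.smoothTransition.le_one _

lemma abs_cutoff_le_one (t : ℝ) : |cutoff t| ≤ 1 :=
  abs_le.2 ⟨by linarith [cutoff_nonneg t], cutoff_le_one t⟩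

lemma cutoff_of_le {t : ℝ} (h : t ≤ 1) : cutoff t = 0 :=
  Real.smoothTransition.zero_of_nonpos (by linarith)

lemma cutoff_of_ge {t : ℝ} (h : 2 ≤ t) : cutoff t = 1 :=
  Real.smoothTransition.one_of_one_le (by linarith)

lemma contDiff_cutoff : ContDiff ℝ ∞ cutoff :=
  Real.smoothTransition.contDiff.comp (contDiff_id.sub contDiff_const)

lemma continuous_cutoff : Continuous cutoff := contDiff_cutoff.continuous

lemma continuous_deriv_cutoff : Continuous (deriv cutoff) :=
  contDiff_cutoff.continuous_deriv (by simp)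

lemma hasDerivAt_cutoff (t : ℝ) : HasDerivAt cutoff (deriv cutoff t) t :=
  (contDiff_cutoff.differentiable (by simp) t).hasDerivAt

lemma deriv_cutoff_nonneg (t : ℝ) : 0 ≤ deriv cutoff t :=
  Monotone.deriv_nonneg fun _ _ h => Real.smoothTransition.monotone (sub_le_sub_right h 1)

lemma deriv_cutoff_of_le {t : ℝ} (h : t ≤ 1) : deriv cutoff t = 0 :=
  IsLocalMin.deriv_eq_zero <| Eventually.of_forall fun u => by
    simpa only [cutoff_of_le h] using cutoff_nonneg u

lemma deriv_cutoff_of_ge {t : ℝ} (h : 2 ≤ t) : deriv cutoff t = 0 :=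
  IsLocalMax.deriv_eq_zero <| Eventually.of_forall fun u => by
    simpa only [cutoff_of_ge h] using cutoff_le_one u

lemma exists_bound_mul_deriv_cutoff : ∃ C, ∀ t, |t * deriv cutoff t| ≤ C := by
  have hsupp : HasCompactSupport fun t => t * deriv cutoff t := by
    refine HasCompactSupport.intro (isCompact_Icc (a := (1 : ℝ)) (b := 2)) fun t ht => ?_
    rcases le_or_gt t 1 with h | h
    · rw [deriv_cutoff_of_le h, mul_zero]
    · rw [deriv_cutoff_of_ge (not_le.1 fun h' => ht ⟨h.le, h'⟩).le, mul_zero]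
  exact (continuous_id.mul continuous_deriv_cutoff).bounded_above_of_compact_support hsupp

lemma eventually_two_le_mul {v : ℝ} (hv : 0 < v) : ∀ᶠ n : ℕ in atTop, 2 ≤ (n : ℝ) * v :=
  (tendsto_natCast_atTop_atTop.atTop_mul_const hv).eventually_ge_atTop 2

lemma tendsto_cutoff {v : ℝ} (hv : 0 < v) :
    Tendsto (fun n : ℕ => cutoff (n * v)) atTop (𝓝 1) :=
  tendsto_const_nhds.congr' <| by
    filter_upwards [eventually_two_le_mul hv] with n hn using (cutoff_of_ge hn).symm

lemma tendsto_mul_deriv_cutoff {v : ℝ} (hv : 0 < v) :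
    Tendsto (fun n : ℕ => n * v * deriv cutoff (n * v)) atTop (𝓝 0) :=
  tendsto_const_nhds.congr' <| by
    filter_upwards [eventually_two_le_mul hv] with n hn
    rw [deriv_cutoff_of_ge hn, mul_zero]

lemma hasDerivAt_truncation (k v : ℝ) : HasDerivAt (truncation k) (cutoff (k * v)) v :=
  have hc : Continuous fun t => cutoff (k * t) := continuous_cutoff.comp (continuous_const_mul k)
  intervalIntegral.integral_hasDerivAt_right (hc.intervalIntegrable _ _)
    (hc.stronglyMeasurableAtFilter _ _) hc.continuousAt

lemma continuous_truncation (k : ℝ) : Continuous (truncation k) :=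
  continuous_iff_continuousAt.2 fun v => (hasDerivAt_truncation k v).continuousAt

lemma abs_truncation_le (k v : ℝ) : |truncation k v| ≤ |v| := by
  simpa [truncation] using intervalIntegral.norm_integral_le_of_norm_le_const (a := 0) (b := v)
    (C := 1) (f := fun t => cutoff (k * t)) fun t _ => abs_cutoff_le_one (k * t)

lemma tendsto_truncation {v : ℝ} (hv : 0 ≤ v) :
    Tendsto (fun n : ℕ => truncation n v) atTop (𝓝 v) := by
  have hlim : Tendsto (fun n : ℕ => truncation n v) atTop (𝓝 (∫ _ in (0 : ℝ)..v, (1 : ℝ))) := by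
    refine intervalIntegral.tendsto_integral_filter_of_dominated_convergence (fun _ => 1)
      (Eventually.of_forall fun n =>
        (continuous_cutoff.comp (continuous_const_mul _)).aestronglyMeasurable)
      (Eventually.of_forall fun n => Eventually.of_forall fun t _ => abs_cutoff_le_one _)
      (continuous_const.intervalIntegrable _ _) (Eventually.of_forall fun t ht => ?_)
    rw [uIoc_of_le hv] at ht
    exact tendsto_cutoff ht.1
  simpa using hlim

/-- `s` is continuous and, off its zeros, twice differentiable with `s' = g` and
`(s²)'' = g² + r`. At the zeros of `s`, where nothing is assumed about derivatives, `g = 0`. -/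
structure SquareEquation (s g r : ℝ → ℝ) : Prop where
  continuous : Continuous s
  continuous_source : Continuous r
  eq_zero : ∀ x, s x = 0 → g x = 0
  hasDerivAt : ∀ x, s x ≠ 0 → HasDerivAt s (g x) x
  hasDerivAt_mul : ∀ x, s x ≠ 0 → HasDerivAt (fun x => 2 * s x * g x) (g x ^ 2 + r x) x

/-- The second derivative of `truncation k (s ^ 2)` for a solution of `SquareEquation s g r`. -/
noncomputable def truncatedSource (k : ℝ) (s g r : ℝ → ℝ) (x : ℝ) : ℝ :=
  cutoff (k * s x ^ 2) * (g x ^ 2 + r x) +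
    4 * (k * s x ^ 2 * deriv cutoff (k * s x ^ 2)) * g x ^ 2

namespace SquareEquation

variable {s g r : ℝ → ℝ}

lemma eventually_le_one (h : SquareEquation s g r) (k : ℝ) {x : ℝ} (hx : s x = 0) :
    ∀ᶠ y in 𝓝 x, k * s y ^ 2 ≤ 1 := by
  have hc : ContinuousAt (fun y => k * s y ^ 2) x := (h.continuous.pow 2).continuousAt.const_mul k
  filter_upwards [hc.eventually_lt (continuousAt_const (y := (1 : ℝ))) (by simp [hx])] with y hy
    using hy.le

lemma isOpen_support (h : SquareEquation s g r) : IsOpen {x | s x ≠ 0} :=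
  isOpen_ne_fun h.continuous continuous_const

lemma continuousAt_deriv (h : SquareEquation s g r) {x : ℝ} (hx : s x ≠ 0) :
    ContinuousAt g x := by
  have hdiv := (h.hasDerivAt_mul x hx).continuousAt.div
    (h.continuous.continuousAt.const_mul 2) (mul_ne_zero two_ne_zero hx)
  refine hdiv.congr ?_
  filter_upwards [h.isOpen_support.mem_nhds hx] with y hy
  exact mul_div_cancel_left₀ (g y) (mul_ne_zero two_ne_zero hy)

lemma measurable_deriv (h : SquareEquation s g r) : Measurable g := by
  have hg : g = {x | s x ≠ 0}.indicator (deriv s) := by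
    funext x
    by_cases hx : s x = 0
    · rw [indicator_of_notMem (by simpa using hx), h.eq_zero x hx]
    · rw [indicator_of_mem (by simpa using hx), (h.hasDerivAt x hx).deriv]
  rw [hg]
  exact (_root_.measurable_deriv s).indicator h.isOpen_support.measurableSet

lemma continuous_cutoff_sq (h : SquareEquation s g r) (k : ℝ) :
    Continuous fun x => cutoff (k * s x ^ 2) :=
  continuous_cutoff.comp ((h.continuous.pow 2).const_mul k)

lemma continuous_mul_deriv_cutoff_sq (h : SquareEquation s g r) (k : ℝ) :
    Continuous fun x => k * s x ^ 2 * deriv cutoff (k * s x ^ 2) :=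
  (continuous_id.mul continuous_deriv_cutoff).comp ((h.continuous.pow 2).const_mul k)

lemma continuous_comp_mul (h : SquareEquation s g r) {k : ℝ} {q f : ℝ → ℝ} (hq : Continuous q)
    (hq0 : ∀ t ≤ 1, q t = 0) (hf : ∀ x, s x ≠ 0 → ContinuousAt f x) :
    Continuous fun x => q (k * s x ^ 2) * f x := by
  refine continuous_iff_continuousAt.2 fun x => ?_
  by_cases hx : s x = 0
  · have hzero : (fun _ => 0) =ᶠ[𝓝 x] fun x => q (k * s x ^ 2) * f x := by
      filter_upwards [h.eventually_le_one k hx] with y hy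
      rw [hq0 _ hy, zero_mul]
    exact continuousAt_const.congr hzero
  · exact (hq.comp ((h.continuous.pow 2).const_mul k)).continuousAt.mul (hf x hx)

lemma continuous_truncatedSource (h : SquareEquation s g r) (k : ℝ) :
    Continuous (truncatedSource k s g r) := by
  have hg2 : ∀ x, s x ≠ 0 → ContinuousAt (fun x => g x ^ 2) x := fun x hx =>
    (h.continuousAt_deriv hx).pow 2
  exact (h.continuous_comp_mul continuous_cutoff (fun _ => cutoff_of_le)
    fun x hx => (hg2 x hx).add h.continuous_source.continuousAt).add
      (h.continuous_comp_mul (q := fun t => 4 * (t * deriv cutoff t))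
        ((continuous_id.mul continuous_deriv_cutoff).const_mul 4)
        (fun t ht => by rw [deriv_cutoff_of_le ht, mul_zero, mul_zero]) hg2)

lemma hasDerivAt_sq (h : SquareEquation s g r) {x : ℝ} (hx : s x ≠ 0) :
    HasDerivAt (fun x => s x ^ 2) (2 * s x * g x) x := by
  simpa using (h.hasDerivAt x hx).fun_pow 2

lemma hasDerivAt_cutoff_sq (h : SquareEquation s g r) (k : ℝ) {x : ℝ} (hx : s x ≠ 0) :
    HasDerivAt (fun x => cutoff (k * s x ^ 2))
      (deriv cutoff (k * s x ^ 2) * (k * (2 * s x * g x))) x :=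
  HasDerivAt.comp (h₂ := cutoff) x (hasDerivAt_cutoff _) ((h.hasDerivAt_sq hx).const_mul k)

lemma hasDerivAt_truncation_sq (h : SquareEquation s g r) (k x : ℝ) :
    HasDerivAt (fun x => truncation k (s x ^ 2)) (cutoff (k * s x ^ 2) * (2 * s x * g x)) x := by
  by_cases hx : s x = 0
  · have hbound : ∀ᶠ y in 𝓝 x, truncation k (s y ^ 2) = 0 := by
      filter_upwards [h.eventually_le_one k hx] with y hy
      refine intervalIntegral.integral_zero_ae (Eventually.of_forall fun t ht => cutoff_of_le ?_)
      rw [uIoc_of_le (sq_nonneg _)] at ht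
      rcases le_total k 0 with hk | hk
      · linarith [mul_nonpos_of_nonpos_of_nonneg hk ht.1.le]
      · exact (mul_le_mul_of_nonneg_left ht.2 hk).trans hy
    simpa [hx] using (hasDerivAt_const x (0 : ℝ)).congr_of_eventuallyEq hbound
  · exact (hasDerivAt_truncation k (s x ^ 2)).comp x (h.hasDerivAt_sq hx)

lemma hasDerivAt_cutoff_mul (h : SquareEquation s g r) (k x : ℝ) :
    HasDerivAt (fun x => cutoff (k * s x ^ 2) * s x)
      ((cutoff (k * s x ^ 2) + 2 * (k * s x ^ 2 * deriv cutoff (k * s x ^ 2))) * g x) x := by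
  by_cases hx : s x = 0
  · have hzero : ∀ᶠ y in 𝓝 x, cutoff (k * s y ^ 2) * s y = 0 := by
      filter_upwards [h.eventually_le_one k hx] with y hy
      rw [cutoff_of_le hy, zero_mul]
    simpa [h.eq_zero x hx] using (hasDerivAt_const x (0 : ℝ)).congr_of_eventuallyEq hzero
  · exact ((h.hasDerivAt_cutoff_sq k hx).mul (h.hasDerivAt x hx)).congr_deriv (by ring)

lemma hasDerivAt_cutoff_mul_mul (h : SquareEquation s g r) (k x : ℝ) :
    HasDerivAt (fun x => cutoff (k * s x ^ 2) * (2 * s x * g x)) (truncatedSource k s g r x) x := by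
  by_cases hx : s x = 0
  · have hzero : ∀ᶠ y in 𝓝 x, cutoff (k * s y ^ 2) * (2 * s y * g y) = 0 := by
      filter_upwards [h.eventually_le_one k hx] with y hy
      rw [cutoff_of_le hy, zero_mul]
    refine ((hasDerivAt_const x (0 : ℝ)).congr_of_eventuallyEq hzero).congr_deriv ?_
    simp [truncatedSource, hx, cutoff_of_le]
  · refine ((h.hasDerivAt_cutoff_sq k hx).mul (h.hasDerivAt_mul x hx)).congr_deriv ?_
    simp only [truncatedSource]
    ring

lemma integral_truncation_mul (h : SquareEquation s g r) (k : ℝ) {ψ : ℝ → ℝ}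
    (hψ : IsTestFunction ψ) :
    ∫ x, truncation k (s x ^ 2) * deriv (deriv ψ) x = ∫ x, truncatedSource k s g r x * ψ x := by
  have hc : Continuous fun x => cutoff (k * s x ^ 2) * (2 * s x * g x) :=
    continuous_iff_continuousAt.2 fun x => (h.hasDerivAt_cutoff_mul_mul k x).continuousAt
  rw [hψ.deriv.integral_mul_deriv (h.hasDerivAt_truncation_sq k) hc.locallyIntegrable,
    hψ.integral_mul_deriv (h.hasDerivAt_cutoff_mul_mul k)
      (h.continuous_truncatedSource k).locallyIntegrable, neg_neg]

lemma integrable_sq_mul (h : SquareEquation s g r) {ψ : ℝ → ℝ} (hψ : IsTestFunction ψ) :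
    Integrable fun x => s x ^ 2 * deriv (deriv ψ) x :=
  hψ.deriv.deriv.integrable_mul (h.continuous.pow 2).locallyIntegrable

lemma abs_truncation_mul_le (s ψ : ℝ → ℝ) (k x : ℝ) :
    |truncation k (s x ^ 2) * deriv (deriv ψ) x| ≤ |s x ^ 2 * deriv (deriv ψ) x| := by
  rw [abs_mul, abs_mul]
  exact mul_le_mul_of_nonneg_right (abs_truncation_le k _) (abs_nonneg _)

lemma integrable_cutoff_mul_sq_mul (h : SquareEquation s g r) (k : ℝ) {ψ : ℝ → ℝ}
    (hψ : IsTestFunction ψ) : Integrable fun x => cutoff (k * s x ^ 2) * g x ^ 2 * ψ x :=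
  hψ.integrable_mul (h.continuous_comp_mul continuous_cutoff (fun _ => cutoff_of_le)
    fun _ hx => (h.continuousAt_deriv hx).pow 2).locallyIntegrable

lemma cutoff_mul_sq_mul_le (s g r : ℝ → ℝ) {k x y : ℝ} (hk : 0 ≤ k) (hy : 0 ≤ y) :
    cutoff (k * s x ^ 2) * g x ^ 2 * y ≤ truncatedSource k s g r x * y + |r x * y| := by
  have hdrop : 0 ≤ k * s x ^ 2 * deriv cutoff (k * s x ^ 2) * g x ^ 2 * y := by
    have := deriv_cutoff_nonneg (k * s x ^ 2)
    positivity
  have hsource : -|r x * y| ≤ cutoff (k * s x ^ 2) * (r x * y) := by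
    refine (abs_le.1 ?_).1
    rw [abs_mul]
    exact mul_le_of_le_one_left (abs_nonneg _) (abs_cutoff_le_one _)
  simp only [truncatedSource]
  linarith

lemma integral_cutoff_mul_sq_le (h : SquareEquation s g r) {k : ℝ} (hk : 0 ≤ k) {ψ : ℝ → ℝ}
    (hψ : IsTestFunction ψ) (hψ0 : ∀ x, 0 ≤ ψ x) :
    ∫ x, cutoff (k * s x ^ 2) * g x ^ 2 * ψ x ≤
      (∫ x, |s x ^ 2 * deriv (deriv ψ) x|) + ∫ x, |r x * ψ x| := by
  have hsource := hψ.integrable_mul (h.continuous_truncatedSource k).locallyIntegrable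
  have hr := (hψ.integrable_mul h.continuous_source.locallyIntegrable).abs
  have htrunc : Integrable fun x => truncation k (s x ^ 2) * deriv (deriv ψ) x :=
    (h.integrable_sq_mul hψ).mono
      (((continuous_truncation k).comp (h.continuous.pow 2)).mul
        hψ.deriv.deriv.continuous).aestronglyMeasurable
      (Eventually.of_forall fun x => abs_truncation_mul_le s ψ k x)
  calc ∫ x, cutoff (k * s x ^ 2) * g x ^ 2 * ψ x
      ≤ ∫ x, (truncatedSource k s g r x * ψ x + |r x * ψ x|) :=
        integral_mono (h.integrable_cutoff_mul_sq_mul k hψ) (hsource.add hr)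
          fun x => cutoff_mul_sq_mul_le s g r hk (hψ0 x)
    _ = (∫ x, truncation k (s x ^ 2) * deriv (deriv ψ) x) + ∫ x, |r x * ψ x| := by
        rw [integral_add hsource hr, h.integral_truncation_mul k hψ]
    _ ≤ (∫ x, |s x ^ 2 * deriv (deriv ψ) x|) + ∫ x, |r x * ψ x| :=
        add_le_add_left (integral_mono htrunc (h.integrable_sq_mul hψ).abs
          fun x => (le_abs_self _).trans (abs_truncation_mul_le s ψ k x)) _

lemma tendsto_cutoff_mul {f : ℝ → ℝ} (hf : ∀ x, s x = 0 → f x = 0) (x : ℝ) :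
    Tendsto (fun n : ℕ => cutoff (n * s x ^ 2) * f x) atTop (𝓝 (f x)) := by
  by_cases hx : s x = 0
  · simp [hf x hx]
  · simpa using (tendsto_cutoff (sq_pos_of_ne_zero hx)).mul_const (f x)

lemma enorm_cutoff_mul_sq_mul (s g : ℝ → ℝ) {ψ : ℝ → ℝ} (hψ0 : ∀ x, 0 ≤ ψ x) (k x : ℝ) :
    ‖cutoff (k * s x ^ 2) * g x ^ 2 * ψ x‖ₑ =
      ENNReal.ofReal (cutoff (k * s x ^ 2) * g x ^ 2 * ψ x) :=
  Real.enorm_of_nonneg (mul_nonneg (mul_nonneg (cutoff_nonneg _) (sq_nonneg _)) (hψ0 x))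

lemma integrable_sq_mul_of_nonneg (h : SquareEquation s g r) {ψ : ℝ → ℝ} (hψ : IsTestFunction ψ)
    (hψ0 : ∀ x, 0 ≤ ψ x) : Integrable fun x => g x ^ 2 * ψ x := by
  have hcut := fun n : ℕ => h.integrable_cutoff_mul_sq_mul n hψ
  set E := (∫ x, |s x ^ 2 * deriv (deriv ψ) x|) + ∫ x, |r x * ψ x|
  have hle : ∀ n : ℕ, ∫⁻ x, ‖cutoff (n * s x ^ 2) * g x ^ 2 * ψ x‖ₑ ≤ ENNReal.ofReal E := by
    intro n
    simp only [enorm_cutoff_mul_sq_mul s g hψ0]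
    rw [← ofReal_integral_eq_lintegral_ofReal (hcut n) (Eventually.of_forall fun x =>
      mul_nonneg (mul_nonneg (cutoff_nonneg _) (sq_nonneg _)) (hψ0 x))]
    exact ENNReal.ofReal_le_ofReal (h.integral_cutoff_mul_sq_le n.cast_nonneg hψ hψ0)
  refine integrable_of_tendsto (f := fun x => g x ^ 2 * ψ x)
    (Eventually.of_forall fun x => ?_) (fun n => (hcut n).aestronglyMeasurable)
    (ne_top_of_le_ne_top (b := ENNReal.ofReal E) ENNReal.ofReal_ne_top
      (liminf_le_of_le (by isBoundedDefault) fun b hb => ?_))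
  · simpa only [mul_assoc] using tendsto_cutoff_mul (f := fun x => g x ^ 2 * ψ x)
      (fun x hx => by simp [h.eq_zero x hx]) x
  · obtain ⟨n, hn⟩ := hb.exists
    exact hn.trans (hle n)

lemma locallyIntegrable_sq (h : SquareEquation s g r) : LocallyIntegrable fun x => g x ^ 2 := by
  refine locallyIntegrable_iff.2 fun K hK => ?_
  obtain ⟨R, hR⟩ := hK.isBounded.subset_closedBall 0
  obtain ⟨ψ, hψ, hψ0, hψ1⟩ := exists_isTestFunction_eq_one R
  refine (h.integrable_sq_mul_of_nonneg hψ hψ0).integrableOn.congr_fun (fun x hx => ?_)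
    hK.measurableSet
  simp only [hψ1 x (by simpa using hR hx), mul_one]

lemma memL2Loc (h : SquareEquation s g r) : MemL2Loc g :=
  (locallyIntegrable_sq_iff_memL2Loc h.measurable_deriv.aestronglyMeasurable).1
    h.locallyIntegrable_sq

lemma isWeakDeriv (h : SquareEquation s g r) : IsWeakDeriv s g := by
  have hg := h.memL2Loc.locallyIntegrable
  refine ⟨h.continuous.locallyIntegrable, hg, fun ψ hψ => ?_⟩
  let slope : ℕ → ℝ → ℝ := fun n x =>
    cutoff (n * s x ^ 2) + 2 * (n * s x ^ 2 * deriv cutoff (n * s x ^ 2))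
  have hslope : ∀ n, Continuous (slope n) := fun n =>
    (h.continuous_cutoff_sq n).add ((h.continuous_mul_deriv_cutoff_sq n).const_mul 2)
  obtain ⟨C, hC⟩ := exists_bound_mul_deriv_cutoff
  have hbound : ∀ n x, |slope n x| ≤ 1 + 2 * C := fun n x => by
    refine (abs_add_le _ _).trans (add_le_add (abs_cutoff_le_one _) ?_)
    rw [abs_mul, abs_two]
    exact mul_le_mul_of_nonneg_left (hC _) zero_le_two
  have hparts : ∀ n : ℕ, ∫ x, cutoff (n * s x ^ 2) * (s x * deriv ψ x) =
      -∫ x, slope n x * (g x * ψ x) := fun n => by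
    simpa only [slope, mul_assoc] using hψ.integral_mul_deriv (h.hasDerivAt_cutoff_mul n)
      (locallyIntegrable_iff.2 fun K hK =>
        (hg.integrableOn_isCompact hK).continuousOn_mul (hslope n).continuousOn hK)
  refine tendsto_nhds_unique (tendsto_integral_mul_of_bounded
    (hψ.deriv.integrable_mul h.continuous.locallyIntegrable)
    (fun n : ℕ => (h.continuous_cutoff_sq n).aestronglyMeasurable)
    (fun n x => abs_cutoff_le_one _) (tendsto_cutoff_mul fun x hx => by simp [hx])) ?_
  simp only [hparts]
  refine (tendsto_integral_mul_of_bounded (hψ.integrable_mul hg)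
    (fun n => (hslope n).aestronglyMeasurable) hbound fun x => ?_).neg
  by_cases hx : s x = 0
  · simp [h.eq_zero x hx]
  · have hv := sq_pos_of_ne_zero hx
    simpa using ((tendsto_cutoff hv).add ((tendsto_mul_deriv_cutoff hv).const_mul 2)).mul_const
      (g x * ψ x)

lemma tendsto_integral_truncation_mul (h : SquareEquation s g r) {ψ : ℝ → ℝ}
    (hψ : IsTestFunction ψ) :
    Tendsto (fun n : ℕ => ∫ x, truncation n (s x ^ 2) * deriv (deriv ψ) x) atTop
      (𝓝 (∫ x, s x ^ 2 * deriv (deriv ψ) x)) :=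
  tendsto_integral_of_dominated_convergence _
    (fun n => (((continuous_truncation n).comp (h.continuous.pow 2)).mul
      hψ.deriv.deriv.continuous).aestronglyMeasurable) (h.integrable_sq_mul hψ).abs
    (fun n => Eventually.of_forall fun x => abs_truncation_mul_le s ψ n x)
    (Eventually.of_forall fun _ => (tendsto_truncation (sq_nonneg _)).mul_const _)

lemma tendsto_truncatedSource (h : SquareEquation s g r) (x : ℝ) :
    Tendsto (fun n : ℕ => truncatedSource n s g r x) atTop
      (𝓝 (g x ^ 2 + {x | s x ≠ 0}.indicator r x)) := by
  by_cases hx : s x = 0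
  · simp [truncatedSource, hx, h.eq_zero x hx, cutoff_of_le]
  · have hv := sq_pos_of_ne_zero hx
    rw [indicator_of_mem (by simpa using hx)]
    simpa [truncatedSource] using ((tendsto_cutoff hv).mul_const (g x ^ 2 + r x)).add
      (((tendsto_mul_deriv_cutoff hv).const_mul 4).mul_const (g x ^ 2))

theorem integral_sq_mul_deriv_deriv (h : SquareEquation s g r) {ψ : ℝ → ℝ}
    (hψ : IsTestFunction ψ) :
    ∫ x, s x ^ 2 * deriv (deriv ψ) x = (∫ x, g x ^ 2 * ψ x) + ∫ x in {x | s x ≠ 0}, r x * ψ x := by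
  have hg := hψ.integrable_mul h.locallyIntegrable_sq
  have hr := hψ.integrable_mul h.continuous_source.locallyIntegrable
  have hmeas := h.isOpen_support.measurableSet
  rw [← integral_indicator hmeas, ← integral_add hg (hr.indicator hmeas)]
  obtain ⟨C, hC⟩ := exists_bound_mul_deriv_cutoff
  refine tendsto_nhds_unique (h.tendsto_integral_truncation_mul hψ) ?_
  simp only [h.integral_truncation_mul _ hψ]
  refine tendsto_integral_of_dominated_convergence
    (fun x => |g x ^ 2 * ψ x| + |r x * ψ x| + 4 * C * |g x ^ 2 * ψ x|)
    (fun n => ((h.continuous_truncatedSource n).mul hψ.continuous).aestronglyMeasurable)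
    ((hg.abs.add hr.abs).add (hg.abs.const_mul (4 * C)))
    (fun n => Eventually.of_forall fun x => ?_) (Eventually.of_forall fun x => ?_)
  · have hsplit : truncatedSource n s g r x * ψ x =
        cutoff (n * s x ^ 2) * (g x ^ 2 * ψ x + r x * ψ x) +
          4 * (n * s x ^ 2 * deriv cutoff (n * s x ^ 2)) * (g x ^ 2 * ψ x) := by
      simp only [truncatedSource]
      ring
    rw [hsplit]
    refine (norm_add_le _ _).trans (add_le_add ?_ ?_)
    · rw [Real.norm_eq_abs, abs_mul]
      exact (mul_le_of_le_one_left (abs_nonneg _) (abs_cutoff_le_one _)).trans (abs_add_le _ _)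
    · rw [Real.norm_eq_abs, abs_mul, abs_mul, abs_of_pos (zero_lt_four' ℝ)]
      gcongr
      exact hC _
  · have hind : {x | s x ≠ 0}.indicator (fun x => r x * ψ x) x =
        {x | s x ≠ 0}.indicator r x * ψ x := indicator_mul_left _ _ _
    rw [hind, ← add_mul]
    exact (h.tendsto_truncatedSource x).mul_const (ψ x)

end SquareEquation

/-! ### Weak derivatives of continuous functions -/

lemma IsTestFunction.exists_tsupport_subset_Ioo {ψ : ℝ → ℝ} (h : IsTestFunction ψ) :
    ∃ r, tsupport ψ ⊆ Ioo (-r) r := by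
  obtain ⟨r, hr⟩ := h.2.isCompact.isBounded.subset_ball 0
  exact ⟨r, by simpa [Real.ball_eq_Ioo] using hr⟩

lemma hasDerivAt_primitive {f : ℝ → ℝ} (hf : Continuous f) (b x : ℝ) :
    HasDerivAt (fun x => ∫ t in b..x, f t) (f x) x :=
  intervalIntegral.integral_hasDerivAt_right (hf.intervalIntegrable _ _)
    (hf.stronglyMeasurableAtFilter _ _) hf.continuousAt

lemma IsTestFunction.exists_primitive {η : ℝ → ℝ} (h : IsTestFunction η) (h0 : ∫ x, η x = 0) :
    ∃ χ, IsTestFunction χ ∧ deriv χ = η := by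
  obtain ⟨r, hr⟩ := h.exists_tsupport_subset_Ioo
  have hderiv : deriv (fun x => ∫ t in (-r)..x, η t) = η :=
    funext fun x => (hasDerivAt_primitive h.continuous (-r) x).deriv
  refine ⟨fun x => ∫ t in (-r)..x, η t, ⟨?_, ?_⟩, hderiv⟩
  · rw [contDiff_infty_iff_deriv, hderiv]
    exact ⟨fun x => (hasDerivAt_primitive h.continuous (-r) x).differentiableAt, h.1⟩
  · refine HasCompactSupport.intro (isCompact_Icc (a := -r) (b := r)) fun x hx => ?_
    rcases lt_or_ge x (-r) with hlt | hge
    · refine intervalIntegral.integral_zero_ae (Eventually.of_forall fun t ht => ?_)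
      rw [uIoc_of_ge hlt.le] at ht
      exact image_eq_zero_of_notMem_tsupport fun hmem => (hr hmem).1.not_ge ht.2
    · have hsupp : Function.support η ⊆ Ioc (-r) x := fun t ht =>
        have hmem := hr (subset_tsupport η ht)
        ⟨hmem.1, hmem.2.le.trans (not_le.1 fun hle => hx ⟨hge, hle⟩).le⟩
      exact (intervalIntegral.integral_eq_integral_of_support_subset hsupp).trans h0

lemma exists_isTestFunction_integral_eq_one : ∃ θ, IsTestFunction θ ∧ ∫ x, θ x = 1 := by
  let f : ContDiffBump (0 : ℝ) := ⟨1, 2, one_pos, one_lt_two⟩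
  exact ⟨f.normed volume, ⟨f.contDiff_normed, f.hasCompactSupport_normed⟩, f.integral_normed⟩

lemma IsTestFunction.sub_const_mul {ψ θ : ℝ → ℝ} (hψ : IsTestFunction ψ) (hθ : IsTestFunction θ)
    (k : ℝ) : IsTestFunction fun x => ψ x - k * θ x :=
  ⟨hψ.1.sub (contDiff_const.mul hθ.1), hψ.2.sub hθ.2.mul_left⟩

/-- Every test function is, up to a multiple of a fixed one of integral `1`, a derivative of a
test function. -/
lemma exists_forall_eq_mul_integral {L : (ℝ → ℝ) → ℝ}
    (hL : ∀ χ θ k, IsTestFunction χ → IsTestFunction θ →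
      L (fun x => deriv χ x + k * θ x) = k * L θ) :
    ∃ k, ∀ ψ, IsTestFunction ψ → L ψ = k * ∫ x, ψ x := by
  obtain ⟨θ, hθ, h1⟩ := exists_isTestFunction_integral_eq_one
  refine ⟨L θ, fun ψ hψ => ?_⟩
  obtain ⟨χ, hχ, hd⟩ := (hψ.sub_const_mul hθ (∫ t, ψ t)).exists_primitive (by
    rw [integral_sub hψ.integrable (hθ.integrable.const_mul _), integral_const_mul, h1]
    ring)
  have hsplit : ψ = fun x => deriv χ x + (∫ t, ψ t) * θ x := by
    simp only [hd, sub_add_cancel]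
  calc L ψ = L fun x => deriv χ x + (∫ t, ψ t) * θ x := by rw [← hsplit]
    _ = L θ * ∫ x, ψ x := by rw [hL χ θ _ hχ hθ, mul_comm]

lemma eq_const_of_integral_mul_deriv_eq_zero {F : ℝ → ℝ} (hF : Continuous F)
    (h : ∀ ψ, IsTestFunction ψ → ∫ x, F x * deriv ψ x = 0) : ∃ k, ∀ x, F x = k := by
  have hint : ∀ {ψ}, IsTestFunction ψ → Integrable fun x => F x * ψ x := fun hψ =>
    hψ.integrable_mul hF.locallyIntegrable
  obtain ⟨k, hk⟩ := exists_forall_eq_mul_integral (L := fun ψ => ∫ x, F x * ψ x)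
    fun χ θ k hχ hθ => by
      simp only [mul_add, mul_left_comm (F _)]
      rw [integral_add (hint hχ.deriv) ((hint hθ).const_mul k), h χ hχ, integral_const_mul,
        zero_add]
  have hc : Continuous fun x => F x - k := hF.sub continuous_const
  have hae : (fun x => F x - k) =ᵐ[volume] fun _ => 0 :=
    ae_eq_zero_of_forall_isTestFunction hc.locallyIntegrable fun ψ hψ => by
      simp only [sub_mul]
      rw [integral_sub (hint hψ) (hψ.integrable.const_mul k), hk ψ hψ, integral_const_mul,
        sub_self]
  exact ⟨k, fun x => sub_eq_zero.1 (congrFun ((hc.ae_eq_iff_eq _ continuous_const).1 hae) x)⟩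

lemma eq_affine_of_integral_mul_deriv_deriv_eq_zero {F : ℝ → ℝ} (hF : Continuous F)
    (h : ∀ ψ, IsTestFunction ψ → ∫ x, F x * deriv (deriv ψ) x = 0) :
    ∃ α β, ∀ x, F x = α * x + β := by
  have hint : ∀ {ψ}, IsTestFunction ψ → Integrable fun x => F x * ψ x := fun hψ =>
    hψ.integrable_mul hF.locallyIntegrable
  obtain ⟨k, hk⟩ := exists_forall_eq_mul_integral (L := fun ψ => ∫ x, F x * deriv ψ x)
    fun χ θ k hχ hθ => by
      have hd : deriv (fun x => deriv χ x + k * θ x) = fun x => deriv (deriv χ) x + k * deriv θ x :=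
        funext fun x => ((hχ.deriv.hasDerivAt x).add ((hθ.hasDerivAt x).const_mul k)).deriv
      simp only [hd, mul_add, mul_left_comm (F _)]
      rw [integral_add (hint hχ.deriv.deriv) ((hint hθ.deriv).const_mul k), h χ hχ,
        integral_const_mul, zero_add]
  have hlin : Continuous fun x : ℝ => k * x := continuous_const_mul k
  obtain ⟨β, hβ⟩ := eq_const_of_integral_mul_deriv_eq_zero (hF.add hlin) fun ψ hψ => by
    have hparts := hψ.integral_mul_deriv (F := fun x => k * x) (F' := fun _ => k)
      (fun x => by simpa using (hasDerivAt_id x).const_mul k) continuous_const.locallyIntegrable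
    simp only [Pi.add_apply, add_mul]
    rw [integral_add (hint hψ.deriv) (hψ.deriv.integrable_mul hlin.locallyIntegrable), hk ψ hψ,
      hparts, integral_const_mul, add_neg_cancel]
  refine ⟨-k, β, fun x => ?_⟩
  rw [← hβ x, Pi.add_apply]
  ring

lemma intervalIntegrable_of_locallyIntegrable {f : ℝ → ℝ} (hf : LocallyIntegrable f) (a b : ℝ) :
    IntervalIntegrable f volume a b :=
  (hf.integrableOn_isCompact isCompact_uIcc).intervalIntegrable

lemma continuous_primitive_of_locallyIntegrable {f : ℝ → ℝ} (hf : LocallyIntegrable f) :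
    Continuous fun x => ∫ t in (0 : ℝ)..x, f t :=
  intervalIntegral.continuous_primitive (intervalIntegrable_of_locallyIntegrable hf) 0

lemma integral_primitive_mul_deriv {f : ℝ → ℝ} (hf : LocallyIntegrable f) {ψ : ℝ → ℝ}
    (hψ : IsTestFunction ψ) :
    ∫ x, (∫ t in (0 : ℝ)..x, f t) * deriv ψ x = -∫ x, f x * ψ x := by
  obtain ⟨r₀, hr₀⟩ := hψ.exists_tsupport_subset_Ioo
  obtain ⟨r, hr0, hr⟩ : ∃ r, 0 ≤ r ∧ tsupport ψ ⊆ Ioo (-r) r :=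
    ⟨|r₀|, abs_nonneg _, hr₀.trans (Ioo_subset_Ioo (neg_le_neg (le_abs_self _)) (le_abs_self _))⟩
  have hψr : ψ r = 0 := image_eq_zero_of_notMem_tsupport fun hmem => (hr hmem).2.ne rfl
  have hψr' : ψ (-r) = 0 := image_eq_zero_of_notMem_tsupport fun hmem => (hr hmem).1.ne rfl
  have hrestrict : ∀ {p q : ℝ → ℝ}, Function.support q ⊆ tsupport ψ →
      ∫ x, p x * q x = ∫ x in (-r)..r, p x * q x := fun hq =>
    (intervalIntegral.integral_eq_integral_of_support_subset
      ((Function.support_mul_subset_right _ _).trans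
        (hq.trans (hr.trans Ioo_subset_Ioc_self)))).symm
  have hfi := intervalIntegrable_of_locallyIntegrable hf (-r) r
  have hac : AbsolutelyContinuousOnInterval (fun x => ∫ t in (0 : ℝ)..x, f t) (-r) r :=
    hfi.absolutelyContinuousOnInterval_intervalIntegral (by
      rw [uIcc_of_le (by linarith)]
      exact ⟨by linarith, hr0⟩)
  have hψac : AbsolutelyContinuousOnInterval ψ (-r) r :=
    (hψ.1.of_le (by simp)).contDiffOn.absolutelyContinuousOnInterval
  have hcongr : ∫ x in (-r)..r, deriv (fun x => ∫ t in (0 : ℝ)..x, f t) x * ψ x =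
      ∫ x in (-r)..r, f x * ψ x := by
    refine intervalIntegral.integral_congr_ae ?_
    filter_upwards [LocallyIntegrable.ae_hasDerivAt_integral hf] with x hx _
    rw [(hx 0).deriv]
  rw [hrestrict support_deriv_subset, hrestrict (subset_tsupport ψ),
    hac.integral_mul_deriv_eq_deriv_mul hψac, hψr, hψr', hcongr, mul_zero, mul_zero, sub_zero,
    zero_sub]

lemma IsWeakDeriv.ae_eq_deriv {f g : ℝ → ℝ} (h : IsWeakDeriv f g) (hf : Continuous f) :
    ∀ᵐ x, g x = deriv f x := by
  have hP := continuous_primitive_of_locallyIntegrable h.2.1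
  obtain ⟨k, hk⟩ := eq_const_of_integral_mul_deriv_eq_zero (hf.sub hP) fun ψ hψ => by
    simp only [Pi.sub_apply, sub_mul]
    rw [integral_sub (hψ.deriv.integrable_mul hf.locallyIntegrable)
      (hψ.deriv.integrable_mul hP.locallyIntegrable), h.2.2 ψ hψ,
      integral_primitive_mul_deriv h.2.1 hψ, sub_self]
  have hfP : f = fun x => (∫ t in (0 : ℝ)..x, g t) + k := funext fun x => by
    rw [← hk x, Pi.sub_apply, add_sub_cancel]
  filter_upwards [LocallyIntegrable.ae_hasDerivAt_integral h.2.1] with x hx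
  rw [hfP, ((hx 0).add_const k).deriv]

lemma exists_hasDerivAt_of_integral_mul_deriv_deriv {F f : ℝ → ℝ} (hF : Continuous F)
    (hf : LocallyIntegrable f)
    (h : ∀ ψ, IsTestFunction ψ → ∫ x, F x * deriv (deriv ψ) x = ∫ x, f x * ψ x) :
    ∃ α, ∀ x, HasDerivAt F ((∫ t in (0 : ℝ)..x, f t) + α) x := by
  have hP := continuous_primitive_of_locallyIntegrable hf
  set P : ℝ → ℝ := fun x => ∫ t in (0 : ℝ)..x, f t with hPdef
  have hQ := hasDerivAt_primitive hP 0
  have hQc := continuous_primitive_of_locallyIntegrable hP.locallyIntegrable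
  obtain ⟨α, β, hαβ⟩ := eq_affine_of_integral_mul_deriv_deriv_eq_zero (hF.sub hQc) fun ψ hψ => by
    simp only [Pi.sub_apply, sub_mul]
    rw [integral_sub (hψ.deriv.deriv.integrable_mul hF.locallyIntegrable)
      (hψ.deriv.deriv.integrable_mul hQc.locallyIntegrable), h ψ hψ,
      hψ.deriv.integral_mul_deriv hQ hP.locallyIntegrable, hPdef,
      integral_primitive_mul_deriv hf hψ, neg_neg, sub_self]
  refine ⟨α, fun x => ?_⟩
  have hlin : HasDerivAt (fun x : ℝ => α * x + β) α x := by
    simpa using ((hasDerivAt_id x).const_mul α).add_const β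
  refine ((hQ x).add hlin).congr_of_eventuallyEq (Eventually.of_forall fun y => ?_)
  simp only [Pi.add_apply, ← hαβ y, Pi.sub_apply, add_sub_cancel]

/-! ### Traveling waves as solutions away from the singular height -/

/-- `φ` is continuous and, where `φ ≠ c`, a classical solution of the once integrated equation
`2 (φ - c) φ'' + φ'² = 4 μ φ - a`. -/
structure SolvesOff (μ c a : ℝ) (φ : ℝ → ℝ) : Prop where
  continuous : Continuous φ
  differentiableAt : ∀ x, φ x ≠ c → DifferentiableAt ℝ φ x
  hasDerivAt_deriv : ∀ x, φ x ≠ c → HasDerivAt (deriv φ)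
    ((4 * μ * φ x - a - deriv φ x ^ 2) / (2 * (φ x - c))) x

/-- The derivative of `φ` where `φ ≠ c`, and zero elsewhere: the weak derivative of a solution. -/
noncomputable def offDeriv (c : ℝ) (φ : ℝ → ℝ) : ℝ → ℝ :=
  {x | φ x ≠ c}.indicator (deriv φ)

lemma isOpen_ne_height {c : ℝ} {φ : ℝ → ℝ} (h : Continuous φ) : IsOpen {x | φ x ≠ c} :=
  isOpen_ne_fun h continuous_const

lemma eventually_ne_height {c : ℝ} {φ : ℝ → ℝ} {x : ℝ} (h : Continuous φ) (hx : φ x ≠ c) :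
    ∀ᶠ y in 𝓝 x, φ y ≠ c :=
  (isOpen_ne_height h).mem_nhds hx

lemma measurableSet_eq_height {c : ℝ} {φ : ℝ → ℝ} (h : Continuous φ) :
    MeasurableSet {x | φ x = c} :=
  (isClosed_eq h continuous_const).measurableSet

lemma offDeriv_of_ne {c : ℝ} {φ : ℝ → ℝ} {x : ℝ} (h : φ x ≠ c) : offDeriv c φ x = deriv φ x :=
  indicator_of_mem (s := {x | φ x ≠ c}) h _

section Weak

variable {μ c a : ℝ} {φ : ℝ → ℝ}

lemma SolvesOff.hasDerivAt (h : SolvesOff μ c a φ) {x : ℝ} (hx : φ x ≠ c) :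
    HasDerivAt φ (deriv φ x) x :=
  (h.differentiableAt x hx).hasDerivAt

lemma SolvesOff.squareEquation (h : SolvesOff μ c a φ) :
    SquareEquation (fun x => φ x - c) (offDeriv c φ) (fun x => 4 * μ * φ x - a) where
  continuous := h.continuous.sub continuous_const
  continuous_source := (h.continuous.const_mul _).sub continuous_const
  eq_zero x hx := indicator_of_notMem (s := {x | φ x ≠ c}) (not_not.2 (sub_eq_zero.1 hx)) _
  hasDerivAt x hx := by
    rw [offDeriv_of_ne (sub_ne_zero.1 hx)]
    exact (h.hasDerivAt (sub_ne_zero.1 hx)).sub_const c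
  hasDerivAt_mul x hx := by
    have hφx := sub_ne_zero.1 hx
    have hoff : offDeriv c φ =ᶠ[𝓝 x] deriv φ := by
      filter_upwards [eventually_ne_height h.continuous hφx] with y hy using offDeriv_of_ne hy
    refine ((((h.hasDerivAt hφx).sub_const c).const_mul 2).fun_mul
      ((h.hasDerivAt_deriv x hφx).congr_of_eventuallyEq hoff)).congr_deriv ?_
    rw [offDeriv_of_ne hφx]
    field_simp
    ring

lemma SolvesOff.isWeakDeriv (h : SolvesOff μ c a φ) : IsWeakDeriv φ (offDeriv c φ) := by
  simpa using h.squareEquation.isWeakDeriv.add_const c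

lemma SolvesOff.isH1LocWithDeriv (h : SolvesOff μ c a φ) : IsH1LocWithDeriv φ (offDeriv c φ) :=
  ⟨h.continuous, (locallyIntegrable_sq_iff_memL2Loc h.continuous.aestronglyMeasurable).1
    (h.continuous.pow 2).locallyIntegrable, h.squareEquation.memL2Loc, h.isWeakDeriv⟩

lemma SolvesOff.integral_sq_mul (h : SolvesOff μ c a φ) {ψ : ℝ → ℝ} (hψ : IsTestFunction ψ) :
    ∫ x, offDeriv c φ x ^ 2 * ψ x =
      (∫ x, (-4 * μ * φ x + a) * ψ x) + (∫ x, (φ x - c) ^ 2 * deriv (deriv ψ) x) +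
        (4 * μ * c - a) * ∫ x in {x | φ x = c}, ψ x := by
  have hsplit := integral_add_compl (measurableSet_eq_height (c := c) h.continuous)
    (hψ.integrable_mul h.squareEquation.continuous_source.locallyIntegrable)
  have hheight : ∫ x in {x | φ x = c}, (4 * μ * φ x - a) * ψ x =
      (4 * μ * c - a) * ∫ x in {x | φ x = c}, ψ x := by
    rw [← integral_const_mul]
    exact setIntegral_congr_fun (measurableSet_eq_height h.continuous) fun x hx => by
      rw [show φ x = c from hx]
  have hneg : ∫ x, (-4 * μ * φ x + a) * ψ x = -∫ x, (4 * μ * φ x - a) * ψ x := by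
    rw [← integral_neg]
    congr 1 with x
    ring
  have hcompl : {x | φ x = c}ᶜ = {x | φ x - c ≠ 0} := by
    ext x
    exact sub_ne_zero.symm
  rw [h.squareEquation.integral_sq_mul_deriv_deriv hψ, hneg, ← hsplit, hheight, hcompl]
  ring

theorem SolvesOff.isTravelingWave (h : SolvesOff μ c a φ)
    (h0 : volume {x | φ x = c} = 0 ∨ a = 4 * μ * c) : IsTravelingWave μ c φ := by
  refine ⟨offDeriv c φ, h.isH1LocWithDeriv, a, fun ψ hψ => ?_⟩
  rw [h.integral_sq_mul hψ]
  rcases h0 with h0 | h0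
  · rw [setIntegral_measure_zero _ h0, mul_zero, add_zero]
  · rw [h0, sub_self, zero_mul, add_zero]

theorem SolvesOff.volume_eq_zero_or (h : SolvesOff μ c a φ) {g : ℝ → ℝ} (hg : IsWeakDeriv φ g)
    (hw : ∀ ψ : ℝ → ℝ, IsTestFunction ψ → ∫ x, (g x) ^ 2 * ψ x =
        (∫ x, (-4 * μ * φ x + a) * ψ x) + ∫ x, (φ x - c) ^ 2 * deriv (deriv ψ) x) :
    volume {x | φ x = c} = 0 ∨ a = 4 * μ * c := by
  by_contra! hcon
  have hmeas := measurableSet_eq_height (c := c) h.continuous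
  have hae : ∀ᵐ x, g x = offDeriv c φ x := by
    filter_upwards [hg.ae_eq_deriv h.continuous, h.isWeakDeriv.ae_eq_deriv h.continuous]
      with x hx hx' using hx.trans hx'.symm
  have hdefect : ∀ ψ, IsTestFunction ψ → ∫ x in {x | φ x = c}, ψ x = 0 := fun ψ hψ => by
    have hcongr : ∫ x, (g x) ^ 2 * ψ x = ∫ x, offDeriv c φ x ^ 2 * ψ x :=
      integral_congr_ae (by filter_upwards [hae] with x hx; rw [hx])
    exact (mul_eq_zero.1 (by linarith [hw ψ hψ, h.integral_sq_mul hψ] :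
      (4 * μ * c - a) * ∫ x in {x | φ x = c}, ψ x = 0)).resolve_left (sub_ne_zero.2 hcon.2.symm)
  have hzero := ae_eq_zero_of_forall_isTestFunction
    (f := {x | φ x = c}.indicator fun _ => 1)
    ((locallyIntegrable_const (1 : ℝ)).indicator hmeas) fun ψ hψ => by
      simp only [← indicator_mul_left, one_mul]
      rw [integral_indicator hmeas, hdefect ψ hψ]
  refine hcon.1 (measure_eq_zero_iff_ae_notMem.2 ?_)
  filter_upwards [hzero] with x hx hmem
  exact one_ne_zero ((indicator_of_mem (s := {x | φ x = c}) hmem (fun _ => (1 : ℝ))).symm.trans hx)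

lemma hasDerivAt_of_hasDerivAt_sq {v : ℝ → ℝ} {x d : ℝ} (hv : ContinuousAt v x) (hx : v x ≠ 0)
    (h : HasDerivAt (fun y => v y ^ 2) d x) : HasDerivAt v (d / (2 * v x)) x := by
  have hsqrt : HasDerivAt (fun y => √(v y ^ 2)) (d / (2 * √(v x ^ 2))) x :=
    h.sqrt (pow_ne_zero 2 hx)
  simp only [Real.sqrt_sq_eq_abs] at hsqrt
  rcases lt_or_gt_of_ne hx with h0 | h0
  · rw [abs_of_neg h0, mul_neg, div_neg] at hsqrt
    refine (hsqrt.neg.congr_of_eventuallyEq ?_).congr_deriv (neg_neg _)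
    filter_upwards [hv.eventually_lt continuousAt_const h0] with y hy
    rw [Pi.neg_apply, abs_of_neg hy, neg_neg]
  · rw [abs_of_pos h0] at hsqrt
    refine hsqrt.congr_of_eventuallyEq ?_
    filter_upwards [continuousAt_const.eventually_lt hv h0] with y hy
    rw [abs_of_pos hy]

lemma solvesOff_of_hasDerivAt_sq {q α : ℝ} {f : ℝ → ℝ} (hc : Continuous φ)
    (hf : LocallyIntegrable f)
    (hsq : ∀ x, HasDerivAt (fun x => (φ x - c) ^ 2) ((∫ t in q..x, f t) + α) x)
    (hfφ : ∀ x, f x = deriv φ x ^ 2 + (4 * μ * φ x - a)) : SolvesOff μ c a φ := by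
  have hP : Continuous fun x => ∫ t in q..x, f t :=
    intervalIntegral.continuous_primitive (intervalIntegrable_of_locallyIntegrable hf) q
  have hφ : ∀ x, φ x ≠ c → HasDerivAt φ (((∫ t in q..x, f t) + α) / (2 * (φ x - c))) x :=
    fun x hx => by
      simpa using (hasDerivAt_of_hasDerivAt_sq (v := fun x => φ x - c)
        (hc.sub continuous_const).continuousAt (sub_ne_zero.2 hx) (hsq x)).add_const c
  refine ⟨hc, fun x hx => (hφ x hx).differentiableAt, fun x hx => ?_⟩
  have hne : 2 * (φ x - c) ≠ 0 := mul_ne_zero two_ne_zero (sub_ne_zero.2 hx)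
  have hderiv : deriv φ =ᶠ[𝓝 x] fun x => ((∫ t in q..x, f t) + α) / (2 * (φ x - c)) := by
    filter_upwards [eventually_ne_height hc hx] with y hy using (hφ y hy).deriv
  have hcont : ContinuousAt (deriv φ) x :=
    ((hP.add continuous_const).continuousAt.div
      ((hc.sub continuous_const).const_mul 2).continuousAt hne).congr hderiv.symm
  have hfx : ContinuousAt f x := by
    rw [funext hfφ]
    exact (hcont.pow 2).add ((hc.const_mul _).sub continuous_const).continuousAt
  have hPx : HasDerivAt (fun x => ∫ t in q..x, f t) (f x) x :=
    intervalIntegral.integral_hasDerivAt_right (intervalIntegrable_of_locallyIntegrable hf q x)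
      ⟨univ, univ_mem, hf.aestronglyMeasurable.restrict⟩ hfx
  refine (((hPx.add_const α).fun_div (((hφ x hx).sub_const c).const_mul 2)
    hne).congr_of_eventuallyEq hderiv).congr_deriv ?_
  rw [hfφ, (hφ x hx).deriv]
  field_simp [sub_ne_zero.2 hx]
  ring

theorem IsTravelingWave.exists_solvesOff (h : IsTravelingWave μ c φ) :
    ∃ a, SolvesOff μ c a φ ∧ (volume {x | φ x = c} = 0 ∨ a = 4 * μ * c) := by
  obtain ⟨g, ⟨hc, -, hg2, hg⟩, a, hw⟩ := h
  have hsource : Continuous fun x => 4 * μ * φ x - a := (hc.const_mul _).sub continuous_const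
  have hf := hg2.locallyIntegrable_sq.add hsource.locallyIntegrable
  have hcongr : ∀ᵐ x, g x ^ 2 + (4 * μ * φ x - a) = deriv φ x ^ 2 + (4 * μ * φ x - a) := by
    filter_upwards [hg.ae_eq_deriv hc] with x hx
    rw [hx]
  obtain ⟨α, hα⟩ := exists_hasDerivAt_of_integral_mul_deriv_deriv
    (F := fun x => (φ x - c) ^ 2) ((hc.sub continuous_const).pow 2) (hf.congr hcongr) fun ψ hψ => by
      have hneg : ∫ x, (-4 * μ * φ x + a) * ψ x = -∫ x, (4 * μ * φ x - a) * ψ x := by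
        rw [← integral_neg]
        congr 1 with x
        ring
      rw [← integral_congr_ae (hcongr.mono fun x hx => congrArg (· * ψ x) hx)]
      simp only [add_mul]
      rw [integral_add (hψ.integrable_mul hg2.locallyIntegrable_sq)
        (hψ.integrable_mul hsource.locallyIntegrable)]
      linarith [hw ψ hψ]
  have hs := solvesOff_of_hasDerivAt_sq hc (hf.congr hcongr) hα fun x => rfl
  exact ⟨a, hs, hs.volume_eq_zero_or hg hw⟩

end Weak

/-! ### Uniqueness, regularity and the first integral -/

section Classical

variable {μ c a : ℝ} {φ w : ℝ → ℝ}

lemma SolvesOff.continuousAt_deriv (h : SolvesOff μ c a φ) {x : ℝ} (hx : φ x ≠ c) :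
    ContinuousAt (deriv φ) x :=
  (h.hasDerivAt_deriv x hx).continuousAt

/-- The right-hand side of the first-order system for `(φ, φ')`. -/
noncomputable def systemField (μ c a : ℝ) (p : ℝ × ℝ) : ℝ × ℝ :=
  (p.2, (4 * μ * p.1 - a - p.2 ^ 2) / (2 * (p.1 - c)))

lemma contDiffAt_systemField {p : ℝ × ℝ} (hp : p.1 ≠ c) :
    ContDiffAt ℝ 1 (systemField μ c a) p := by
  refine contDiffAt_snd.prodMk (ContDiffAt.div ?_ ?_ ?_)
  · fun_prop
  · fun_prop
  · exact mul_ne_zero two_ne_zero (sub_ne_zero.2 hp)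

lemma SolvesOff.eventually_hasDerivAt_systemField (h : SolvesOff μ c a φ) {x : ℝ} (hx : φ x ≠ c)
    {t : Set (ℝ × ℝ)} (ht : t ∈ 𝓝 (φ x, deriv φ x)) :
    ∀ᶠ y in 𝓝 x, HasDerivAt (fun y => (φ y, deriv φ y))
      (systemField μ c a (φ y, deriv φ y)) y ∧ (φ y, deriv φ y) ∈ t := by
  filter_upwards [eventually_ne_height h.continuous hx,
    (h.continuous.continuousAt.prodMk (h.continuousAt_deriv hx)).eventually_mem ht] with y hy hyt
  exact ⟨(h.hasDerivAt hy).prodMk (h.hasDerivAt_deriv y hy), hyt⟩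

lemma SolvesOff.eventually_eq (h : SolvesOff μ c a φ) (hw : SolvesOff μ c a w) {x : ℝ}
    (hx : φ x ≠ c) (h0 : φ x = w x) (h1 : deriv φ x = deriv w x) :
    ∀ᶠ y in 𝓝 x, φ y = w y ∧ deriv φ y = deriv w y := by
  obtain ⟨K, t, ht, hK⟩ :=
    (contDiffAt_systemField (μ := μ) (a := a) (p := (φ x, deriv φ x)) hx).exists_lipschitzOnWith
  have heq := ODE_solution_unique_of_eventually (v := fun _ => systemField μ c a) (s := fun _ => t)
    (Eventually.of_forall fun _ => hK) (h.eventually_hasDerivAt_systemField hx ht)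
    (hw.eventually_hasDerivAt_systemField (h0 ▸ hx) (by rwa [← h0, ← h1])) (by simp [h0, h1])
  filter_upwards [heq] with y hy using Prod.ext_iff.1 hy

theorem SolvesOff.eqOn (h : SolvesOff μ c a φ) (hw : SolvesOff μ c a w) {x : ℝ} {s : Set ℝ}
    (hs : IsPreconnected s) (hxs : x ∈ s) (hsc : ∀ y ∈ s, φ y ≠ c)
    (h0 : φ x = w x) (h1 : deriv φ x = deriv w x) : EqOn φ w s := by
  set u : Set ℝ := {y | φ y ≠ c ∧ φ y = w y ∧ deriv φ y = deriv w y}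
  have hu : IsOpen u := by
    rw [isOpen_iff_mem_nhds]
    rintro y ⟨hy, hy0, hy1⟩
    filter_upwards [eventually_ne_height h.continuous hy, h.eventually_eq hw hy hy0 hy1]
      with z hz hz' using ⟨hz, hz'⟩
  have hsu : s ⊆ u := by
    refine hs.subset_of_closure_inter_subset hu ⟨x, hxs, hsc x hxs, h0, h1⟩ ?_
    rintro y ⟨hyu, hys⟩
    have hval : φ y = w y :=
      (isClosed_eq h.continuous hw.continuous).closure_subset_iff.2 (fun z hz => hz.2.1) hyu
    refine ⟨hsc y hys, hval, ?_⟩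
    by_contra hne
    have hev : ∀ᶠ z in 𝓝 y, deriv φ z - deriv w z ≠ 0 :=
      ((h.continuousAt_deriv (hsc y hys)).sub
        (hw.continuousAt_deriv (hval ▸ hsc y hys))).eventually_ne (sub_ne_zero.2 hne)
    obtain ⟨z, hz, hz'⟩ := ((mem_closure_iff_frequently.1 hyu).and_eventually hev).exists
    exact hz' (sub_eq_zero.2 hz.2.2)
  exact fun y hy => (hsu hy).2.1

lemma connectedComponentIn_ne_subset {f g : ℝ → ℝ} {x : ℝ} (hx : f x ≠ c)
    (h : EqOn f g (connectedComponentIn {y | f y ≠ c} x)) :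
    connectedComponentIn {y | f y ≠ c} x ⊆ connectedComponentIn {y | g y ≠ c} x :=
  isPreconnected_connectedComponentIn.subset_connectedComponentIn
    (mem_connectedComponentIn hx) fun y hy => by
      have hy' : f y ≠ c := connectedComponentIn_subset _ _ hy
      rwa [h hy] at hy'

theorem SolvesOff.connectedComponentIn_eq (h : SolvesOff μ c a φ) (hw : SolvesOff μ c a w)
    {x : ℝ} (hx : φ x ≠ c) (h0 : φ x = w x) (h1 : deriv φ x = deriv w x) :
    connectedComponentIn {y | φ y ≠ c} x = connectedComponentIn {y | w y ≠ c} x ∧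
      EqOn φ w (connectedComponentIn {y | φ y ≠ c} x) := by
  have hwx : w x ≠ c := h0 ▸ hx
  have hφw := h.eqOn hw (isPreconnected_connectedComponentIn (F := {y | φ y ≠ c}))
    (mem_connectedComponentIn hx) (fun y hy => connectedComponentIn_subset _ _ hy) h0 h1
  have hwφ := hw.eqOn h (isPreconnected_connectedComponentIn (F := {y | w y ≠ c}))
    (mem_connectedComponentIn hwx) (fun y hy => connectedComponentIn_subset _ _ hy) h0.symm h1.symm
  exact ⟨(connectedComponentIn_ne_subset hx hφw).antisymm
    (connectedComponentIn_ne_subset hwx hwφ), hφw⟩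

lemma SolvesOff.contDiffOn (h : SolvesOff μ c a φ) : ContDiffOn ℝ ∞ φ {x | φ x ≠ c} := by
  have hU := isOpen_ne_height (c := c) h.continuous
  have hreg (n : ℕ) :
      ContDiffOn ℝ n φ {x | φ x ≠ c} ∧ ContDiffOn ℝ n (deriv φ) {x | φ x ≠ c} := by
    induction n with
    | zero =>
      exact ⟨contDiffOn_zero.2 h.continuous.continuousOn,
        contDiffOn_zero.2 fun x hx => (h.continuousAt_deriv hx).continuousWithinAt⟩
    | succ n ih =>
      obtain ⟨hφ, hdφ⟩ := ih
      push_cast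
      rw [contDiffOn_succ_iff_deriv_of_isOpen hU, contDiffOn_succ_iff_deriv_of_isOpen hU]
      have hrhs : ContDiffOn ℝ n (fun x => (4 * μ * φ x - a - deriv φ x ^ 2) / (2 * (φ x - c)))
          {x | φ x ≠ c} :=
        ContDiffOn.div (((contDiffOn_const.mul hφ).sub contDiffOn_const).sub (hdφ.pow 2))
          (contDiffOn_const.mul (hφ.sub contDiffOn_const)) fun x hx =>
            mul_ne_zero two_ne_zero (sub_ne_zero.2 hx)
      exact ⟨⟨fun x hx => (h.differentiableAt x hx).differentiableWithinAt, by simp, hdφ⟩,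
        fun x hx => (h.hasDerivAt_deriv x hx).differentiableAt.differentiableWithinAt, by simp,
        hrhs.congr fun x hx => (h.hasDerivAt_deriv x hx).deriv⟩
  exact contDiffOn_infty.2 fun n => (hreg n).1

lemma SolvesOff.comp_add_const (h : SolvesOff μ c a φ) (s : ℝ) :
    SolvesOff μ c a fun x => φ (x + s) := by
  have hd : deriv (fun x => φ (x + s)) = fun x => deriv φ (x + s) :=
    funext fun x => deriv_comp_add_const φ s x
  refine ⟨h.continuous.comp (continuous_add_const s), fun x hx => ?_, fun x hx => ?_⟩
  · exact ((h.hasDerivAt hx).comp_add_const x s).differentiableAt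
  · rw [hd]
    exact (h.hasDerivAt_deriv (x + s) hx).comp_add_const x s

lemma SolvesOff.comp_neg (h : SolvesOff μ c a φ) : SolvesOff μ c a fun x => φ (-x) := by
  have hd : deriv (fun x => φ (-x)) = fun x => -deriv φ (-x) := funext fun x => deriv_comp_neg φ x
  refine ⟨h.continuous.comp continuous_neg, fun x hx => ?_, fun x hx => ?_⟩
  · exact (h.differentiableAt (-x) hx).comp x differentiableAt_id.neg
  · rw [hd]
    refine ((h.hasDerivAt_deriv (-x) hx).comp x (hasDerivAt_neg x)).neg.congr_deriv ?_
    ring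

lemma SolvesOff.constant_unique (h : SolvesOff μ c a φ) {a' x : ℝ} (h' : SolvesOff μ c a' φ)
    (hx : φ x ≠ c) : a = a' := by
  have hne := sub_ne_zero.2 hx
  have hsecond := (h.hasDerivAt_deriv x hx).unique (h'.hasDerivAt_deriv x hx)
  field_simp at hsecond
  linarith

/-- The first integral of the equation: it is constant on each component of `{φ ≠ c}`. -/
noncomputable def firstIntegral (μ c a : ℝ) (φ : ℝ → ℝ) (x : ℝ) : ℝ :=
  (φ x - c) * deriv φ x ^ 2 - 2 * μ * φ x ^ 2 + a * φ x

lemma SolvesOff.hasDerivAt_firstIntegral (h : SolvesOff μ c a φ) {x : ℝ} (hx : φ x ≠ c) :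
    HasDerivAt (firstIntegral μ c a φ) 0 x := by
  have hφ := h.hasDerivAt hx
  have hne := sub_ne_zero.2 hx
  refine ((((hφ.sub_const c).fun_mul ((h.hasDerivAt_deriv x hx).fun_pow 2)).fun_sub
    ((hφ.fun_pow 2).const_mul (2 * μ))).fun_add (hφ.const_mul a)).congr_deriv ?_
  field_simp
  ring

lemma SolvesOff.firstIntegral_eq (h : SolvesOff μ c a φ) {s : Set ℝ} (ho : IsOpen s)
    (hs : IsPreconnected s) (hsc : ∀ y ∈ s, φ y ≠ c) {x y : ℝ} (hx : x ∈ s) (hy : y ∈ s) :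
    firstIntegral μ c a φ x = firstIntegral μ c a φ y :=
  ho.is_const_of_deriv_eq_zero hs
    (fun z hz => (h.hasDerivAt_firstIntegral (hsc z hz)).differentiableAt.differentiableWithinAt)
    (fun z hz => (h.hasDerivAt_firstIntegral (hsc z hz)).deriv) hx hy

lemma HasParameters.mul_sq {m M : ℝ} (h : HasParameters μ c m M φ) {x : ℝ} (hx : φ x ≠ c) :
    (c - φ x) * deriv φ x ^ 2 = 2 * μ * (M - φ x) * (φ x - m) := by
  rw [(h x hx).2, mul_div_cancel₀ _ (sub_ne_zero.2 hx.symm)]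

lemma SolvesOff.eq_of_hasParameters (h : SolvesOff μ c a φ) {m M : ℝ}
    (hp : HasParameters μ c m M φ) {x : ℝ} (hx : φ x ≠ c) (hd : deriv φ x ≠ 0) :
    a = 2 * μ * (m + M) := by
  have hfirst : firstIntegral μ c a φ =ᶠ[𝓝 x]
      fun y => (a - 2 * μ * (m + M)) * φ y + 2 * μ * m * M := by
    filter_upwards [eventually_ne_height h.continuous hx] with y hy
    simp only [firstIntegral]
    linarith [hp.mul_sq hy]
  have hzero : (a - 2 * μ * (m + M)) * deriv φ x = 0 :=
    ((((h.hasDerivAt hx).const_mul _).add_const _).congr_of_eventuallyEq hfirst).unique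
      (h.hasDerivAt_firstIntegral hx)
  exact sub_eq_zero.1 ((mul_eq_zero.1 hzero).resolve_right hd)

theorem IsTravelingWave.solvesOff_of_hasParameters (hμ : μ ≠ 0) (h : IsTravelingWave μ c φ)
    {m M : ℝ} (hp : HasParameters μ c m M φ) {x : ℝ} (hc : φ x ≠ c) (hm : φ x ≠ m)
    (hM : φ x ≠ M) : SolvesOff μ c (2 * μ * (m + M)) φ := by
  obtain ⟨a, ha, -⟩ := h.exists_solvesOff
  have hd : deriv φ x ≠ 0 := fun hzero => by
    have hrhs : 2 * μ * (M - φ x) * (φ x - m) ≠ 0 :=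
      mul_ne_zero (mul_ne_zero (mul_ne_zero two_ne_zero hμ) (sub_ne_zero.2 hM.symm))
        (sub_ne_zero.2 hm)
    rw [← hp.mul_sq hc, hzero] at hrhs
    simp at hrhs
  rwa [ha.eq_of_hasParameters hp hc hd] at ha

lemma SolvesOff.hasParameters_of_firstIntegral {m M : ℝ}
    (h : SolvesOff μ c (2 * μ * (m + M)) φ)
    (hb : ∀ x, φ x ≠ c → firstIntegral μ c (2 * μ * (m + M)) φ x = 2 * μ * m * M) :
    HasParameters μ c m M φ := by
  intro x hx
  refine ⟨h.differentiableAt x hx, ?_⟩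
  have hfirst := hb x hx
  rw [firstIntegral] at hfirst
  rw [eq_div_iff (sub_ne_zero.2 hx.symm)]
  linarith

end Classical

/-! ### Construction of solutions by a change of the independent variable -/

/-- The independent variable `x = ∫ √W dy` as a function of the parameter `y` in which
`W = |φ - c|` satisfies a linear equation. -/
noncomputable def arcX (W : ℝ → ℝ) (y : ℝ) : ℝ := ∫ t in (0 : ℝ)..y, √(W t)

section ChangeOfVariable

variable {W : ℝ → ℝ}

@[simp] lemma arcX_zero : arcX W 0 = 0 := intervalIntegral.integral_same

lemma arcX_sub_arcX (hW : Continuous W) (y z : ℝ) :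
    arcX W z - arcX W y = ∫ t in y..z, √(W t) :=
  intervalIntegral.integral_interval_sub_left (hW.sqrt.intervalIntegrable _ _)
    (hW.sqrt.intervalIntegrable _ _)

lemma hasDerivAt_arcX (hW : Continuous W) (y : ℝ) : HasDerivAt (arcX W) (√(W y)) y :=
  intervalIntegral.integral_hasDerivAt_right (hW.sqrt.intervalIntegrable _ _)
    (hW.sqrt.stronglyMeasurableAtFilter _ _) hW.sqrt.continuousAt

lemma strictMono_arcX (hW : Continuous W) (h0 : ∀ y, 0 ≤ W y) (hz : {y | W y = 0}.Countable) :
    StrictMono (arcX W) := by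
  intro y z hyz
  obtain ⟨t, ht, hyt, htz⟩ := (hz.dense_compl ℝ).exists_between hyz
  rw [← sub_pos, arcX_sub_arcX hW]
  exact intervalIntegral.integral_pos hyz hW.sqrt.continuousOn (fun t _ => Real.sqrt_nonneg _)
    ⟨t, ⟨hyt.le, htz.le⟩, Real.sqrt_pos.2 (lt_of_le_of_ne (h0 t) (Ne.symm ht))⟩

lemma arcX_add_period (hW : Continuous W) {L : ℝ} (hper : Function.Periodic W L) (y : ℝ) :
    arcX W (y + L) = arcX W y + arcX W L := by
  have hperS : Function.Periodic (fun y => √(W y)) L := fun y => by simp only [hper y]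
  have h := hperS.intervalIntegral_add_eq y 0
  rw [zero_add, ← arcX_sub_arcX hW] at h
  exact sub_eq_iff_eq_add'.1 h

lemma arcX_neg (heven : ∀ t, W (-t) = W t) (y : ℝ) : arcX W (-y) = -arcX W y := by
  have h := intervalIntegral.integral_comp_neg (a := 0) (b := y) (fun t => √(W t))
  simp only [heven, neg_zero] at h
  rw [arcX, arcX, h, intervalIntegral.integral_symm]

lemma tendsto_arcX_atTop (hW : Continuous W) {δ : ℝ} (hδ : 0 < δ) {q : ℝ}
    (h : ∀ y, q ≤ y → δ ≤ W y) : Tendsto (arcX W) atTop atTop := by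
  have hlin : Tendsto (fun y => arcX W q + √δ * (y - q)) atTop atTop :=
    tendsto_atTop_add_const_left _ _ ((tendsto_atTop_add_const_right _ (-q)
      tendsto_id).const_mul_atTop (Real.sqrt_pos.2 hδ))
  refine tendsto_atTop_mono' _ ?_ hlin
  filter_upwards [eventually_ge_atTop q] with y hy
  have hint : ∫ _ in q..y, √δ ≤ ∫ t in q..y, √(W t) :=
    intervalIntegral.integral_mono_on hy intervalIntegrable_const
      (hW.sqrt.intervalIntegrable _ _) fun t ht => Real.sqrt_le_sqrt (h t ht.1)
  rw [intervalIntegral.integral_const, smul_eq_mul, ← arcX_sub_arcX hW] at hint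
  linarith

lemma exists_orderIso_arcX (hW : Continuous W) (h0 : ∀ y, 0 ≤ W y)
    (hz : {y | W y = 0}.Countable) (htop : Tendsto (arcX W) atTop atTop)
    (hbot : Tendsto (arcX W) atBot atBot) : ∃ Y : ℝ ≃o ℝ, ∀ y, Y.symm y = arcX W y := by
  have hsurj : Function.Surjective (arcX W) :=
    (continuous_iff_continuousAt.2 fun y => (hasDerivAt_arcX hW y).continuousAt).surjective
      htop hbot
  exact ⟨((strictMono_arcX hW h0 hz).orderIsoOfSurjective _ hsurj).symm, fun y => rfl⟩

lemma exists_orderIso_arcX_of_periodic (hW : Continuous W) (h0 : ∀ y, 0 ≤ W y)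
    (hz : {y | W y = 0}.Countable) {L : ℝ} (hper : Function.Periodic W L) (hL : 0 < L) :
    ∃ Y : ℝ ≃o ℝ, ∀ y, Y.symm y = arcX W y := by
  have hperS : Function.Periodic (fun y => √(W y)) L := fun y => by simp only [hper y]
  have hpos : 0 < arcX W L := arcX_zero (W := W) ▸ strictMono_arcX hW h0 hz hL
  exact exists_orderIso_arcX hW h0 hz (hperS.tendsto_atTop_intervalIntegral_of_pos hpos hL)
    (hperS.tendsto_atBot_intervalIntegral_of_pos hpos hL)

variable {Y : ℝ ≃o ℝ}

lemma apply_arcX (hY : ∀ y, Y.symm y = arcX W y) (y : ℝ) : Y (arcX W y) = y := by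
  rw [← hY, OrderIso.apply_symm_apply]

lemma apply_add_arcX_period (hY : ∀ y, Y.symm y = arcX W y) (hW : Continuous W) {L : ℝ}
    (hper : Function.Periodic W L) (x : ℝ) : Y (x + arcX W L) = Y x + L := by
  rw [← Y.symm_apply_apply x, hY, ← arcX_add_period hW hper, apply_arcX hY, apply_arcX hY]

lemma hasDerivAt_param (hW : Continuous W) (hY : ∀ y, Y.symm y = arcX W y) {x : ℝ}
    (h0 : 0 < W (Y x)) : HasDerivAt Y (√(W (Y x)))⁻¹ x := by
  refine HasDerivAt.of_local_left_inverse (f := arcX W) Y.continuous.continuousAt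
    (hasDerivAt_arcX hW (Y x)) (Real.sqrt_pos.2 h0).ne' (Eventually.of_forall fun z => ?_)
  rw [← hY, OrderIso.symm_apply_apply]

end ChangeOfVariable

/-- A modulus `W = |φ - c|` in the parameter of `arcX`: a nonnegative function with countably many
zeros that, away from them, has the derivative `W'` and solves `W'' = 2 μ (s W - κ)`. The sign `s`
tells on which side of `c` the wave `φ = c + s W` lies. -/
structure IsModulus (μ κ s : ℝ) (W W' : ℝ → ℝ) : Prop where
  continuous : Continuous W
  nonneg : ∀ y, 0 ≤ W y
  countable_zeros : {y | W y = 0}.Countable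
  hasDerivAt : ∀ y, W y ≠ 0 → HasDerivAt W (W' y) y
  hasDerivAt_deriv : ∀ y, W y ≠ 0 → HasDerivAt W' (2 * μ * (s * W y - κ)) y

namespace IsModulus

variable {μ c κ s : ℝ} {W W' : ℝ → ℝ} {Y : ℝ ≃o ℝ}

lemma pos (h : IsModulus μ κ s W W') {y : ℝ} (hy : W y ≠ 0) : 0 < W y :=
  lt_of_le_of_ne (h.nonneg y) hy.symm

lemma strictMono_arcX (h : IsModulus μ κ s W W') : StrictMono (arcX W) :=
  MuHS.strictMono_arcX h.continuous h.nonneg h.countable_zeros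

lemma hasDerivAt_profile (h : IsModulus μ κ s W W') (hY : ∀ y, Y.symm y = arcX W y) {x : ℝ}
    (hx : W (Y x) ≠ 0) :
    HasDerivAt (fun x => c + s * W (Y x)) (s * (W' (Y x) / √(W (Y x)))) x :=
  ((((h.hasDerivAt _ hx).comp x (hasDerivAt_param h.continuous hY (h.pos hx))).const_mul
    s).const_add c).congr_deriv (by rw [div_eq_mul_inv])

lemma mul_deriv_profile (h : IsModulus μ κ s W W') (hY : ∀ y, Y.symm y = arcX W y)
    (hs : s ^ 2 = 1) {x : ℝ} (hx : W (Y x) ≠ 0) :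
    s * deriv (fun x => c + s * W (Y x)) x = W' (Y x) / √(W (Y x)) := by
  rw [(h.hasDerivAt_profile hY hx).deriv, ← mul_assoc, ← sq, hs, one_mul]

theorem solvesOff_profile (h : IsModulus μ κ s W W') (hY : ∀ y, Y.symm y = arcX W y)
    (hs : s ^ 2 = 1) : SolvesOff μ c (4 * μ * (c + κ)) fun x => c + s * W (Y x) := by
  have hs0 : s ≠ 0 := by
    rintro rfl
    norm_num at hs
  have hcW : Continuous fun x => W (Y x) := h.continuous.comp Y.continuous
  have hne : ∀ x, c + s * W (Y x) ≠ c → W (Y x) ≠ 0 := fun x hx h0 => hx (by rw [h0]; ring)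
  refine ⟨(hcW.const_mul s).const_add c,
    fun x hx => (h.hasDerivAt_profile hY (hne x hx)).differentiableAt, fun x hx => ?_⟩
  have hderiv : deriv (fun x => c + s * W (Y x)) =ᶠ[𝓝 x]
      fun x => s * (W' (Y x) / √(W (Y x))) := by
    filter_upwards [hcW.continuousAt.eventually_ne (hne x hx)] with z hz
    exact (h.hasDerivAt_profile hY hz).deriv
  have hpos : 0 < √(W (Y x)) := Real.sqrt_pos.2 (h.pos (hne x hx))
  have hYx := hasDerivAt_param h.continuous hY (h.pos (hne x hx))
  have hquot := (((h.hasDerivAt_deriv _ (hne x hx)).comp x hYx).fun_div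
    (((h.hasDerivAt _ (hne x hx)).comp x hYx).sqrt (hne x hx)) hpos.ne').const_mul s
  refine (hquot.congr_of_eventuallyEq hderiv).congr_deriv ?_
  rw [hderiv.eq_of_nhds]
  simp only [Function.comp_apply]
  have hsq : W (Y x) = √(W (Y x)) ^ 2 := (Real.sq_sqrt (h.nonneg _)).symm
  set r := √(W (Y x))
  have hden : c + s * r ^ 2 - c = s * r ^ 2 := by ring
  rw [hsq, hden]
  field_simp
  rw [hs]
  ring

end IsModulus

/-! ### Arches -/

/-- An arch: a `T`-periodic solution `φ` which on the period `(x₀, x₀ + T)` moves strictly away from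
the height `c` (upwards if `s = 1`, downwards if `s = -1`), from the value `e` at `x₀` to the value
`m` at `p`, and then moves strictly back. For `e = c` the solution breaks down at the end points;
for `e ≠ c` it is smooth. -/
structure IsArch (μ c a s e m : ℝ) (φ : ℝ → ℝ) (x₀ T p : ℝ) : Prop where
  solves : SolvesOff μ c a φ
  sq_sign : s ^ 2 = 1
  height_le : s * c ≤ s * e
  periodic : Function.Periodic φ T
  mem : p ∈ Ioo x₀ (x₀ + T)
  value_end : φ x₀ = e
  value_mid : φ p = m
  critical : deriv φ p = 0
  sign_left : ∀ x ∈ Ioo x₀ p, 0 < s * deriv φ x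
  sign_right : ∀ x ∈ Ioo p (x₀ + T), s * deriv φ x < 0

theorem IsModulus.exists_isArch {μ κ s j : ℝ} {W W' : ℝ → ℝ} (h : IsModulus μ κ s W W') (c : ℝ)
    (hs : s ^ 2 = 1) (hj : 0 < j) (hper : Function.Periodic W (2 * j))
    (hne : ∀ y ∈ Ioo (-j) j, W y ≠ 0) (hcrit : W' 0 = 0) (hleft : ∀ y ∈ Ioo (-j) 0, 0 < W' y)
    (hright : ∀ y ∈ Ioo 0 j, W' y < 0) :
    ∃ φ x₀ T p, IsArch μ c (4 * μ * (c + κ)) s (c + s * W j) (c + s * W 0) φ x₀ T p := by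
  obtain ⟨Y, hY⟩ := exists_orderIso_arcX_of_periodic h.continuous h.nonneg h.countable_zeros hper
    (by positivity)
  have hYX := apply_arcX hY
  have hY0 : Y 0 = 0 := by rw [← arcX_zero (W := W), hYX, arcX_zero]
  have hend : arcX W (-j) + arcX W (2 * j) = arcX W j := by
    rw [← arcX_add_period h.continuous hper]
    ring_nf
  have hnegj : arcX W (-j) < 0 :=
    (h.strictMono_arcX (neg_neg_of_pos hj)).trans_eq arcX_zero
  have hposj : 0 < arcX W j := arcX_zero.symm.trans_lt (h.strictMono_arcX hj)
  have hYleft : ∀ x ∈ Ioo (arcX W (-j)) 0, Y x ∈ Ioo (-j) 0 := fun x hx =>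
    ⟨hYX (-j) ▸ Y.strictMono hx.1, (Y.strictMono hx.2).trans_eq hY0⟩
  have hYright : ∀ x ∈ Ioo 0 (arcX W j), Y x ∈ Ioo 0 j := fun x hx =>
    ⟨hY0.symm.trans_lt (Y.strictMono hx.1), hYX j ▸ Y.strictMono hx.2⟩
  have hsqrt : ∀ y, W y ≠ 0 → 0 < √(W y) := fun y hy => Real.sqrt_pos.2 (h.pos hy)
  refine ⟨fun x => c + s * W (Y x), arcX W (-j), arcX W (2 * j), 0, h.solvesOff_profile hY hs, hs,
    ?_, fun x => ?_, ⟨hnegj, hend ▸ hposj⟩, ?_, by rw [hY0], ?_, fun x hx => ?_, fun x hx => ?_⟩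
  · rw [mul_add, ← mul_assoc, ← sq, hs, one_mul]
    exact le_add_of_nonneg_right (h.nonneg j)
  · simp only [apply_add_arcX_period hY h.continuous hper, hper (Y x)]
  · rw [hYX, ← hper (-j)]
    ring_nf
  · have hW0 : W (Y 0) ≠ 0 := by
      rw [hY0]
      exact hne 0 ⟨neg_neg_of_pos hj, hj⟩
    rw [(h.hasDerivAt_profile hY hW0).deriv, hY0, hcrit, zero_div, mul_zero]
  · have hy := hYleft x hx
    have hWx := hne _ ⟨hy.1, hy.2.trans hj⟩
    rw [h.mul_deriv_profile hY hs hWx]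
    exact div_pos (hleft _ hy) (hsqrt _ hWx)
  · have hy := hYright x (hend ▸ hx)
    have hWx := hne _ ⟨(neg_neg_of_pos hj).trans hy.1, hy.2⟩
    rw [h.mul_deriv_profile hY hs hWx]
    exact div_neg_of_neg_of_pos (hright _ hy) (hsqrt _ hWx)

section PeriodicExtension

variable {p a : ℝ} (hp : 0 < p)

lemma hasDerivAt_toIcoMod {y : ℝ} (hy : toIcoMod hp a y ≠ a) :
    HasDerivAt (toIcoMod hp a) 1 y := by
  have hmod : ¬y ≡ a [PMOD p] := fun h =>
    hy ((AddCommGroup.modEq_iff_toIcoMod_eq_left hp).1 h.symm)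
  refine ((hasDerivAt_id y).sub_const (toIcoDiv hp a y • p)).congr_of_eventuallyEq ?_
  filter_upwards [eventuallyEq_toIcoDiv_nhds hp a hmod] with z hz
  rw [toIcoMod, hz, id]

lemma continuous_comp_toIcoMod {V : ℝ → ℝ} (hV : Continuous V) (h : V a = V (a + p)) :
    Continuous fun y => V (toIcoMod hp a y) := by
  have : Fact (0 < p) := ⟨hp⟩
  exact (AddCircle.liftIco_continuous h hV.continuousOn).comp (AddCircle.continuous_mk' p)

lemma countable_setOf_toIcoMod_eq (b : ℝ) : {y | toIcoMod hp a y = b}.Countable := by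
  refine (countable_range fun k : ℤ => b + k • p).mono fun y hy => ?_
  obtain ⟨-, k, hk⟩ := (toIcoMod_eq_iff hp).1 hy
  exact ⟨k, hk.symm⟩

end PeriodicExtension

/-- The modulus `V` of an arch that meets the height `c`, in the parameter of `arcX`: on `[-j, j]`
it increases from `0` to its maximum at `0` and decreases back to `0`. Only the restriction of `V`
to `[-j, j]` is of interest; the equation is assumed everywhere for convenience. -/
structure IsArchModulus (μ κ s j : ℝ) (V V' : ℝ → ℝ) : Prop where
  width_pos : 0 < j
  hasDerivAt : ∀ y, HasDerivAt V (V' y) y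
  hasDerivAt_deriv : ∀ y, HasDerivAt V' (2 * μ * (s * V y - κ)) y
  pos : ∀ y ∈ Ioo (-j) j, 0 < V y
  zero_left : V (-j) = 0
  zero_right : V j = 0
  critical : V' 0 = 0
  sign_left : ∀ y ∈ Ioo (-j) 0, 0 < V' y
  sign_right : ∀ y ∈ Ioo 0 j, V' y < 0

namespace IsArchModulus

variable {μ κ s j : ℝ} {V V' : ℝ → ℝ}

lemma two_mul_width_pos (h : IsArchModulus μ κ s j V V') : 0 < 2 * j :=
  mul_pos two_pos h.width_pos

lemma isModulus_periodicExtension (h : IsArchModulus μ κ s j V V') :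
    IsModulus μ κ s (fun y => V (toIcoMod h.two_mul_width_pos (-j) y))
      (fun y => V' (toIcoMod h.two_mul_width_pos (-j) y)) := by
  have hp := h.two_mul_width_pos
  have hadd : -j + 2 * j = j := by ring
  have hmem (y : ℝ) : toIcoMod hp (-j) y ∈ Ico (-j) j :=
    Ico_subset_Ico_right hadd.le (toIcoMod_mem_Ico hp (-j) y)
  have hpos {y : ℝ} (hy : toIcoMod hp (-j) y ≠ -j) : 0 < V (toIcoMod hp (-j) y) :=
    h.pos _ ⟨lt_of_le_of_ne (hmem y).1 hy.symm, (hmem y).2⟩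
  have hne {y : ℝ} (hy : V (toIcoMod hp (-j) y) ≠ 0) : toIcoMod hp (-j) y ≠ -j :=
    fun heq => hy (by rw [heq, h.zero_left])
  have hcont : Continuous V := continuous_iff_continuousAt.2 fun y => (h.hasDerivAt y).continuousAt
  refine ⟨continuous_comp_toIcoMod hp hcont ?_, fun y => ?_,
    (countable_setOf_toIcoMod_eq hp (a := -j) (-j)).mono fun y hy => ?_, fun y hy => ?_,
    fun y hy => ?_⟩
  · rw [hadd, h.zero_left, h.zero_right]
  · obtain heq | hy := eq_or_ne (toIcoMod hp (-j) y) (-j)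
    · rw [heq, h.zero_left]
    · exact (hpos hy).le
  · exact by_contra fun hy' => (hpos hy').ne' hy
  · exact ((h.hasDerivAt _).comp y (hasDerivAt_toIcoMod hp (hne hy))).congr_deriv (mul_one _)
  · exact ((h.hasDerivAt_deriv _).comp y (hasDerivAt_toIcoMod hp (hne hy))).congr_deriv (mul_one _)

theorem exists_isArch (h : IsArchModulus μ κ s j V V') (c : ℝ) (hs : s ^ 2 = 1) :
    ∃ φ x₀ T p, IsArch μ c (4 * μ * (c + κ)) s c (c + s * V 0) φ x₀ T p := by
  have hj := h.width_pos
  have hself {y : ℝ} (hy : y ∈ Ico (-j) j) : toIcoMod h.two_mul_width_pos (-j) y = y := by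
    rw [toIcoMod_eq_self, two_mul, neg_add_cancel_left]
    exact hy
  have hself0 := hself ⟨neg_nonpos.2 hj.le, hj⟩
  have hselfj : toIcoMod h.two_mul_width_pos (-j) j = -j :=
    (toIcoMod_eq_iff _).2 ⟨by simpa using hj, 1, by ring⟩
  obtain ⟨φ, x₀, T, p, hφ⟩ := h.isModulus_periodicExtension.exists_isArch c hs hj
    (fun y => by rw [toIcoMod_periodic])
    (fun y hy => by rw [hself ⟨hy.1.le, hy.2⟩]; exact (h.pos y hy).ne')
    (by rw [hself0, h.critical])
    (fun y hy => by rw [hself ⟨hy.1.le, hy.2.trans hj⟩]; exact h.sign_left y hy)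
    (fun y hy => by
      rw [hself ⟨((neg_neg_of_pos hj).trans hy.1).le, hy.2⟩]; exact h.sign_right y hy)
  rw [hself0, hselfj, h.zero_left, mul_zero, add_zero] at hφ
  exact ⟨φ, x₀, T, p, hφ⟩

end IsArchModulus

section ExplicitArches

variable {μ c m M : ℝ}

lemma hasDerivAt_cos_profile (k B ν y : ℝ) :
    HasDerivAt (fun y => k + B * Real.cos (ν * y)) (-(B * ν) * Real.sin (ν * y)) y :=
  (((((hasDerivAt_id y).const_mul ν).cos).const_mul B).const_add k).congr_deriv
    (by simp only [id_eq]; ring)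

lemma hasDerivAt_sin_profile (k ν y : ℝ) :
    HasDerivAt (fun y => k * Real.sin (ν * y)) (k * ν * Real.cos (ν * y)) y :=
  ((((hasDerivAt_id y).const_mul ν).sin).const_mul k).congr_deriv (by simp only [id_eq]; ring)

lemma hasDerivAt_cosh_profile (k B ν y : ℝ) :
    HasDerivAt (fun y => k - B * Real.cosh (ν * y)) (-(B * ν) * Real.sinh (ν * y)) y :=
  (((((hasDerivAt_id y).const_mul ν).cosh).const_mul B).const_sub k).congr_deriv
    (by simp only [id_eq]; ring)

lemma hasDerivAt_sinh_profile (k ν y : ℝ) :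
    HasDerivAt (fun y => k * Real.sinh (ν * y)) (k * ν * Real.cosh (ν * y)) y :=
  ((((hasDerivAt_id y).const_mul ν).sinh).const_mul k).congr_deriv (by simp only [id_eq]; ring)

lemma hasDerivAt_deriv_cos_profile (hμ : 0 ≤ μ) (k B y : ℝ) :
    HasDerivAt (fun y => -(B * √(2 * μ)) * Real.sin (√(2 * μ) * y))
      (2 * μ * (-1 * (k + B * Real.cos (√(2 * μ) * y)) - -k)) y :=
  (hasDerivAt_sin_profile _ _ y).congr_deriv (by
    have hsq : √(2 * μ) ^ 2 = 2 * μ := Real.sq_sqrt (by positivity)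
    linear_combination -B * Real.cos (√(2 * μ) * y) * hsq)

lemma hasDerivAt_deriv_cosh_profile (hμ : 0 ≤ μ) (k B y : ℝ) :
    HasDerivAt (fun y => -(B * √(2 * μ)) * Real.sinh (√(2 * μ) * y))
      (2 * μ * (1 * (k - B * Real.cosh (√(2 * μ) * y)) - k)) y :=
  (hasDerivAt_sinh_profile _ _ y).congr_deriv (by
    have hsq : √(2 * μ) ^ 2 = 2 * μ := Real.sq_sqrt (by positivity)
    linear_combination -B * Real.cosh (√(2 * μ) * y) * hsq)

lemma neg_mul_sin_pos {B ν j y : ℝ} (hB : 0 < B * ν) (hν : 0 < ν) (hj : ν * j ≤ Real.pi)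
    (hy : y ∈ Ioo (-j) 0) : 0 < -(B * ν) * Real.sin (ν * y) :=
  mul_pos_of_neg_of_neg (neg_neg_of_pos hB) <|
    Real.sin_neg_of_neg_of_neg_pi_lt (mul_neg_of_pos_of_neg hν hy.2) (by nlinarith [hy.1])

lemma neg_mul_sin_neg {B ν j y : ℝ} (hB : 0 < B * ν) (hν : 0 < ν) (hj : ν * j ≤ Real.pi)
    (hy : y ∈ Ioo 0 j) : -(B * ν) * Real.sin (ν * y) < 0 :=
  mul_neg_of_neg_of_pos (neg_neg_of_pos hB) <|
    Real.sin_pos_of_pos_of_lt_pi (mul_pos hν hy.1) (by nlinarith [hy.2])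

lemma isArchModulus_cos (hμ : 0 < μ) {k B : ℝ} (hB : 0 < B) (hk : -B < k) (hk' : k ≤ B) :
    IsArchModulus μ (-k) (-1) (Real.arccos (-k / B) / √(2 * μ))
      (fun y => k + B * Real.cos (√(2 * μ) * y))
      (fun y => -(B * √(2 * μ)) * Real.sin (√(2 * μ) * y)) := by
  have hν : 0 < √(2 * μ) := Real.sqrt_pos.2 (by positivity)
  have hBν := mul_pos hB hν
  set j := Real.arccos (-k / B) / √(2 * μ)
  have hνj : √(2 * μ) * j = Real.arccos (-k / B) := mul_div_cancel₀ _ hν.ne'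
  have hlt : -k / B < 1 := (div_lt_one hB).2 (by linarith)
  have hge : -1 ≤ -k / B := (le_div_iff₀ hB).2 (by linarith)
  have hcos : k + B * Real.cos (√(2 * μ) * j) = 0 := by
    rw [hνj, Real.cos_arccos hge hlt.le]
    field_simp
    ring
  have hπ : √(2 * μ) * j ≤ Real.pi := hνj ▸ Real.arccos_le_pi _
  refine ⟨div_pos (Real.arccos_pos.2 hlt) hν, hasDerivAt_cos_profile _ _ _,
    hasDerivAt_deriv_cos_profile hμ.le k B, fun y hy => ?_, by simpa using hcos, hcos,
    by simp, fun y => neg_mul_sin_pos hBν hν hπ, fun y => neg_mul_sin_neg hBν hν hπ⟩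
  have habs : |√(2 * μ) * y| < √(2 * μ) * j := by
    rw [abs_mul, abs_of_pos hν]
    exact mul_lt_mul_of_pos_left (abs_lt.2 hy) hν
  have hlt := Real.cos_lt_cos_of_nonneg_of_le_pi (abs_nonneg _) hπ habs
  rw [Real.cos_abs] at hlt
  rw [← hcos]
  gcongr

lemma isArchModulus_cosh (hμ : 0 < μ) {k B : ℝ} (hB : 0 < B) (hk : B < k) :
    IsArchModulus μ k 1 (Real.arcosh (k / B) / √(2 * μ))
      (fun y => k - B * Real.cosh (√(2 * μ) * y))
      (fun y => -(B * √(2 * μ)) * Real.sinh (√(2 * μ) * y)) := by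
  have hν : 0 < √(2 * μ) := Real.sqrt_pos.2 (by positivity)
  have hBν := neg_neg_of_pos (mul_pos hB hν)
  set j := Real.arcosh (k / B) / √(2 * μ) with hj
  have hlt : 1 < k / B := (one_lt_div hB).2 hk
  have hjpos : 0 < j := div_pos (Real.arcosh_pos hlt) hν
  have hcosh : k - B * Real.cosh (√(2 * μ) * j) = 0 := by
    rw [hj, mul_div_cancel₀ _ hν.ne', Real.cosh_arcosh hlt.le, mul_div_cancel₀ _ hB.ne', sub_self]
  refine ⟨hjpos, hasDerivAt_cosh_profile _ _ _, hasDerivAt_deriv_cosh_profile hμ.le k B,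
    fun y hy => ?_, by simpa using hcosh, hcosh, by simp,
    fun y hy => mul_pos_of_neg_of_neg hBν (Real.sinh_neg_iff.2 (mul_neg_of_pos_of_neg hν hy.2)),
    fun y hy => mul_neg_of_neg_of_pos hBν (Real.sinh_pos_iff.2 (mul_pos hν hy.1))⟩
  have hlt : Real.cosh (√(2 * μ) * y) < Real.cosh (√(2 * μ) * j) := by
    rw [Real.cosh_lt_cosh, abs_mul, abs_mul, abs_of_pos hν, abs_of_pos hjpos]
    exact mul_lt_mul_of_pos_left (abs_lt.2 hy) hν
  rw [← hcosh]
  gcongr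

theorem exists_isArch_below (hμ : 0 < μ) (hm : m < c) (hM : c ≤ M) :
    ∃ φ x₀ T p, IsArch μ c (2 * μ * (m + M)) (-1) c m φ x₀ T p := by
  have h := (isArchModulus_cos hμ (k := c - (m + M) / 2) (B := (M - m) / 2) (by linarith)
    (by linarith) (by linarith)).exists_isArch c (by norm_num)
  simp only [mul_zero, Real.cos_zero] at h
  rwa [show 4 * μ * (c + -(c - (m + M) / 2)) = 2 * μ * (m + M) by ring,
    show c + -1 * (c - (m + M) / 2 + (M - m) / 2 * 1) = m by ring] at h

theorem exists_isArch_above (hμ : 0 < μ) (hm : c < m) (hM : m < M) :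
    ∃ φ x₀ T p, IsArch μ c (2 * μ * (m + M)) 1 c m φ x₀ T p := by
  have h := (isArchModulus_cosh hμ (k := (m + M) / 2 - c) (B := (M - m) / 2) (by linarith)
    (by linarith)).exists_isArch c (by norm_num)
  simp only [mul_zero, Real.cosh_zero] at h
  rwa [show 4 * μ * (c + ((m + M) / 2 - c)) = 2 * μ * (m + M) by ring,
    show c + 1 * ((m + M) / 2 - c - (M - m) / 2 * 1) = m by ring] at h

theorem exists_isArch_smooth (hμ : 0 < μ) (hm : m < M) (hM : M < c) :
    ∃ φ x₀ T p, IsArch μ c (2 * μ * (m + M)) (-1) M m φ x₀ T p := by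
  have hν : 0 < √(2 * μ) := Real.sqrt_pos.2 (by positivity)
  have hB : 0 < (M - m) / 2 := by linarith
  have hνj : √(2 * μ) * (Real.pi / √(2 * μ)) = Real.pi := mul_div_cancel₀ _ hν.ne'
  set k := c - (m + M) / 2 with hk
  have hpos (y : ℝ) : 0 < k + (M - m) / 2 * Real.cos (√(2 * μ) * y) := by
    nlinarith [Real.neg_one_le_cos (√(2 * μ) * y)]
  have hmodulus : IsModulus μ (-k) (-1) (fun y => k + (M - m) / 2 * Real.cos (√(2 * μ) * y))
      (fun y => -((M - m) / 2 * √(2 * μ)) * Real.sin (√(2 * μ) * y)) :=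
    ⟨by fun_prop, fun y => (hpos y).le, countable_empty.mono fun y hy => (hpos y).ne' hy,
      fun y _ => hasDerivAt_cos_profile _ _ _ y,
      fun y _ => hasDerivAt_deriv_cos_profile hμ.le _ _ y⟩
  have h := hmodulus.exists_isArch c (by norm_num) (div_pos Real.pi_pos hν)
    (fun y => by simp only [mul_add, mul_left_comm _ (2 : ℝ), hνj, Real.cos_add_two_pi])
    (fun y _ => (hpos y).ne') (by simp)
    (fun y => neg_mul_sin_pos (mul_pos hB hν) hν hνj.le)
    (fun y => neg_mul_sin_neg (mul_pos hB hν) hν hνj.le)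
  simp only [hνj, mul_zero, Real.cos_zero, Real.cos_pi] at h
  rwa [show 4 * μ * (c + -k) = 2 * μ * (m + M) by ring,
    show c + -1 * (k + (M - m) / 2 * -1) = M by ring,
    show c + -1 * (k + (M - m) / 2 * 1) = m by ring] at h

end ExplicitArches

/-! ### The limiting arch on the line -/

/-- The limiting case `M = m > c` of an arch, on the whole line: a solution that descends strictly
from `m` at `-∞` to the height `c` at `x₀` and ascends strictly back to `m` at `+∞`. -/
structure IsLineArch (μ c a m : ℝ) (φ : ℝ → ℝ) (x₀ : ℝ) : Prop where
  solves : SolvesOff μ c a φ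
  parameters : HasParameters μ c m m φ
  zeros : ∀ x, φ x = c ↔ x = x₀
  lt : ∀ x, φ x < m
  sign_left : ∀ x < x₀, deriv φ x < 0
  sign_right : ∀ x > x₀, 0 < deriv φ x
  limit_right : Tendsto φ atTop (𝓝 m)
  limit_left : Tendsto φ atBot (𝓝 m)

/-- The modulus `|φ - c|` of the line arch of amplitude `d`, in the parameter of `arcX`. -/
noncomputable def lineModulus (d ν y : ℝ) : ℝ := d * (1 - Real.exp (-(ν * |y|)))

/-- The derivative of `lineModulus d ν` away from `0`. -/
noncomputable def lineModulusDeriv (d ν y : ℝ) : ℝ :=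
  d * ν * SignType.sign y * Real.exp (-(ν * |y|))

section LineModulus

variable {μ c d m ν y : ℝ}

lemma continuous_lineModulus : Continuous (lineModulus d ν) := by
  unfold lineModulus
  fun_prop

@[simp] lemma lineModulus_zero : lineModulus d ν 0 = 0 := by simp [lineModulus]

lemma lineModulus_neg (y : ℝ) : lineModulus d ν (-y) = lineModulus d ν y := by
  rw [lineModulus, lineModulus, abs_neg]

lemma lineModulus_lt (hd : 0 < d) (y : ℝ) : lineModulus d ν y < d :=
  mul_lt_of_lt_one_right hd (sub_lt_self _ (Real.exp_pos _))

lemma lineModulus_pos (hd : 0 < d) (hν : 0 < ν) (hy : y ≠ 0) : 0 < lineModulus d ν y := by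
  refine mul_pos hd (sub_pos.2 (Real.exp_lt_one_iff.2 ?_))
  exact neg_neg_of_pos (mul_pos hν (abs_pos.2 hy))

lemma lineModulus_eq_zero_iff (hd : 0 < d) (hν : 0 < ν) : lineModulus d ν y = 0 ↔ y = 0 :=
  ⟨fun h => by_contra fun hy => (lineModulus_pos hd hν hy).ne' h, by
    rintro rfl
    exact lineModulus_zero⟩

lemma monotoneOn_lineModulus (hd : 0 ≤ d) (hν : 0 ≤ ν) : MonotoneOn (lineModulus d ν) (Ici 0) := by
  intro y hy z hz hyz
  rw [lineModulus, lineModulus, abs_of_nonneg hy, abs_of_nonneg hz]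
  gcongr

lemma tendsto_lineModulus_atTop (hν : 0 < ν) : Tendsto (lineModulus d ν) atTop (𝓝 d) := by
  have hexp : Tendsto (fun y => Real.exp (-(ν * |y|))) atTop (𝓝 0) :=
    Real.tendsto_exp_neg_atTop_nhds_zero.comp (tendsto_abs_atTop_atTop.const_mul_atTop hν)
  have h := (hexp.const_sub 1).const_mul d
  rwa [sub_zero, mul_one] at h

lemma tendsto_lineModulus_atBot (hν : 0 < ν) : Tendsto (lineModulus d ν) atBot (𝓝 d) :=
  ((tendsto_lineModulus_atTop hν).comp tendsto_neg_atBot_atTop).congr lineModulus_neg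

lemma hasDerivAt_exp_neg_mul_abs (hy : y ≠ 0) : HasDerivAt (fun y => Real.exp (-(ν * |y|)))
    (-(ν * SignType.sign y) * Real.exp (-(ν * |y|))) y :=
  ((hasDerivAt_abs hy).const_mul ν).neg.exp.congr_deriv (mul_comm _ _)

lemma hasDerivAt_lineModulus (hy : y ≠ 0) :
    HasDerivAt (lineModulus d ν) (lineModulusDeriv d ν y) y :=
  (((hasDerivAt_exp_neg_mul_abs hy).const_sub 1).const_mul d).congr_deriv (by
    rw [lineModulusDeriv]
    ring)

lemma sq_sign_of_ne_zero (hy : y ≠ 0) : (SignType.sign y : ℝ) ^ 2 = 1 := by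
  obtain h | h := hy.lt_or_gt
  · simp [sign_neg h]
  · simp [sign_pos h]

lemma hasDerivAt_lineModulusDeriv (hy : y ≠ 0) :
    HasDerivAt (lineModulusDeriv d ν) (ν ^ 2 * (lineModulus d ν y - d)) y := by
  have hsign : ∀ᶠ z in 𝓝 y, SignType.sign z = SignType.sign y :=
    (continuousAt_sign_of_ne_zero hy).eventually (eventually_nhds_iff.2
      ⟨{SignType.sign y}, fun _ => id, isOpen_discrete _, rfl⟩)
  have heq : lineModulusDeriv d ν =ᶠ[𝓝 y]
      fun z => d * ν * SignType.sign y * Real.exp (-(ν * |z|)) := by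
    filter_upwards [hsign] with z hz
    rw [lineModulusDeriv, hz]
  refine (((hasDerivAt_exp_neg_mul_abs hy).const_mul _).congr_of_eventuallyEq heq).congr_deriv ?_
  rw [lineModulus]
  linear_combination -(d * ν ^ 2 * Real.exp (-(ν * |y|))) * sq_sign_of_ne_zero hy

lemma sq_lineModulusDeriv (hy : y ≠ 0) :
    lineModulusDeriv d ν y ^ 2 = ν ^ 2 * (d - lineModulus d ν y) ^ 2 := by
  rw [lineModulusDeriv, lineModulus, mul_pow, mul_pow, sq_sign_of_ne_zero hy]
  ring

lemma isModulus_lineModulus (hμ : 0 < μ) (hd : 0 < d) :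
    IsModulus μ d 1 (lineModulus d √(2 * μ)) (lineModulusDeriv d √(2 * μ)) := by
  have hν : 0 < √(2 * μ) := Real.sqrt_pos.2 (by positivity)
  have hzero {y : ℝ} := lineModulus_eq_zero_iff (y := y) hd hν
  refine ⟨continuous_lineModulus, fun y => ?_, ?_,
    fun y hy => hasDerivAt_lineModulus (mt hzero.2 hy), fun y hy => ?_⟩
  · obtain rfl | hy := eq_or_ne y 0
    · rw [lineModulus_zero]
    · exact (lineModulus_pos hd hν hy).le
  · simp only [hzero]
    exact countable_singleton 0
  · refine (hasDerivAt_lineModulusDeriv (mt hzero.2 hy)).congr_deriv ?_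
    rw [Real.sq_sqrt (by positivity), one_mul]

lemma exists_orderIso_arcX_lineModulus (hμ : 0 < μ) (hd : 0 < d) :
    ∃ Y : ℝ ≃o ℝ, ∀ y, Y.symm y = arcX (lineModulus d √(2 * μ)) y := by
  have hν : 0 < √(2 * μ) := Real.sqrt_pos.2 (by positivity)
  have h := isModulus_lineModulus hμ hd
  have htop := tendsto_arcX_atTop h.continuous (lineModulus_pos hd hν one_ne_zero)
    fun y hy => monotoneOn_lineModulus hd.le hν.le (mem_Ici.2 zero_le_one)
      (mem_Ici.2 (zero_le_one.trans hy)) hy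
  refine exists_orderIso_arcX h.continuous h.nonneg h.countable_zeros htop ?_
  refine (tendsto_neg_atTop_atBot.comp (htop.comp tendsto_neg_atBot_atTop)).congr fun y => ?_
  simp only [Function.comp_apply, arcX_neg lineModulus_neg, neg_neg]

lemma hasParameters_lineProfile (hμ : 0 < μ) (hm : c < m) {Y : ℝ ≃o ℝ}
    (hY : ∀ y, Y.symm y = arcX (lineModulus (m - c) √(2 * μ)) y) :
    HasParameters μ c m m fun x => c + 1 * lineModulus (m - c) √(2 * μ) (Y x) := by
  have h := isModulus_lineModulus hμ (sub_pos.2 hm)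
  intro x hx
  have hne : lineModulus (m - c) √(2 * μ) (Y x) ≠ 0 := fun h0 => hx (by simp only [h0]; ring)
  have hYx : Y x ≠ 0 := fun h0 => hne (by rw [h0, lineModulus_zero])
  have hderiv := h.hasDerivAt_profile (c := c) hY hne
  refine ⟨hderiv.differentiableAt, ?_⟩
  rw [hderiv.deriv, one_mul, div_pow, Real.sq_sqrt (h.nonneg _), sq_lineModulusDeriv hYx,
    Real.sq_sqrt (by positivity), div_eq_div_iff hne (by simpa using hne)]
  ring

theorem exists_isLineArch (hμ : 0 < μ) (hm : c < m) :
    ∃ φ x₀, IsLineArch μ c (2 * μ * (m + m)) m φ x₀ := by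
  have hν : 0 < √(2 * μ) := Real.sqrt_pos.2 (by positivity)
  have hd := sub_pos.2 hm
  have h := isModulus_lineModulus hμ hd
  obtain ⟨Y, hY⟩ := exists_orderIso_arcX_lineModulus hμ hd
  have hY0 : Y 0 = 0 := by rw [← arcX_zero (W := lineModulus _ _), apply_arcX hY, arcX_zero]
  have hderiv {x : ℝ} (hx : Y x ≠ 0) : deriv (fun x => c + 1 * lineModulus (m - c) √(2 * μ) (Y x)) x
      = lineModulusDeriv (m - c) √(2 * μ) (Y x) / √(lineModulus (m - c) √(2 * μ) (Y x)) := by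
    rw [← one_mul (deriv _ x),
      h.mul_deriv_profile hY (one_pow 2) (lineModulus_pos hd hν hx).ne']
  have hsqrt {x : ℝ} (hx : Y x ≠ 0) : 0 < √(lineModulus (m - c) √(2 * μ) (Y x)) :=
    Real.sqrt_pos.2 (lineModulus_pos hd hν hx)
  have hlim {l : Filter ℝ} (hl : Tendsto (lineModulus (m - c) √(2 * μ)) l (𝓝 (m - c))) :
      Tendsto (fun y => c + 1 * lineModulus (m - c) √(2 * μ) y) l (𝓝 m) := by
    simpa using hl.const_add c
  refine ⟨fun x => c + 1 * lineModulus (m - c) √(2 * μ) (Y x), 0, ?_,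
    hasParameters_lineProfile hμ hm hY, fun x => ?_, fun x => ?_, fun x hx => ?_, fun x hx => ?_,
    (hlim (tendsto_lineModulus_atTop hν)).comp Y.tendsto_atTop,
    (hlim (tendsto_lineModulus_atBot hν)).comp Y.tendsto_atBot⟩
  · convert h.solvesOff_profile hY (one_pow 2) using 1
    ring
  · rw [one_mul, add_eq_left, lineModulus_eq_zero_iff hd hν, ← hY0, Y.injective.eq_iff, hY0]
  · linarith [lineModulus_lt (ν := √(2 * μ)) hd (Y x)]
  · have hYx : Y x < 0 := hY0 ▸ Y.strictMono hx
    rw [hderiv hYx.ne, lineModulusDeriv, sign_neg hYx]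
    refine div_neg_of_neg_of_pos ?_ (hsqrt hYx.ne)
    simpa using by positivity
  · have hYx : 0 < Y x := hY0 ▸ Y.strictMono hx
    rw [hderiv hYx.ne', lineModulusDeriv, sign_pos hYx]
    refine div_pos ?_ (hsqrt hYx.ne')
    simpa using by positivity

end LineModulus

/-! ### Slopes at the singular height -/

section Crest

variable {μ c m M s : ℝ} {φ : ℝ → ℝ} {l : Filter ℝ}

lemma sq_mul_deriv (hp : HasParameters μ c m M φ) (hs : s ^ 2 = 1) {x : ℝ} (hx : φ x ≠ c) :
    (s * deriv φ x) ^ 2 = 2 * μ * (M - φ x) * (φ x - m) / (c - φ x) := by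
  rw [mul_pow, hs, one_mul, (hp x hx).2]

lemma tendsto_mul_deriv_atTop (hμ : μ ≠ 0) (hp : HasParameters μ c m M φ) (hm : m ≠ c)
    (hM : M ≠ c) (hs : s ^ 2 = 1) (hl : Tendsto φ l (𝓝 c))
    (hev : ∀ᶠ x in l, φ x ≠ c ∧ 0 < s * deriv φ x) :
    Tendsto (fun x => s * deriv φ x) l atTop := by
  have hden : Tendsto (fun x => |c - φ x|) l (𝓝[>] 0) := by
    refine tendsto_nhdsWithin_iff.2 ⟨?_, ?_⟩
    · simpa using (hl.const_sub c).abs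
    · filter_upwards [hev] with x hx using abs_pos.2 (sub_ne_zero.2 hx.1.symm)
  have hnum : Tendsto (fun x => |2 * μ * (M - φ x) * (φ x - m)|) l
      (𝓝 |2 * μ * (M - c) * (c - m)|) :=
    (((hl.const_sub M).const_mul (2 * μ)).mul (hl.sub_const m)).abs
  have hpos : 0 < |2 * μ * (M - c) * (c - m)| :=
    abs_pos.2 (mul_ne_zero (mul_ne_zero (mul_ne_zero two_ne_zero hμ) (sub_ne_zero.2 hM))
      (sub_ne_zero.2 hm.symm))
  refine (Real.tendsto_sqrt_atTop.comp
    (hnum.pos_mul_atTop hpos (tendsto_inv_nhdsGT_zero.comp hden))).congr' ?_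
  filter_upwards [hev] with x hx
  have hsq : |2 * μ * (M - φ x) * (φ x - m)| * |c - φ x|⁻¹ = (s * deriv φ x) ^ 2 := by
    rw [← abs_inv, ← abs_mul, ← div_eq_mul_inv, ← sq_mul_deriv hp hs hx.1, abs_sq]
  rw [Function.comp_apply, Function.comp_apply, hsq, Real.sqrt_sq hx.2.le]

lemma tendsto_mul_deriv_nhds (hp : HasParameters μ c m c φ) (hs : s ^ 2 = 1)
    (hl : Tendsto φ l (𝓝 c)) (hev : ∀ᶠ x in l, φ x ≠ c ∧ 0 < s * deriv φ x) :
    Tendsto (fun x => s * deriv φ x) l (𝓝 √(2 * μ * (c - m))) := by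
  refine (((hl.sub_const m).const_mul (2 * μ)).sqrt).congr' ?_
  filter_upwards [hev] with x hx
  have hsq : 2 * μ * (φ x - m) = (s * deriv φ x) ^ 2 := by
    have hne : c - φ x ≠ 0 := sub_ne_zero.2 hx.1.symm
    rw [sq_mul_deriv hp hs hx.1]
    field_simp
  rw [hsq, Real.sqrt_sq hx.2.le]

lemma tendsto_deriv_atBot (hμ : μ ≠ 0) (hp : HasParameters μ c m M φ) (hm : m ≠ c) (hM : M ≠ c)
    (hl : Tendsto φ l (𝓝 c)) (hev : ∀ᶠ x in l, φ x ≠ c ∧ deriv φ x < 0) :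
    Tendsto (deriv φ) l atBot := by
  have h := tendsto_mul_deriv_atTop (s := -1) hμ hp hm hM (by norm_num) hl
    (hev.mono fun x hx => ⟨hx.1, by simpa using hx.2⟩)
  simpa [Function.comp_def] using tendsto_neg_atTop_atBot.comp h

end Crest

/-! ### Periodic waves -/

lemma deriv_periodic {φ : ℝ → ℝ} {T : ℝ} (h : Function.Periodic φ T) :
    Function.Periodic (deriv φ) T := fun x => by
  rw [← deriv_comp_add_const]
  exact congrArg (fun f => deriv f x) (funext h)

lemma exists_int_add_mem_Ico {T : ℝ} (hT : 0 < T) (x y : ℝ) :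
    ∃ k : ℤ, x + k * T ∈ Ico y (y + T) := by
  obtain ⟨k, hk, -⟩ := existsUnique_add_zsmul_mem_Ico hT x y
  exact ⟨k, by simpa using hk⟩

lemma volume_eq_zero_of_lattice {c x₀ T : ℝ} {φ : ℝ → ℝ}
    (h : ∀ x, φ x = c ↔ ∃ k : ℤ, x = x₀ + k * T) : volume {x | φ x = c} = 0 := by
  refine ((countable_range fun k : ℤ => x₀ + k * T).mono fun x hx => ?_).measure_zero _
  obtain ⟨k, hk⟩ := (h x).1 hx
  exact ⟨k, hk.symm⟩

lemma ne_of_mem_Ioo_lattice {c x₀ T : ℝ} {φ : ℝ → ℝ} (hT : 0 < T)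
    (h : ∀ x, φ x = c ↔ ∃ k : ℤ, x = x₀ + k * T) (k : ℤ) {x : ℝ}
    (hx : x ∈ Ioo (x₀ + k * T) (x₀ + (k + 1) * T)) : φ x ≠ c := by
  intro hc
  obtain ⟨n, rfl⟩ := (h x).1 hc
  have hkn : (k : ℝ) < n := lt_of_mul_lt_mul_right (by linarith [hx.1]) hT.le
  have hnk : (n : ℝ) < k + 1 := lt_of_mul_lt_mul_right (by linarith [hx.2]) hT.le
  norm_cast at hkn hnk
  omega

lemma eq_period_of_consecutive {c x₀ y T T' : ℝ} {φ : ℝ → ℝ} (hT' : 0 < T')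
    (h : ∀ x, φ x = c ↔ ∃ k : ℤ, x = x₀ + k * T') (hT : 0 < T) (hy : φ y = c)
    (hyT : φ (y + T) = c) (hne : ∀ x ∈ Ioo y (y + T), φ x ≠ c) : T = T' := by
  obtain ⟨k, hk⟩ := (h y).1 hy
  obtain ⟨n, hn⟩ := (h _).1 hyT
  have hTn : T = (n - k : ℤ) * T' := by
    push_cast
    linarith
  have hpos : (0 : ℝ) < (n - k : ℤ) := pos_of_mul_pos_left (hTn ▸ hT) hT'.le
  have hone : (1 : ℝ) ≤ (n - k : ℤ) := by
    norm_cast at hpos ⊢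
  refine le_antisymm (not_lt.1 fun hlt => ?_) (hTn ▸ le_mul_of_one_le_left hT'.le hone)
  refine hne (y + T') ⟨by linarith, by linarith⟩ ((h _).2 ⟨k + 1, ?_⟩)
  push_cast
  linarith

lemma existsUniqueUpToTranslation_of_forall {P : (ℝ → ℝ) → Prop} {φ : ℝ → ℝ}
    (hP : ∀ t, P fun x => φ (x + t)) (huniq : ∀ ψ, P ψ → ∃ t, ∀ x, ψ x = φ (x + t)) :
    ExistsUniqueUpToTranslation P := by
  refine ⟨φ, by simpa using hP 0, fun ψ => ⟨huniq ψ, ?_⟩⟩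
  rintro ⟨t, ht⟩
  rw [funext ht]
  exact hP t

lemma HasParameters.deriv_eq {μ c m M d z : ℝ} {φ : ℝ → ℝ} (hp : HasParameters μ c m M φ)
    (hz : φ z ≠ c) (hd : (c - φ z) * d ^ 2 = 2 * μ * (M - φ z) * (φ z - m))
    (hs : 0 < deriv φ z * d) : deriv φ z = d := by
  have hsq := hp.mul_sq hz
  rw [← hd] at hsq
  refine (sq_eq_sq_iff_eq_or_eq_neg.1
    (mul_left_cancel₀ (sub_ne_zero.2 hz.symm) hsq)).resolve_right fun hneg => ?_
  rw [hneg, neg_mul] at hs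
  linarith [mul_self_nonneg d]

lemma exists_apply_eq {φ : ℝ → ℝ} (hφ : Continuous φ) {x y v : ℝ} (hv : v ∈ uIcc (φ x) (φ y)) :
    ∃ z, φ z = v := by
  obtain ⟨z, -, hz⟩ := intermediate_value_uIcc hφ.continuousOn hv
  exact ⟨z, hz⟩

namespace IsArch

variable {μ c a s e m M x₀ T p : ℝ} {φ ψ : ℝ → ℝ}

lemma sign_ne_zero (h : IsArch μ c a s e m φ x₀ T p) : s ≠ 0 := by
  rintro rfl
  simpa using h.sq_sign

lemma period_pos (h : IsArch μ c a s e m φ x₀ T p) : 0 < T := by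
  linarith [h.mem.1, h.mem.2]

lemma apply_right (h : IsArch μ c a s e m φ x₀ T p) : φ (x₀ + T) = e := by
  rw [h.periodic, h.value_end]

lemma comp_add_const (h : IsArch μ c a s e m φ x₀ T p) (t : ℝ) :
    IsArch μ c a s e m (fun x => φ (x + t)) (x₀ - t) T (p - t) := by
  have hderiv (x : ℝ) : deriv (fun x => φ (x + t)) x = deriv φ (x + t) :=
    deriv_comp_add_const φ t x
  refine ⟨h.solves.comp_add_const t, h.sq_sign, h.height_le, fun x => ?_, ?_, ?_, ?_, ?_,
    fun x hx => ?_, fun x hx => ?_⟩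
  · rw [add_right_comm, h.periodic]
  · exact ⟨by linarith [h.mem.1], by linarith [h.mem.2]⟩
  · rw [sub_add_cancel, h.value_end]
  · rw [sub_add_cancel, h.value_mid]
  · rw [hderiv, sub_add_cancel, h.critical]
  · rw [hderiv]
    exact h.sign_left _ ⟨by linarith [hx.1], by linarith [hx.2]⟩
  · rw [hderiv]
    exact h.sign_right _ ⟨by linarith [hx.1], by linarith [hx.2]⟩

lemma strictMonoOn (h : IsArch μ c a s e m φ x₀ T p) :
    StrictMonoOn (fun x => s * φ x) (Icc x₀ p) := by
  refine strictMonoOn_of_deriv_pos (convex_Icc _ _)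
    (continuous_const.mul h.solves.continuous).continuousOn fun x hx => ?_
  rw [interior_Icc] at hx
  rw [deriv_const_mul_field]
  exact h.sign_left x hx

lemma strictAntiOn (h : IsArch μ c a s e m φ x₀ T p) :
    StrictAntiOn (fun x => s * φ x) (Icc p (x₀ + T)) := by
  refine strictAntiOn_of_deriv_neg (convex_Icc _ _)
    (continuous_const.mul h.solves.continuous).continuousOn fun x hx => ?_
  rw [interior_Icc] at hx
  rw [deriv_const_mul_field]
  exact h.sign_right x hx

lemma end_lt_of_mem (h : IsArch μ c a s e m φ x₀ T p) {x : ℝ} (hx : x ∈ Ioo x₀ (x₀ + T)) :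
    s * e < s * φ x := by
  obtain hxp | hpx := le_total x p
  · simpa only [h.value_end] using
      h.strictMonoOn (left_mem_Icc.2 h.mem.1.le) ⟨hx.1.le, hxp⟩ hx.1
  · simpa only [h.apply_right] using
      h.strictAntiOn ⟨hpx, hx.2.le⟩ (right_mem_Icc.2 h.mem.2.le) hx.2

lemma ne_of_mem (h : IsArch μ c a s e m φ x₀ T p) {x : ℝ} (hx : x ∈ Ioo x₀ (x₀ + T)) :
    φ x ≠ c := fun hc =>
  (h.height_le.trans_lt (h.end_lt_of_mem hx)).ne (by rw [hc])

lemma ne_value (h : IsArch μ c a s e m φ x₀ T p) : m ≠ c :=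
  h.value_mid ▸ h.ne_of_mem h.mem

lemma range_bounds (h : IsArch μ c a s e m φ x₀ T p) (x : ℝ) :
    s * e ≤ s * φ x ∧ s * φ x ≤ s * m := by
  obtain ⟨k, hk⟩ := exists_int_add_mem_Ico h.period_pos x x₀
  rw [← h.periodic.int_mul k x]
  refine ⟨?_, ?_⟩
  · obtain heq | hlt := hk.1.eq_or_lt
    · rw [← heq, h.value_end]
    · exact (h.end_lt_of_mem ⟨hlt, hk.2⟩).le
  · rw [← h.value_mid]
    obtain hxp | hpx := le_total (x + k * T) p
    · exact h.strictMonoOn.monotoneOn ⟨hk.1, hxp⟩ (right_mem_Icc.2 h.mem.1.le) hxp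
    · exact h.strictAntiOn.antitoneOn (left_mem_Icc.2 h.mem.2.le) ⟨hpx, hk.2.le⟩ hpx

lemma ne_height (h : IsArch μ c a s e m φ x₀ T p) (he : e ≠ c) (x : ℝ) : φ x ≠ c := by
  rintro hx
  have hse : s * e ≤ s * c := hx ▸ (h.range_bounds x).1
  exact he (mul_left_cancel₀ h.sign_ne_zero (hse.antisymm h.height_le))

lemma exists_shift (h : IsArch μ c a s c m φ x₀ T p) {x : ℝ} (hx : φ x ≠ c) :
    ∃ k : ℤ, x + k * T ∈ Ioo x₀ (x₀ + T) := by
  obtain ⟨k, hk⟩ := exists_int_add_mem_Ico h.period_pos x x₀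
  refine ⟨k, lt_of_le_of_ne hk.1 fun heq => hx ?_, hk.2⟩
  rw [← h.periodic.int_mul k x, ← heq, h.value_end]

lemma apply_eq_iff (h : IsArch μ c a s c m φ x₀ T p) (x : ℝ) :
    φ x = c ↔ ∃ k : ℤ, x = x₀ + k * T := by
  refine ⟨fun hx => ?_, ?_⟩
  · obtain ⟨k, hk⟩ := exists_int_add_mem_Ico h.period_pos x x₀
    obtain heq | hlt := hk.1.eq_or_lt
    · refine ⟨-k, ?_⟩
      push_cast
      linarith
    · exact absurd ((h.periodic.int_mul k x).trans hx) (h.ne_of_mem ⟨hlt, hk.2⟩)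
  · rintro ⟨k, rfl⟩
    rw [h.periodic.int_mul, h.value_end]

lemma firstIntegral_eq (h : IsArch μ c a s e m φ x₀ T p) {x : ℝ} (hx : φ x ≠ c) :
    firstIntegral μ c a φ x = firstIntegral μ c a φ p := by
  obtain rfl | he := eq_or_ne e c
  · obtain ⟨k, hk⟩ := h.exists_shift hx
    have hshift : firstIntegral μ e a φ x = firstIntegral μ e a φ (x + k * T) := by
      simp only [firstIntegral, h.periodic.int_mul k x, (deriv_periodic h.periodic).int_mul k x]
    rw [hshift]
    exact h.solves.firstIntegral_eq isOpen_Ioo isPreconnected_Ioo (fun _ => h.ne_of_mem) hk h.mem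
  · exact h.solves.firstIntegral_eq isOpen_univ isPreconnected_univ
      (fun y _ => h.ne_height he y) (mem_univ x) (mem_univ p)

lemma hasParameters (h : IsArch μ c (2 * μ * (m + M)) s e m φ x₀ T p) :
    HasParameters μ c m M φ := by
  refine h.solves.hasParameters_of_firstIntegral fun x hx => ?_
  rw [h.firstIntegral_eq hx, firstIntegral, h.critical, h.value_mid]
  ring

lemma exists_data_of_mem_Ioo (h : IsArch μ c (2 * μ * (m + M)) s e m φ x₀ T p) {v d : ℝ}
    (hv : s * v ∈ Ioo (s * e) (s * m)) (hd0 : d ≠ 0)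
    (hd : (c - v) * d ^ 2 = 2 * μ * (M - v) * (v - m)) : ∃ z, φ z = v ∧ deriv φ z = d := by
  have hs0 := h.sign_ne_zero
  have hvc : v ≠ c := fun hvc => (h.height_le.trans_lt hv.1).ne (by rw [hvc])
  suffices hz : ∃ z, s * φ z = s * v ∧ 0 < (s * deriv φ z) * (s * d) by
    obtain ⟨z, hzv, hpos⟩ := hz
    obtain rfl := mul_left_cancel₀ hs0 hzv
    rw [mul_mul_mul_comm, ← sq, h.sq_sign, one_mul] at hpos
    exact ⟨z, rfl, h.hasParameters.deriv_eq hvc hd hpos⟩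
  have hcont : Continuous fun x => s * φ x := continuous_const.mul h.solves.continuous
  obtain hsd | hsd := (mul_ne_zero hs0 hd0).lt_or_gt
  · obtain ⟨z, hz, hzv⟩ := intermediate_value_Ioo' h.mem.2.le hcont.continuousOn
      (by rwa [h.apply_right, h.value_mid])
    exact ⟨z, hzv, mul_pos_of_neg_of_neg (h.sign_right z hz) hsd⟩
  · obtain ⟨z, hz, hzv⟩ := intermediate_value_Ioo h.mem.1.le hcont.continuousOn
      (by rwa [h.value_end, h.value_mid])
    exact ⟨z, hzv, mul_pos (h.sign_left z hz) hsd⟩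

theorem exists_data (h : IsArch μ c (2 * μ * (m + M)) s e m φ x₀ T p) (he : e = c ∨ e = M)
    {v d : ℝ} (hv : v ∈ uIcc e m) (hvc : v ≠ c)
    (hd : (c - v) * d ^ 2 = 2 * μ * (M - v) * (v - m)) : ∃ z, φ z = v ∧ deriv φ z = d := by
  have hcv : c - v ≠ 0 := sub_ne_zero.2 hvc.symm
  rw [← h.value_end, ← h.value_mid] at hv
  obtain ⟨z, hz⟩ := exists_apply_eq h.solves.continuous hv
  obtain rfl | hd0 := eq_or_ne d 0
  · have hsq := h.hasParameters.mul_sq (hz ▸ hvc : φ z ≠ c)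
    rw [hz, ← hd] at hsq
    exact ⟨z, hz, by simpa using mul_left_cancel₀ hcv hsq⟩
  have hrhs : 2 * μ * (M - v) * (v - m) ≠ 0 := hd ▸ mul_ne_zero hcv (pow_ne_zero 2 hd0)
  have hvm : v ≠ m := by
    rintro rfl
    exact hrhs (by ring)
  have hve : v ≠ e := by
    rintro rfl
    refine he.elim hvc ?_
    rintro rfl
    exact hrhs (by ring)
  have hbounds := h.range_bounds z
  rw [hz] at hbounds
  exact h.exists_data_of_mem_Ioo
    ⟨hbounds.1.lt_of_ne' (mt (mul_left_cancel₀ h.sign_ne_zero) hve),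
      hbounds.2.lt_of_ne (mt (mul_left_cancel₀ h.sign_ne_zero) hvm)⟩ hd0 hd

section Crests

lemma eventually_right (h : IsArch μ c a s c m φ x₀ T p) {x : ℝ} (hx : φ x = c) :
    ∀ᶠ y in 𝓝[>] x, φ y ≠ c ∧ 0 < s * deriv φ y := by
  obtain ⟨k, rfl⟩ := (h.apply_eq_iff x).1 hx
  have hp := h.mem
  filter_upwards [Ioo_mem_nhdsGT (show x₀ + k * T < p + k * T by linarith [hp.1])] with y hy
  have hshift : y + (-k : ℤ) * T ∈ Ioo x₀ p := by
    push_cast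
    constructor <;> linarith [hy.1, hy.2]
  rw [← h.periodic.int_mul (-k) y, ← (deriv_periodic h.periodic).int_mul (-k) y]
  exact ⟨h.ne_of_mem ⟨hshift.1, hshift.2.trans hp.2⟩, h.sign_left _ hshift⟩

lemma eventually_left (h : IsArch μ c a s c m φ x₀ T p) {x : ℝ} (hx : φ x = c) :
    ∀ᶠ y in 𝓝[<] x, φ y ≠ c ∧ s * deriv φ y < 0 := by
  obtain ⟨k, rfl⟩ := (h.apply_eq_iff x).1 hx
  have hp := h.mem
  filter_upwards [Ioo_mem_nhdsLT (show p + (k - 1) * T < x₀ + k * T by linarith [hp.2])] with y hy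
  have hshift : y + (1 - k : ℤ) * T ∈ Ioo p (x₀ + T) := by
    push_cast
    constructor <;> linarith [hy.1, hy.2]
  rw [← h.periodic.int_mul (1 - k) y, ← (deriv_periodic h.periodic).int_mul (1 - k) y]
  exact ⟨h.ne_of_mem ⟨hp.1.trans hshift.1, hshift.2⟩, h.sign_right _ hshift⟩

lemma smoothOnBothSides (h : IsArch μ c a s c m φ x₀ T p) {x : ℝ} (hx : φ x = c) :
    SmoothOnBothSides φ x := by
  obtain ⟨k, rfl⟩ := (h.apply_eq_iff x).1 hx
  refine ⟨T, h.period_pos, h.solves.contDiffOn.mono fun y hy => ?_,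
    h.solves.contDiffOn.mono fun y hy => ?_⟩
  · refine ne_of_mem_Ioo_lattice h.period_pos h.apply_eq_iff (k - 1) ?_
    push_cast
    constructor <;> linarith [hy.1, hy.2]
  · refine ne_of_mem_Ioo_lattice h.period_pos h.apply_eq_iff k ?_
    constructor <;> linarith [hy.1, hy.2]

lemma isTravelingWave (h : IsArch μ c a s c m φ x₀ T p) : IsTravelingWave μ c φ :=
  h.solves.isTravelingWave (Or.inl (volume_eq_zero_of_lattice h.apply_eq_iff))

lemma isPeriodicWithCrests (h : IsArch μ c a s c m φ x₀ T p) {Q : (ℝ → ℝ) → ℝ → Prop}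
    (hQ : ∀ x, φ x = c → Q φ x) : IsPeriodicWithCrests c Q φ :=
  ⟨x₀, T, h.period_pos, h.periodic, h.apply_eq_iff, h.solves.contDiffOn, hQ⟩

lemma tendsto_nhdsWithin (h : IsArch μ c a s c m φ x₀ T p) {x : ℝ} (hx : φ x = c) (t : Set ℝ) :
    Tendsto φ (𝓝[t] x) (𝓝 c) :=
  hx ▸ h.solves.continuous.continuousAt.mono_left nhdsWithin_le_nhds

lemma isLeast_range (h : IsArch μ c a 1 e m φ x₀ T p) : IsLeast (range φ) e :=
  ⟨⟨x₀, h.value_end⟩, forall_mem_range.2 fun x => by linarith [(h.range_bounds x).1]⟩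

lemma isGreatest_range (h : IsArch μ c a 1 e m φ x₀ T p) : IsGreatest (range φ) m :=
  ⟨⟨p, h.value_mid⟩, forall_mem_range.2 fun x => by linarith [(h.range_bounds x).2]⟩

lemma isLeast_range_of_neg (h : IsArch μ c a (-1) e m φ x₀ T p) : IsLeast (range φ) m :=
  ⟨⟨p, h.value_mid⟩, forall_mem_range.2 fun x => by linarith [(h.range_bounds x).2]⟩

lemma isGreatest_range_of_neg (h : IsArch μ c a (-1) e m φ x₀ T p) : IsGreatest (range φ) e :=
  ⟨⟨x₀, h.value_end⟩, forall_mem_range.2 fun x => by linarith [(h.range_bounds x).1]⟩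

lemma isSmoothPeriodicWave (hM : M < c) (h : IsArch μ c (2 * μ * (m + M)) (-1) M m φ x₀ T p) :
    IsSmoothPeriodicWave μ c m M φ := by
  have hne := h.ne_height hM.ne
  refine ⟨h.solves.isTravelingWave (Or.inl ?_), h.hasParameters, ?_, ⟨T, h.period_pos, h.periodic⟩,
    h.isLeast_range_of_neg, h.isGreatest_range_of_neg⟩
  · simp only [hne, ofPred_false, measure_empty]
  · have hsmooth := h.solves.contDiffOn
    rwa [show {x | φ x ≠ c} = univ from eq_univ_of_forall hne, contDiffOn_univ] at hsmooth

lemma isPeakedPeriodicWave (hμ : 0 < μ) (hm : m < c)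
    (h : IsArch μ c (2 * μ * (m + c)) (-1) c m φ x₀ T p) : IsPeakedPeriodicWave μ c m φ := by
  have hp := h.hasParameters
  refine ⟨h.isTravelingWave, hp, h.isPeriodicWithCrests fun x hx => ?_, h.isLeast_range_of_neg,
    h.isGreatest_range_of_neg⟩
  refine ⟨h.solves.continuous.continuousAt, h.smoothOnBothSides hx, √(2 * μ * (c - m)),
    Real.sqrt_pos.2 (mul_pos (by positivity) (sub_pos.2 hm)), ?_, ?_⟩
  · simpa using tendsto_mul_deriv_nhds (s := 1) hp (one_pow 2) (h.tendsto_nhdsWithin hx _)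
      (by simpa using h.eventually_left hx)
  · simpa using (tendsto_mul_deriv_nhds (s := -1) hp h.sq_sign (h.tendsto_nhdsWithin hx _)
      (h.eventually_right hx)).neg

lemma isCuspedPeriodicWave (hμ : μ ≠ 0) (hM : M ≠ c)
    (h : IsArch μ c (2 * μ * (m + M)) (-1) c m φ x₀ T p) : IsCuspedPeriodicWave μ c m M φ := by
  have hp := h.hasParameters
  refine ⟨h.isTravelingWave, hp, h.isPeriodicWithCrests fun x hx => ?_, h.isLeast_range_of_neg,
    h.isGreatest_range_of_neg⟩
  refine ⟨h.solves.continuous.continuousAt, h.smoothOnBothSides hx, ?_, ?_⟩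
  · simpa using tendsto_mul_deriv_atTop (s := 1) hμ hp h.ne_value hM (one_pow 2)
      (h.tendsto_nhdsWithin hx _) (by simpa using h.eventually_left hx)
  · exact tendsto_deriv_atBot hμ hp h.ne_value hM (h.tendsto_nhdsWithin hx _)
      (by simpa using h.eventually_right hx)

lemma isAnticuspedPeriodicWave (hμ : μ ≠ 0) (hM : M ≠ c)
    (h : IsArch μ c (2 * μ * (m + M)) 1 c m φ x₀ T p) : IsAnticuspedPeriodicWave μ c m M φ := by
  have hp := h.hasParameters
  refine ⟨h.isTravelingWave, hp, h.isPeriodicWithCrests fun x hx => ?_, h.isLeast_range,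
    h.isGreatest_range⟩
  refine ⟨h.solves.continuous.continuousAt, h.smoothOnBothSides hx, ?_, ?_⟩
  · exact tendsto_deriv_atBot hμ hp h.ne_value hM (h.tendsto_nhdsWithin hx _)
      (by simpa using h.eventually_left hx)
  · simpa using tendsto_mul_deriv_atTop (s := 1) hμ hp h.ne_value hM (one_pow 2)
      (h.tendsto_nhdsWithin hx _) (h.eventually_right hx)

end Crests

theorem eq_comp_add_const (h : IsArch μ c a s c m φ x₀ T p) (hψ : SolvesOff μ c a ψ) {Q}
    (hcrests : IsPeriodicWithCrests c Q ψ) {q : ℝ} (hq : ψ q = m) (hq' : deriv ψ q = 0) (x : ℝ) :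
    ψ x = φ (x + (p - q)) := by
  obtain ⟨x₁, T', hT', hper, hlattice, -⟩ := hcrests
  have hw := h.comp_add_const (p - q)
  set w : ℝ → ℝ := fun x => φ (x + (p - q))
  rw [sub_sub_cancel] at hw
  set y₀ := x₀ - (p - q)
  have hT := hw.period_pos
  have heqIoo : EqOn w ψ (Ioo y₀ (y₀ + T)) :=
    hw.solves.eqOn hψ isPreconnected_Ioo hw.mem (fun y hy => hw.ne_of_mem hy)
      (hw.value_mid.trans hq.symm) (hw.critical.trans hq'.symm)
  have heqIcc : EqOn w ψ (Icc y₀ (y₀ + T)) := by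
    rw [← closure_Ioo (by linarith : y₀ ≠ y₀ + T)]
    exact heqIoo.closure hw.solves.continuous hψ.continuous
  have hperiod : T = T' := eq_period_of_consecutive hT' hlattice hT
    (by rw [← heqIcc (left_mem_Icc.2 (by linarith)), hw.value_end])
    (by rw [← heqIcc (right_mem_Icc.2 (by linarith)), hw.apply_right])
    fun y hy => heqIoo hy ▸ hw.ne_of_mem hy
  obtain ⟨n, hn⟩ := exists_int_add_mem_Ico hT x y₀
  have heq := heqIcc (Ico_subset_Icc_self hn)
  rw [hw.periodic.int_mul, hperiod, hper.int_mul] at heq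
  exact heq.symm

theorem existsUniqueUpToTranslation (h : IsArch μ c a s c m φ x₀ T p) {P : (ℝ → ℝ) → Prop} {Q}
    (hP : ∀ φ x₀ T p, IsArch μ c a s c m φ x₀ T p → P φ)
    (hQ : ∀ ψ, P ψ → SolvesOff μ c a ψ ∧ IsPeriodicWithCrests c Q ψ ∧
      ∃ q, ψ q = m ∧ deriv ψ q = 0) : ExistsUniqueUpToTranslation P :=
  existsUniqueUpToTranslation_of_forall (fun t => hP _ _ _ _ (h.comp_add_const t)) fun ψ hψ =>
    have ⟨hsolves, hcrests, q, hq, hq'⟩ := hQ ψ hψ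
    ⟨p - q, h.eq_comp_add_const hsolves hcrests hq hq'⟩

end IsArch

section Families

variable {μ c m M : ℝ} {φ : ℝ → ℝ}

lemma IsTravelingWave.continuous (h : IsTravelingWave μ c φ) : Continuous φ := by
  obtain ⟨g, hg, -⟩ := h
  exact hg.1

lemma exists_apply_eq_deriv_eq_zero_of_isLeast (h : IsLeast (range φ) m) :
    ∃ q, φ q = m ∧ deriv φ q = 0 := by
  obtain ⟨⟨q, rfl⟩, hle⟩ := h
  exact ⟨q, rfl, IsLocalMin.deriv_eq_zero (Eventually.of_forall fun x => hle (mem_range_self x))⟩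

lemma exists_apply_eq_deriv_eq_zero_of_isGreatest (h : IsGreatest (range φ) M) :
    ∃ q, φ q = M ∧ deriv φ q = 0 := by
  obtain ⟨⟨q, rfl⟩, hge⟩ := h
  exact ⟨q, rfl, IsLocalMax.deriv_eq_zero (Eventually.of_forall fun x => hge (mem_range_self x))⟩

lemma IsTravelingWave.solvesOff_of_isLeast_of_isGreatest (hμ : μ ≠ 0) (h : IsTravelingWave μ c φ)
    (hp : HasParameters μ c m M φ) {l u : ℝ} (hl : IsLeast (range φ) l)
    (hu : IsGreatest (range φ) u) (hc : (l + u) / 2 ≠ c) (hm : (l + u) / 2 ≠ m)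
    (hM : (l + u) / 2 ≠ M) : SolvesOff μ c (2 * μ * (m + M)) φ := by
  have hlu : l ≤ u := hu.2 hl.1
  obtain ⟨⟨q, rfl⟩, -⟩ := hl
  obtain ⟨⟨q', rfl⟩, -⟩ := hu
  obtain ⟨z, hz⟩ := exists_apply_eq h.continuous (x := q) (y := q') (v := (φ q + φ q') / 2)
    (Icc_subset_uIcc ⟨by linarith, by linarith⟩)
  rw [← hz] at hc hm hM
  exact h.solvesOff_of_hasParameters hμ hp hc hm hM

theorem existsUnique_smooth (hμ : 0 < μ) (hm : m < M) (hM : M < c) :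
    ExistsUniqueUpToTranslation (IsSmoothPeriodicWave μ c m M) := by
  obtain ⟨φ, x₀, T, p, h⟩ := exists_isArch_smooth hμ hm hM
  refine existsUniqueUpToTranslation_of_forall
    (fun t => (h.comp_add_const t).isSmoothPeriodicWave hM) fun ψ hψ => ?_
  obtain ⟨q, hq, hq'⟩ := exists_apply_eq_deriv_eq_zero_of_isLeast hψ.minimum
  have hne (x : ℝ) : ψ x ≠ c := ((hψ.maximum.2 ⟨x, rfl⟩).trans_lt hM).ne
  have hsolves := hψ.wave.solvesOff_of_isLeast_of_isGreatest hμ.ne' hψ.parameters hψ.minimum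
    hψ.maximum (by linarith) (by linarith) (by linarith)
  have hw := h.comp_add_const (p - q)
  rw [sub_sub_cancel] at hw
  have heq := hsolves.eqOn hw.solves isPreconnected_univ (mem_univ q) (fun y _ => hne y)
    (hq.trans hw.value_mid.symm) (hq'.trans hw.critical.symm)
  exact ⟨p - q, fun x => heq (mem_univ x)⟩

theorem existsUnique_peaked (hμ : 0 < μ) (hm : m < c) :
    ExistsUniqueUpToTranslation (IsPeakedPeriodicWave μ c m) := by
  obtain ⟨φ, x₀, T, p, h⟩ := exists_isArch_below hμ hm le_rfl
  exact h.existsUniqueUpToTranslation (fun φ x₀ T p h => h.isPeakedPeriodicWave hμ hm)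
    fun ψ hψ => ⟨hψ.wave.solvesOff_of_isLeast_of_isGreatest hμ.ne' hψ.parameters hψ.minimum
      hψ.maximum (by linarith) (by linarith) (by linarith), hψ.peaks,
      exists_apply_eq_deriv_eq_zero_of_isLeast hψ.minimum⟩

theorem existsUnique_cusped (hμ : 0 < μ) (hm : m < c) (hM : c < M) :
    ExistsUniqueUpToTranslation (IsCuspedPeriodicWave μ c m M) := by
  obtain ⟨φ, x₀, T, p, h⟩ := exists_isArch_below hμ hm hM.le
  exact h.existsUniqueUpToTranslation (fun φ x₀ T p h => h.isCuspedPeriodicWave hμ.ne' hM.ne')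
    fun ψ hψ => ⟨hψ.wave.solvesOff_of_isLeast_of_isGreatest hμ.ne' hψ.parameters hψ.minimum
      hψ.maximum (by linarith) (by linarith) (by linarith), hψ.cusps,
      exists_apply_eq_deriv_eq_zero_of_isLeast hψ.minimum⟩

theorem existsUnique_anticusped (hμ : 0 < μ) (hm : c < m) (hM : m < M) :
    ExistsUniqueUpToTranslation (IsAnticuspedPeriodicWave μ c m M) := by
  obtain ⟨φ, x₀, T, p, h⟩ := exists_isArch_above hμ hm hM
  exact h.existsUniqueUpToTranslation
    (fun φ x₀ T p h => h.isAnticuspedPeriodicWave hμ.ne' (hm.trans hM).ne')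
    fun ψ hψ => ⟨hψ.wave.solvesOff_of_isLeast_of_isGreatest hμ.ne' hψ.parameters hψ.minimum
      hψ.maximum (by linarith) (by linarith) (by linarith), hψ.anticusps,
      exists_apply_eq_deriv_eq_zero_of_isGreatest hψ.maximum⟩

end Families

/-! ### Anticusped waves on the line -/

namespace IsLineArch

variable {μ c a m x₀ : ℝ} {φ ψ : ℝ → ℝ}

lemma comp_add_const (h : IsLineArch μ c a m φ x₀) (t : ℝ) :
    IsLineArch μ c a m (fun x => φ (x + t)) (x₀ - t) := by
  have hderiv (x : ℝ) : deriv (fun x => φ (x + t)) x = deriv φ (x + t) :=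
    deriv_comp_add_const φ t x
  have hsolves := h.solves.comp_add_const t
  refine ⟨hsolves, fun x hx => ⟨hsolves.differentiableAt x hx, ?_⟩, fun x => ?_, fun x => h.lt _,
    fun x hx => ?_, fun x hx => ?_,
    h.limit_right.comp (tendsto_atTop_add_const_right _ t tendsto_id),
    h.limit_left.comp (tendsto_atBot_add_const_right _ t tendsto_id)⟩
  · rw [hderiv, (h.parameters _ hx).2]
  · rw [h.zeros, eq_sub_iff_add_eq]
  · rw [hderiv]
    exact h.sign_left _ (by linarith)
  · rw [hderiv]
    exact h.sign_right _ (by linarith)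

lemma comp_neg (h : IsLineArch μ c a m φ x₀) : IsLineArch μ c a m (fun x => φ (-x)) (-x₀) := by
  have hderiv (x : ℝ) : deriv (fun x => φ (-x)) x = -deriv φ (-x) := deriv_comp_neg φ x
  refine ⟨h.solves.comp_neg, fun x hx => ⟨h.solves.comp_neg.differentiableAt x hx, ?_⟩,
    fun x => ?_, fun x => h.lt _, fun x hx => ?_, fun x hx => ?_,
    h.limit_left.comp tendsto_neg_atTop_atBot, h.limit_right.comp tendsto_neg_atBot_atTop⟩
  · rw [hderiv, neg_sq, (h.parameters _ hx).2]
  · rw [h.zeros, neg_eq_iff_eq_neg]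
  · rw [hderiv, neg_neg_iff_pos]
    exact h.sign_right _ (by linarith)
  · rw [hderiv, neg_pos]
    exact h.sign_left _ (by linarith)

lemma apply_crest (h : IsLineArch μ c a m φ x₀) : φ x₀ = c := (h.zeros x₀).2 rfl

lemma ne_height (h : IsLineArch μ c a m φ x₀) {x : ℝ} (hx : x ≠ x₀) : φ x ≠ c :=
  mt (h.zeros x).1 hx

lemma le (h : IsLineArch μ c a m φ x₀) (x : ℝ) : c ≤ φ x := by
  rw [← h.apply_crest]
  wlog hx : x₀ ≤ x generalizing φ x x₀
  · simpa using this h.comp_neg (-x) (by linarith)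
  refine (strictMonoOn_of_deriv_pos (convex_Ici x₀) h.solves.continuous.continuousOn
    fun y hy => h.sign_right y ?_).monotoneOn self_mem_Ici hx hx
  rwa [interior_Ici] at hy

lemma hasAnticuspAt (hμ : μ ≠ 0) (hm : m ≠ c) (h : IsLineArch μ c a m φ x₀) :
    HasAnticuspAt φ x₀ := by
  have hlim (s : Set ℝ) : Tendsto φ (𝓝[s] x₀) (𝓝 c) :=
    h.apply_crest ▸ h.solves.continuous.continuousAt.mono_left nhdsWithin_le_nhds
  refine ⟨h.solves.continuous.continuousAt, ⟨1, one_pos, ?_, ?_⟩, ?_, ?_⟩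
  · exact h.solves.contDiffOn.mono fun x hx => h.ne_height hx.2.ne
  · exact h.solves.contDiffOn.mono fun x hx => h.ne_height hx.1.ne'
  · refine tendsto_deriv_atBot hμ h.parameters hm hm (hlim _) ?_
    filter_upwards [self_mem_nhdsWithin] with x hx
    exact ⟨h.ne_height (ne_of_lt hx), h.sign_left x hx⟩
  · have hright : ∀ᶠ x in 𝓝[>] x₀, φ x ≠ c ∧ 0 < 1 * deriv φ x := by
      filter_upwards [self_mem_nhdsWithin] with x hx
      exact ⟨h.ne_height (ne_of_gt hx), by simpa using h.sign_right x hx⟩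
    simpa using tendsto_mul_deriv_atTop hμ h.parameters hm hm (one_pow 2) (hlim _) hright

lemma isAnticuspedLineWave (hμ : μ ≠ 0) (hm : m ≠ c) (h : IsLineArch μ c a m φ x₀) :
    IsAnticuspedLineWave μ c m φ := by
  refine ⟨h.solves.isTravelingWave (Or.inl ?_), h.parameters, h.solves.contDiffOn,
    ⟨x₀, h.zeros, h.hasAnticuspAt hμ hm⟩, ⟨⟨x₀, h.apply_crest⟩, forall_mem_range.2 h.le⟩,
    ⟨forall_mem_range.2 fun x => (h.lt x).le, fun b hb => ?_⟩, h.limit_right, h.limit_left⟩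
  · simp only [h.zeros, ofPred_eq_eq_singleton, Real.volume_singleton]
  · exact le_of_tendsto h.limit_right (Eventually.of_forall fun x => hb (mem_range_self x))

lemma exists_data (hμ : 0 < μ) (h : IsLineArch μ c a m φ x₀) {v d : ℝ} (hv : v ∈ Ioo c m)
    (hd : (c - v) * d ^ 2 = 2 * μ * (m - v) * (v - m)) : ∃ z, φ z = v ∧ deriv φ z = d := by
  have hd0 : d ≠ 0 := by
    rintro rfl
    nlinarith [mul_pos hμ (mul_pos (sub_pos.2 hv.2) (sub_pos.2 hv.2))]
  wlog hpos : 0 < d generalizing φ x₀ d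
  · obtain ⟨z, hz, hz'⟩ := this h.comp_neg (d := -d) (by rwa [neg_sq]) (neg_ne_zero.2 hd0)
      (neg_pos.2 (lt_of_le_of_ne (not_lt.1 hpos) hd0))
    rw [deriv_comp_neg, neg_inj] at hz'
    exact ⟨-z, hz, hz'⟩
  obtain ⟨y, hy, hy'⟩ := ((h.limit_right.eventually_const_lt hv.2).and
    (eventually_gt_atTop x₀)).exists
  obtain ⟨z, hz, rfl⟩ := intermediate_value_Ioo hy'.le h.solves.continuous.continuousOn
    (show v ∈ Ioo (φ x₀) (φ y) from ⟨h.apply_crest ▸ hv.1, hy⟩)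
  exact ⟨z, rfl, h.parameters.deriv_eq hv.1.ne' hd (mul_pos (h.sign_right z hz.1) hpos)⟩

lemma eqOn_side (hμ : 0 < μ) (h : IsLineArch μ c a m φ x₀) (hψ : SolvesOff μ c a ψ)
    (hp : HasParameters μ c m m ψ) {x₁ ξ : ℝ} {s : Set ℝ} (hs : IsPreconnected s) (hξ : ξ ∈ s)
    (hx₁ : x₁ ∈ closure s) (hc : ψ x₁ = c) (hne : ∀ x ∈ s, ψ x ≠ c) (hψξ : ψ ξ ∈ Ioo c m) :
    EqOn ψ (fun x => φ (x + (x₀ - x₁))) s := by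
  obtain ⟨z, hz, hz'⟩ := h.exists_data hμ hψξ (hp.mul_sq (hne ξ hξ))
  have hw := h.comp_add_const (z - ξ)
  have heq : EqOn ψ (fun x => φ (x + (z - ξ))) s := by
    refine hψ.eqOn hw.solves hs hξ hne ?_ ?_
    · rw [add_sub_cancel, hz]
    · rw [deriv_comp_add_const, add_sub_cancel, hz']
  have hcrest : x₁ = x₀ - (z - ξ) := (hw.zeros x₁).1
    (hc ▸ (heq.closure hψ.continuous hw.solves.continuous hx₁).symm)
  rwa [hcrest, sub_sub_cancel]

end IsLineArch

theorem existsUnique_line {μ c m : ℝ} (hμ : 0 < μ) (hm : c < m) :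
    ExistsUniqueUpToTranslation (IsAnticuspedLineWave μ c m) := by
  obtain ⟨φ, x₀, h⟩ := exists_isLineArch hμ hm
  refine existsUniqueUpToTranslation_of_forall
    (fun t => (h.comp_add_const t).isAnticuspedLineWave hμ.ne' hm.ne') fun ψ hψ => ?_
  obtain ⟨x₁, hzeros, -⟩ := hψ.anticusp
  have hx₁ : ψ x₁ = c := (hzeros x₁).2 rfl
  have hne {x : ℝ} (hx : x ≠ x₁) : ψ x ≠ c := mt (hzeros x).1 hx
  have hmem : ∀ᶠ x in 𝓝[≠] x₁, ψ x ∈ Ioo c m := by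
    filter_upwards [self_mem_nhdsWithin,
      (hψ.wave.continuous.continuousAt.eventually_lt_const (hx₁.trans_lt hm)).filter_mono
        nhdsWithin_le_nhds] with x hx hxm
    exact ⟨(hψ.minimum.2 (mem_range_self x)).lt_of_ne' (hne hx), hxm⟩
  obtain ⟨ξ, hξ, hξ₁⟩ := ((hmem.filter_mono (nhdsGT_le_nhdsNE x₁)).and self_mem_nhdsWithin).exists
  obtain ⟨η, hη, hη₁⟩ := ((hmem.filter_mono (nhdsLT_le_nhdsNE x₁)).and self_mem_nhdsWithin).exists
  have hsolves := hψ.wave.solvesOff_of_hasParameters hμ.ne' hψ.parameters hξ.1.ne' hξ.2.ne hξ.2.ne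
  have hright := h.eqOn_side hμ hsolves hψ.parameters isPreconnected_Ioi hξ₁
    (by rw [closure_Ioi]; exact self_mem_Ici) hx₁ (fun x hx => hne (ne_of_gt hx)) hξ
  have hleft := h.eqOn_side hμ hsolves hψ.parameters isPreconnected_Iio hη₁
    (by rw [closure_Iio]; exact self_mem_Iic) hx₁ (fun x hx => hne (ne_of_lt hx)) hη
  refine ⟨x₀ - x₁, fun x => ?_⟩
  obtain hx | rfl | hx := lt_trichotomy x x₁
  · exact hleft hx
  · rw [hx₁, add_sub_cancel, h.apply_crest]
  · exact hright hx

section Elementary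

variable {μ c m M : ℝ} {w : ℝ → ℝ}

namespace IsElementaryWave

lemma solvesOff (hμ : 0 < μ) (h : IsElementaryWave μ c m M w) :
    SolvesOff μ c (2 * μ * (m + M)) w := by
  rcases h with ⟨hm, rfl, h⟩ | ⟨hm, hM, h⟩ | ⟨hm, hM, h⟩ | ⟨hm, rfl, h⟩
  · apply h.wave.solvesOff_of_isLeast_of_isGreatest hμ.ne' h.parameters h.minimum h.maximum <;>
      linarith
  · apply h.wave.solvesOff_of_isLeast_of_isGreatest hμ.ne' h.parameters h.minimum h.maximum <;>
      linarith
  · apply h.wave.solvesOff_of_isLeast_of_isGreatest hμ.ne' h.parameters h.minimum h.maximum <;>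
      linarith
  · obtain ⟨x, hx⟩ := h.minimum.1
    obtain ⟨y, hy⟩ := (h.limit_right.eventually_const_lt (add_div_two_lt_right.2 hm)).exists
    obtain ⟨z, hz⟩ := exists_apply_eq h.wave.continuous
      (Icc_subset_uIcc ⟨hx.trans_le (left_lt_add_div_two.2 hm).le, hy.le⟩)
    have hzc : w z ≠ c := hz ▸ (left_lt_add_div_two.2 hm).ne'
    have hzm : w z ≠ m := hz ▸ (add_div_two_lt_right.2 hm).ne
    exact h.wave.solvesOff_of_hasParameters hμ.ne' h.parameters hzc hzm hzm

lemma ne (h : IsElementaryWave μ c m M w) : m ≠ c := by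
  rcases h with ⟨hm, -, -⟩ | ⟨hm, -, -⟩ | ⟨hm, -, -⟩ | ⟨hm, -, -⟩
  exacts [hm.ne, hm.ne, hm.ne', hm.ne']

lemma hasParameters (h : IsElementaryWave μ c m M w) : HasParameters μ c m M w := by
  rcases h with ⟨-, rfl, h⟩ | ⟨-, -, h⟩ | ⟨-, -, h⟩ | ⟨-, rfl, h⟩
  exacts [h.parameters, h.parameters, h.parameters, h.parameters]

lemma mem_uIcc (h : IsElementaryWave μ c m M w) (x : ℝ) : w x ∈ uIcc c m := by
  rw [Set.mem_uIcc]
  rcases h with ⟨-, rfl, h⟩ | ⟨-, -, h⟩ | ⟨-, -, h⟩ | ⟨-, rfl, h⟩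
  · exact Or.inr ⟨h.minimum.2 ⟨x, rfl⟩, h.maximum.2 ⟨x, rfl⟩⟩
  · exact Or.inr ⟨h.minimum.2 ⟨x, rfl⟩, h.maximum.2 ⟨x, rfl⟩⟩
  · exact Or.inl ⟨h.minimum.2 ⟨x, rfl⟩, h.maximum.2 ⟨x, rfl⟩⟩
  · exact Or.inl ⟨h.minimum.2 ⟨x, rfl⟩, h.supremum.1 ⟨x, rfl⟩⟩

lemma periodic_or_single_crest (h : IsElementaryWave μ c m M w) :
    ((∃ q, w q = m) ∧ ∃ x₀ T : ℝ, 0 < T ∧ ∀ x, w x = c ↔ ∃ k : ℤ, x = x₀ + k * T) ∨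
      ∃ x₀, ∀ x, w x = c ↔ x = x₀ := by
  rcases h with ⟨-, rfl, h⟩ | ⟨-, -, h⟩ | ⟨-, -, h⟩ | ⟨-, rfl, h⟩
  · obtain ⟨x₀, T, hT, -, hzeros, -⟩ := h.peaks
    exact Or.inl ⟨h.minimum.1, x₀, T, hT, hzeros⟩
  · obtain ⟨x₀, T, hT, -, hzeros, -⟩ := h.cusps
    exact Or.inl ⟨h.minimum.1, x₀, T, hT, hzeros⟩
  · obtain ⟨x₀, T, hT, -, hzeros, -⟩ := h.anticusps
    exact Or.inl ⟨h.maximum.1, x₀, T, hT, hzeros⟩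
  · obtain ⟨x₀, hzeros, -⟩ := h.anticusp
    exact Or.inr ⟨x₀, hzeros⟩

end IsElementaryWave

/-- A bound for `|φ - c| φ'²` on an elementary wave whose parameters have the sum `S` and whose
amplitude `|m - c|` is `d`. -/
noncomputable def slopeBound (μ c S d : ℝ) : ℝ := 2 * μ * (|S - 2 * c| + 2 * d) * d

lemma slopeBound_nonneg (hμ : 0 ≤ μ) {S d : ℝ} (hd : 0 ≤ d) : 0 ≤ slopeBound μ c S d := by
  unfold slopeBound
  positivity

lemma slopeBound_mono (hμ : 0 ≤ μ) {S d d' : ℝ} (hd : 0 ≤ d) (h : d ≤ d') :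
    slopeBound μ c S d ≤ slopeBound μ c S d' := by
  have hd' : 0 ≤ d' := hd.trans h
  unfold slopeBound
  gcongr

lemma IsElementaryWave.abs_sub_mul_deriv_sq_le (hμ : 0 ≤ μ) (h : IsElementaryWave μ c m M w)
    {x : ℝ} (hx : w x ≠ c) : |w x - c| * deriv w x ^ 2 ≤ slopeBound μ c (m + M) |m - c| := by
  have hwm : |w x - m| ≤ |m - c| := by
    simpa only [abs_sub_comm m] using abs_sub_right_of_mem_uIcc (h.mem_uIcc x)
  have hwc : |w x - c| ≤ |m - c| := abs_sub_left_of_mem_uIcc (h.mem_uIcc x)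
  have hwM : |M - w x| ≤ |m + M - 2 * c| + 2 * |m - c| := by
    calc |M - w x| = |(m + M - 2 * c) - (m - c) - (w x - c)| := by ring_nf
      _ ≤ |m + M - 2 * c| + |m - c| + |w x - c| :=
        (abs_sub _ _).trans (add_le_add_left (abs_sub _ _) _)
      _ ≤ |m + M - 2 * c| + 2 * |m - c| := by linarith
  calc |w x - c| * deriv w x ^ 2 = |(c - w x) * deriv w x ^ 2| := by
        rw [abs_mul, abs_sq, abs_sub_comm]
    _ = 2 * μ * |M - w x| * |w x - m| := by
        rw [h.hasParameters.mul_sq hx, abs_mul, abs_mul, abs_of_nonneg (by positivity)]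
    _ ≤ 2 * μ * (|m + M - 2 * c| + 2 * |m - c|) * |m - c| := by gcongr

end Elementary

/-! ### Hölder estimate near the singular height -/

section Holder

variable {u : ℝ → ℝ} {K x y : ℝ}

lemma exists_last_zero (hu : Continuous u) (hxy : x ≤ y) (hx : u x = 0) (hy : u y ≠ 0) :
    ∃ z ∈ Ico x y, u z = 0 ∧ ∀ t ∈ Ioc z y, u t ≠ 0 := by
  have hcompact : IsCompact (Icc x y ∩ {t | u t = 0}) :=
    isCompact_Icc.inter_right (isClosed_eq hu continuous_const)
  obtain ⟨z, ⟨hz, hz0⟩, hmax⟩ := hcompact.exists_isGreatest ⟨x, left_mem_Icc.2 hxy, hx⟩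
  have hzy : z ≠ y := by
    rintro rfl
    exact hy hz0
  exact ⟨z, ⟨hz.1, hz.2.lt_of_ne hzy⟩, hz0, fun t ht ht0 =>
    ht.1.not_ge (hmax ⟨⟨hz.1.trans ht.1.le, ht.2⟩, ht0⟩)⟩

lemma sq_rpow_sq (s r : ℝ) : ((s ^ 2) ^ r) ^ 2 = |s| ^ (4 * r) := by
  rw [← sq_abs s, ← Real.rpow_natCast, ← Real.rpow_natCast, ← Real.rpow_mul (abs_nonneg s),
    ← Real.rpow_mul (abs_nonneg s)]
  ring_nf

lemma exists_hasDerivAt_sq_rpow {d : ℝ} (hu : HasDerivAt u d x) (hx : u x ≠ 0) :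
    ∃ e, HasDerivAt (fun t => (u t ^ 2) ^ (3 / 4 : ℝ)) e x ∧ e ^ 2 = 9 / 4 * (|u x| * d ^ 2) := by
  refine ⟨_, (hu.pow 2).rpow_const (p := 3 / 4) (Or.inl (pow_ne_zero 2 hx)), ?_⟩
  have : |u x| ≠ 0 := abs_ne_zero.2 hx
  have hinv : ((u x ^ 2) ^ ((3 / 4 : ℝ) - 1)) ^ 2 = |u x|⁻¹ := by
    rw [sq_rpow_sq, ← Real.rpow_neg_one]
    norm_num
  simp only [mul_pow, Pi.pow_apply, hinv, Nat.add_one_sub_one, pow_one]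
  rw [← sq_abs (u x)]
  field_simp
  ring

lemma abs_pow_three_le_of_ne_zero (hu : Continuous u) (hxy : x < y) (hx : u x = 0)
    (hne : ∀ t ∈ Ioo x y, u t ≠ 0) (hd : ∀ t ∈ Ioo x y, DifferentiableAt ℝ u t)
    (hK : ∀ t ∈ Ioo x y, |u t| * deriv u t ^ 2 ≤ K) :
    |u y| ^ 3 ≤ 9 / 4 * K * (y - x) ^ 2 := by
  set f : ℝ → ℝ := fun t => (u t ^ 2) ^ (3 / 4 : ℝ) with hf
  have hderiv (t) (ht : t ∈ Ioo x y) : HasDerivAt f (deriv f t) t ∧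
      deriv f t ^ 2 = 9 / 4 * (|u t| * deriv u t ^ 2) := by
    obtain ⟨e, he, hsq⟩ := exists_hasDerivAt_sq_rpow (hd t ht).hasDerivAt (hne t ht)
    exact he.deriv.symm ▸ ⟨he, hsq⟩
  have hcont : Continuous f := (hu.pow 2).rpow_const fun _ => Or.inr (by norm_num)
  have hfx : f x = 0 := by simp [hf, hx]
  have hfy : f y ^ 2 = |u y| ^ 3 := by
    rw [hf, sq_rpow_sq, ← Real.rpow_natCast]
    norm_num
  obtain ⟨ξ, hξ, hslope⟩ := exists_hasDerivAt_eq_slope f (deriv f) hxy hcont.continuousOn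
    fun t ht => (hderiv t ht).1
  rw [hfx, sub_zero, eq_div_iff (sub_pos.2 hxy).ne'] at hslope
  rw [← hfy, ← hslope, mul_pow, (hderiv ξ hξ).2]
  gcongr
  exact hK ξ hξ

/-- `|u|^{3/2}` is Lipschitz, because the square of its derivative is `9/4 |u| u'²`. -/
lemma abs_pow_three_le_of_abs_mul_deriv_sq_le (hu : Continuous u)
    (hd : ∀ t, u t ≠ 0 → DifferentiableAt ℝ u t ∧ |u t| * deriv u t ^ 2 ≤ K) (hK : 0 ≤ K)
    (hx : u x = 0) : |u y| ^ 3 ≤ 9 / 4 * K * (y - x) ^ 2 := by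
  wlog hxy : x ≤ y generalizing u x y
  · have hreflect := this (u := fun t => u (-t)) (x := -x) (y := -y) (by fun_prop)
      (fun t ht => ⟨(hd (-t) ht).1.comp t differentiableAt_id.neg, by
        rw [deriv_comp_neg, neg_sq]; exact (hd (-t) ht).2⟩)
      (by rwa [neg_neg]) (neg_le_neg (not_le.1 hxy).le)
    rwa [neg_neg, neg_sub_neg, sub_sq_comm] at hreflect
  by_cases hy : u y = 0
  · rw [hy, abs_zero, zero_pow three_ne_zero]
    positivity
  obtain ⟨z, hz, hz0, hne⟩ := exists_last_zero hu hxy hx hy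
  have hsub {t : ℝ} (ht : t ∈ Ioo z y) : u t ≠ 0 := hne t (Ioo_subset_Ioc_self ht)
  refine (abs_pow_three_le_of_ne_zero hu hz.2 hz0 (fun t ht => hsub ht)
    (fun t ht => (hd t (hsub ht)).1) (fun t ht => (hd t (hsub ht)).2)).trans ?_
  gcongr
  · exact sub_nonneg.2 hz.2.le
  · exact hz.1

lemma continuousAt_of_abs_pow_three_le
    (h : ∀ᶠ t in 𝓝 x, |u t - u x| ^ 3 ≤ K * (t - x) ^ 2) : ContinuousAt u x := by
  have hlim : Tendsto (fun t => K * (t - x) ^ 2) (𝓝 x) (𝓝 0) := by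
    have hcont : Continuous fun t => K * (t - x) ^ 2 := by fun_prop
    simpa using hcont.tendsto x
  rw [Metric.continuousAt_iff']
  intro ε hε
  filter_upwards [h, hlim.eventually_lt_const (pow_pos hε 3)] with t ht htε
  exact lt_of_pow_lt_pow_left₀ 3 hε.le (ht.trans_lt htε)

end Holder

section Gluing

variable {μ c m M S : ℝ} {φ w : ℝ → ℝ}

lemma exists_eq_height_mem_uIcc {x y : ℝ} (hx : x ∉ connectedComponentIn {t | w t ≠ c} y) :
    ∃ z ∈ uIcc x y, w z = c := by
  by_contra! hne
  exact hx (isPreconnected_uIcc.subset_connectedComponentIn right_mem_uIcc hne left_mem_uIcc)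

lemma period_le_of_lattice {x₀ T : ℝ} (hT : 0 < T)
    (h : ∀ x, w x = c ↔ ∃ k : ℤ, x = x₀ + k * T) {y z : ℝ} (hy : w y = c) (hz : w z = c)
    (hyz : y < z) : T ≤ z - y := by
  obtain ⟨j, rfl⟩ := (h y).1 hy
  obtain ⟨k, rfl⟩ := (h z).1 hz
  have hjk : (j : ℝ) < k := by nlinarith
  have hone : (j : ℝ) + 1 ≤ k := by exact_mod_cast Int.cast_lt.1 hjk
  nlinarith

namespace IsElementaryWave

lemma abs_sub_pow_three_le (hμ : 0 < μ) (h : IsElementaryWave μ c m M w) {x y : ℝ}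
    (hx : w x = c) : |w y - c| ^ 3 ≤ 9 / 4 * slopeBound μ c (m + M) |m - c| * (y - x) ^ 2 := by
  have hw := h.solvesOff hμ
  refine abs_pow_three_le_of_abs_mul_deriv_sq_le (u := fun t => w t - c)
    (hw.continuous.sub continuous_const) (fun t ht => ?_)
    (slopeBound_nonneg hμ.le (abs_nonneg _)) (sub_eq_zero.2 hx)
  rw [deriv_sub_const]
  exact ⟨(hw.differentiableAt t (sub_ne_zero.1 ht)).sub_const c,
    h.abs_sub_mul_deriv_sq_le hμ.le (sub_ne_zero.1 ht)⟩

lemma abs_sub_pow_three_le_of_notMem (hμ : 0 < μ) (h : IsElementaryWave μ c m M w) {x y : ℝ}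
    (hx : x ∉ connectedComponentIn {t | w t ≠ c} y) :
    |w y - c| ^ 3 ≤ 9 / 4 * slopeBound μ c (m + M) |m - c| * (y - x) ^ 2 := by
  obtain ⟨z, hz, hzc⟩ := exists_eq_height_mem_uIcc hx
  refine (h.abs_sub_pow_three_le hμ hzc).trans (mul_le_mul_of_nonneg_left (sq_le_sq.2 ?_)
    (mul_nonneg (by norm_num) (slopeBound_nonneg hμ.le (abs_nonneg _))))
  exact abs_sub_right_of_mem_uIcc hz

lemma amplitude_pow_three_le (hμ : 0 < μ) (h : IsElementaryWave μ c m M w) {y z : ℝ}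
    (hy : w y = c) (hz : w z = c) (hyz : y < z) :
    |m - c| ^ 3 ≤ 9 / 4 * slopeBound μ c (m + M) |m - c| * (z - y) ^ 2 := by
  obtain ⟨⟨q, rfl⟩, x₀, T, hT, hzeros⟩ | ⟨x₀, hzeros⟩ := h.periodic_or_single_crest
  · obtain ⟨k, hk⟩ := exists_int_add_mem_Ico hT q x₀
    have hcrest : w (x₀ + (-k : ℤ) * T) = c := (hzeros _).2 ⟨-k, rfl⟩
    refine (h.abs_sub_pow_three_le hμ hcrest).trans (mul_le_mul_of_nonneg_left
      (pow_le_pow_left₀ ?_ ?_ 2)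
      (mul_nonneg (by norm_num) (slopeBound_nonneg hμ.le (abs_nonneg _)))) <;> push_cast
    · linarith [hk.1]
    · linarith [hk.2, period_le_of_lattice hT hzeros hy hz hyz]
  · exact absurd (((hzeros y).1 hy).trans ((hzeros z).1 hz).symm) hyz.ne

end IsElementaryWave

/-- A bound for the amplitude `|m - c|` of an elementary wave with `m + M = S` two of whose crests
are at distance at most `2`. -/
noncomputable def amplitudeBound (μ c S : ℝ) : ℝ := 1 + 18 * μ * |S - 2 * c| + 36 * μ

lemma le_amplitudeBound (hμ : 0 ≤ μ) {d : ℝ} (hd : 0 < d)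
    (h : d ^ 3 ≤ 9 / 4 * slopeBound μ c S d * 2 ^ 2) : d ≤ amplitudeBound μ c S := by
  have hsq : d ^ 2 ≤ 18 * μ * (|S - 2 * c| + 2 * d) := by
    refine le_of_mul_le_mul_right ?_ hd
    unfold slopeBound at h
    linarith
  unfold amplitudeBound
  have hS : 0 ≤ μ * |S - 2 * c| := by positivity
  by_contra! hlt
  have : 1 < d := by nlinarith
  nlinarith

lemma IsElementaryWave.amplitude_le (hμ : 0 < μ) (h : IsElementaryWave μ c m M w) {x y : ℝ}
    (hy : w y ≠ c) (hxy : y ∈ Ioo (x - 1) (x + 1))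
    (hright : x + 1 ∉ connectedComponentIn {t | w t ≠ c} y)
    (hleft : x - 1 ∉ connectedComponentIn {t | w t ≠ c} y) :
    |m - c| ≤ amplitudeBound μ c (m + M) := by
  obtain ⟨z, hz, hzc⟩ := exists_eq_height_mem_uIcc hleft
  obtain ⟨z', hz', hzc'⟩ := exists_eq_height_mem_uIcc hright
  rw [uIcc_of_le hxy.1.le] at hz
  rw [uIcc_of_ge hxy.2.le] at hz'
  have hzy : z < y := hz.2.lt_of_ne fun heq => hy (heq ▸ hzc)
  refine le_amplitudeBound hμ.le (abs_pos.2 (sub_ne_zero.2 h.ne))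
    ((h.amplitude_pow_three_le hμ hzc hzc' (hzy.trans_le hz'.1)).trans ?_)
  have hnonneg := slopeBound_nonneg (c := c) hμ.le (S := m + M) (abs_nonneg (m - c))
  gcongr
  · linarith [hz'.1]
  · linarith [hz.1, hz'.2]

namespace IsComposite

lemma exists_eventuallyEq (hμ : 0 < μ) (h : IsComposite μ c S φ) {x : ℝ} (hx : φ x ≠ c) :
    ∃ w, SolvesOff μ c (2 * μ * S) w ∧ φ =ᶠ[𝓝 x] w := by
  obtain ⟨m, M, w, rfl, hw, hcomponent, heq⟩ := h x hx
  have hsol := hw.solvesOff hμ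
  have hopen : IsOpen (connectedComponentIn {y | φ y ≠ c} x) :=
    hcomponent ▸ (isOpen_ne_height hsol.continuous).connectedComponentIn
  exact ⟨w, hsol, heq.eventuallyEq_of_mem (hopen.mem_nhds (mem_connectedComponentIn hx))⟩

lemma exists_bound_of_mem (hμ : 0 < μ) (h : IsComposite μ c S φ) (x z : ℝ) :
    ∃ K, ∀ y, φ y ≠ c → z ∈ connectedComponentIn {t | φ t ≠ c} y →
      x ∉ connectedComponentIn {t | φ t ≠ c} y → |φ y - c| ^ 3 ≤ K * (y - x) ^ 2 := by
  by_cases hz : φ z = c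
  · exact ⟨0, fun y _ hzy => absurd hz (connectedComponentIn_subset _ _ hzy)⟩
  obtain ⟨m, M, w, rfl, hw, hcomponent, heq⟩ := h z hz
  refine ⟨9 / 4 * slopeBound μ c (m + M) |m - c|, fun y hy hzy hxy => ?_⟩
  have hyz := connectedComponentIn_eq hzy
  have hmem : y ∈ connectedComponentIn {t | φ t ≠ c} z := hyz ▸ mem_connectedComponentIn hy
  rw [hyz, hcomponent, connectedComponentIn_eq (hcomponent ▸ hmem)] at hxy
  exact heq hmem ▸ hw.abs_sub_pow_three_le_of_notMem hμ hxy

lemma exists_bound_of_notMem (hμ : 0 < μ) (h : IsComposite μ c S φ) {x y : ℝ} (hy : φ y ≠ c)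
    (hxy : y ∈ Ioo (x - 1) (x + 1))
    (hright : x + 1 ∉ connectedComponentIn {t | φ t ≠ c} y)
    (hleft : x - 1 ∉ connectedComponentIn {t | φ t ≠ c} y)
    (hx : x ∉ connectedComponentIn {t | φ t ≠ c} y) :
    |φ y - c| ^ 3 ≤ 9 / 4 * slopeBound μ c S (amplitudeBound μ c S) * (y - x) ^ 2 := by
  obtain ⟨m, M, w, rfl, hw, hcomponent, heq⟩ := h y hy
  have hyw : φ y = w y := heq (mem_connectedComponentIn hy)
  rw [hcomponent] at hright hleft hx
  rw [hyw]
  refine (hw.abs_sub_pow_three_le_of_notMem hμ hx).trans ?_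
  gcongr
  exact slopeBound_mono hμ.le (abs_nonneg _) (hw.amplitude_le hμ (hyw ▸ hy) hxy hright hleft)

/-- Of the components of `{φ ≠ c}` that meet `(x - 1, x + 1)`, at most two contain `x + 1` or
`x - 1`; all others lie between two crests at distance at most `2`, which bounds their amplitude
and hence their Hölder constant. -/
lemma exists_abs_sub_pow_three_le (hμ : 0 < μ) (h : IsComposite μ c S φ) {x : ℝ} (hx : φ x = c) :
    ∃ K, ∀ᶠ y in 𝓝 x, |φ y - c| ^ 3 ≤ K * (y - x) ^ 2 := by
  obtain ⟨K₁, hK₁⟩ := h.exists_bound_of_mem hμ x (x + 1)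
  obtain ⟨K₂, hK₂⟩ := h.exists_bound_of_mem hμ x (x - 1)
  set K₀ := 9 / 4 * slopeBound μ c S (amplitudeBound μ c S)
  refine ⟨max 0 (max K₀ (max K₁ K₂)), ?_⟩
  have henlarge {y K : ℝ} (hK : K ≤ max 0 (max K₀ (max K₁ K₂)))
      (hle : |φ y - c| ^ 3 ≤ K * (y - x) ^ 2) :
      |φ y - c| ^ 3 ≤ max 0 (max K₀ (max K₁ K₂)) * (y - x) ^ 2 :=
    hle.trans (mul_le_mul_of_nonneg_right hK (sq_nonneg _))
  filter_upwards [Ioo_mem_nhds (sub_one_lt x) (lt_add_one x)] with y hxy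
  by_cases hy : φ y = c
  · exact henlarge (K := 0) (by simp) (by simp [hy])
  have hxy' : x ∉ connectedComponentIn {t | φ t ≠ c} y := fun hmem =>
    connectedComponentIn_subset _ _ hmem hx
  by_cases hright : x + 1 ∈ connectedComponentIn {t | φ t ≠ c} y
  · exact henlarge (by simp) (hK₁ y hy hright hxy')
  by_cases hleft : x - 1 ∈ connectedComponentIn {t | φ t ≠ c} y
  · exact henlarge (by simp) (hK₂ y hy hleft hxy')
  exact henlarge (K := K₀) (by simp) (h.exists_bound_of_notMem hμ hy hxy hright hleft hxy')

lemma continuous (hμ : 0 < μ) (h : IsComposite μ c S φ) : Continuous φ := by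
  refine continuous_iff_continuousAt.2 fun x => ?_
  by_cases hx : φ x = c
  · obtain ⟨K, hK⟩ := h.exists_abs_sub_pow_three_le hμ hx
    exact continuousAt_of_abs_pow_three_le (hx.symm ▸ hK)
  · obtain ⟨w, hw, heq⟩ := h.exists_eventuallyEq hμ hx
    exact hw.continuous.continuousAt.congr heq.symm

theorem solvesOff (hμ : 0 < μ) (h : IsComposite μ c S φ) : SolvesOff μ c (2 * μ * S) φ := by
  refine ⟨h.continuous hμ, fun x hx => ?_, fun x hx => ?_⟩
  · obtain ⟨w, hw, heq⟩ := h.exists_eventuallyEq hμ hx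
    exact (hw.differentiableAt x (heq.eq_of_nhds ▸ hx)).congr_of_eventuallyEq heq
  · obtain ⟨w, hw, heq⟩ := h.exists_eventuallyEq hμ hx
    rw [heq.eq_of_nhds, heq.deriv.eq_of_nhds]
    exact (hw.hasDerivAt_deriv x (heq.eq_of_nhds ▸ hx)).congr_of_eventuallyEq heq.deriv

end IsComposite

lemma mul_eq_four_mul_mul_iff (hμ : μ ≠ 0) : 2 * μ * S = 4 * μ * c ↔ S = 2 * c := by
  rw [show 4 * μ * c = 2 * μ * (2 * c) by ring, mul_right_inj' (mul_ne_zero two_ne_zero hμ)]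

theorem IsComposite.isTravelingWave (hμ : 0 < μ) (h : IsComposite μ c S φ)
    (hS : volume {x | φ x = c} = 0 ∨ S = 2 * c) : IsTravelingWave μ c φ :=
  (h.solvesOff hμ).isTravelingWave (hS.imp_right (mul_eq_four_mul_mul_iff hμ.ne').2)

theorem IsComposite.isTravelingWave_iff (hμ : 0 < μ) (h : IsComposite μ c S φ)
    (hne : ∃ x, φ x ≠ c) :
    IsTravelingWave μ c φ ↔ (volume {x | φ x = c} = 0 ∨ S = 2 * c) := by
  refine ⟨fun hw => ?_, h.isTravelingWave hμ⟩
  obtain ⟨a, ha, hvol⟩ := hw.exists_solvesOff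
  obtain ⟨x, hx⟩ := hne
  rw [ha.constant_unique (h.solvesOff hμ) hx] at hvol
  exact hvol.imp_right (mul_eq_four_mul_mul_iff hμ.ne').1

end Gluing

section Growth

variable {μ c a : ℝ} {φ : ℝ → ℝ} {x : ℝ}

lemma sub_mul_deriv_sq (x : ℝ) :
    (φ x - c) * deriv φ x ^ 2 = 2 * μ * φ x ^ 2 - a * φ x + firstIntegral μ c a φ x := by
  rw [firstIntegral]
  ring

lemma not_bddAbove_of_le_deriv {f : ℝ → ℝ} {δ : ℝ} (hδ : 0 < δ)
    (hf : ∀ y ∈ Ici x, DifferentiableAt ℝ f y) (h : ∀ y ∈ Ici x, δ ≤ deriv f y) :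
    ¬ BddAbove (range f) := by
  rintro ⟨K, hK⟩
  have hfK (y : ℝ) : f y ≤ K := hK (mem_range_self y)
  have hpos : 0 < (K + 1 - f x) / δ := div_pos (by linarith [hfK x]) hδ
  have hle : x ≤ x + (K + 1 - f x) / δ := by linarith
  have hgrowth := (convex_Ici x).mul_sub_le_image_sub_of_le_deriv
    (fun y hy => (hf y hy).continuousAt.continuousWithinAt)
    (fun y hy => (hf y (interior_subset hy)).differentiableWithinAt)
    (fun y hy => h y (interior_subset hy)) x self_mem_Ici _ hle hle
  rw [add_sub_cancel_left, mul_div_cancel₀ _ hδ.ne'] at hgrowth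
  linarith [hfK (x + (K + 1 - f x) / δ)]

namespace SolvesOff

lemma isClosed_rising (h : SolvesOff μ c a φ) {v b : ℝ} (hv : c < v) :
    IsClosed {y | v ≤ φ y ∧ 0 ≤ deriv φ y ∧ firstIntegral μ c a φ y = b} := by
  have hclosed : IsClosed {y | v ≤ φ y} := isClosed_le continuous_const h.continuous
  refine ContinuousOn.preimage_isClosed_of_isClosed
    (f := fun y => (deriv φ y, firstIntegral μ c a φ y)) (fun y hy => ?_) hclosed
    (isClosed_Ici.prod isClosed_singleton)
  have hne : φ y ≠ c := (hv.trans_le hy).ne'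
  exact ((h.continuousAt_deriv hne).prodMk
    (h.hasDerivAt_firstIntegral hne).continuousAt).continuousWithinAt

lemma eventually_lt_and_firstIntegral_eq (h : SolvesOff μ c a φ) (hx : c < φ x)
    (hev : ∀ᶠ y in 𝓝[>] x, 0 < deriv φ y) :
    ∀ᶠ y in 𝓝[>] x, φ x < φ y ∧ firstIntegral μ c a φ y = firstIntegral μ c a φ x := by
  obtain ⟨u, hu, hpos⟩ := mem_nhdsGT_iff_exists_Ioo_subset.1 hev
  obtain ⟨ε, hε, hgt⟩ := Metric.eventually_nhds_iff_ball.1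
    (h.continuous.continuousAt.eventually_const_lt hx)
  rw [Real.ball_eq_Ioo] at hgt
  filter_upwards [Ioo_mem_nhdsGT hu, Ioo_mem_nhdsGT (lt_add_of_pos_right x hε)] with y hyu hyε
  have hmono : StrictMonoOn φ (Icc x y) :=
    strictMonoOn_of_deriv_pos (convex_Icc _ _) h.continuous.continuousOn fun t ht => by
      rw [interior_Icc] at ht
      exact hpos ⟨ht.1, ht.2.trans hyu.2⟩
  exact ⟨hmono (left_mem_Icc.2 hyu.1.le) (right_mem_Icc.2 hyu.1.le) hyu.1,
    h.firstIntegral_eq isOpen_Ioo isPreconnected_Ioo (fun t ht => (hgt t ht).ne')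
      ⟨by linarith [hyu.1], hyε.2⟩ ⟨by linarith, by linarith⟩⟩

lemma le_and_deriv_pos_and_firstIntegral_eq (h : SolvesOff μ c a φ) (hx : c < φ x)
    (hd : 0 < deriv φ x)
    (hpos : ∀ t, φ x ≤ t → 0 < 2 * μ * t ^ 2 - a * t + firstIntegral μ c a φ x) {y : ℝ}
    (hy : x ≤ y) :
    φ x ≤ φ y ∧ 0 < deriv φ y ∧ firstIntegral μ c a φ y = firstIntegral μ c a φ x := by
  set b := firstIntegral μ c a φ x with hb
  set s : Set ℝ := {y | φ x ≤ φ y ∧ 0 ≤ deriv φ y ∧ firstIntegral μ c a φ y = b}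
  have hderiv : ∀ z ∈ s, 0 < deriv φ z := by
    rintro z ⟨hz, hz0, hzb⟩
    refine hz0.lt_of_ne' fun hzero => ?_
    have hquad := hpos _ hz
    rw [← hzb, ← sub_mul_deriv_sq, hzero] at hquad
    simp at hquad
  have hclosed : IsClosed (s ∩ Icc x y) := (h.isClosed_rising hx).inter isClosed_Icc
  have hmem : y ∈ s := hclosed.Icc_subset_of_forall_mem_nhdsWithin ⟨le_rfl, hd.le, hb.symm⟩
    (fun z hz => ?_) ⟨hy, le_rfl⟩
  · exact ⟨hmem.1, hderiv y hmem, hmem.2.2⟩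
  · have hcz : c < φ z := hx.trans_le hz.1.1
    have hev : ∀ᶠ t in 𝓝[>] z, 0 < deriv φ t := nhdsWithin_le_nhds
      ((h.continuousAt_deriv hcz.ne').eventually_const_lt (hderiv z hz.1))
    filter_upwards [hev, h.eventually_lt_and_firstIntegral_eq hcz hev] with t ht ht'
    exact ⟨hz.1.1.trans ht'.1.le, ht.le, ht'.2.trans hz.1.2.2⟩

lemma not_bddAbove_of_deriv_pos (h : SolvesOff μ c a φ) (hx : c < φ x) (hd : 0 < deriv φ x)
    (hpos : ∀ t, φ x ≤ t → 0 < 2 * μ * t ^ 2 - a * t + firstIntegral μ c a φ x) :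
    ¬ BddAbove (range φ) := by
  intro hbdd
  obtain ⟨K, hK⟩ := hbdd
  have hφK (y : ℝ) : φ y ≤ K := hK (mem_range_self y)
  have hrise {y : ℝ} (hy : y ∈ Ici x) := h.le_and_deriv_pos_and_firstIntegral_eq hx hd hpos hy
  obtain ⟨t₀, ht₀, hmin⟩ := isCompact_Icc.exists_isMinOn (nonempty_Icc.2 (hφK x))
    (f := fun t : ℝ => 2 * μ * t ^ 2 - a * t + firstIntegral μ c a φ x) (by fun_prop)
  set ρ := 2 * μ * t₀ ^ 2 - a * t₀ + firstIntegral μ c a φ x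
  have hKc : 0 < K - c := by linarith [hφK x]
  have hδ : 0 < √(ρ / (K - c)) := Real.sqrt_pos.2 (div_pos (hpos _ ht₀.1) hKc)
  refine not_bddAbove_of_le_deriv hδ
    (fun y hy => h.differentiableAt y (hx.trans_le (hrise hy).1).ne') (fun y hy => ?_) ⟨K, hK⟩
  obtain ⟨hle, hpos', hfi⟩ := hrise hy
  rw [Real.sqrt_le_left hpos'.le, div_le_iff₀ hKc]
  calc ρ ≤ 2 * μ * φ y ^ 2 - a * φ y + firstIntegral μ c a φ x := hmin ⟨hle, hφK y⟩
    _ = (φ y - c) * deriv φ y ^ 2 := by rw [← hfi, ← sub_mul_deriv_sq]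
    _ ≤ (K - c) * deriv φ y ^ 2 := by gcongr; exact hφK y
    _ = deriv φ y ^ 2 * (K - c) := mul_comm _ _

lemma eventually_deriv_pos_of_critical (h : SolvesOff μ c a φ) (hx : c < φ x)
    (hd : deriv φ x = 0) (ha : a < 4 * μ * φ x) : ∀ᶠ y in 𝓝[>] x, 0 < deriv φ y := by
  have hsecond : 0 < deriv (deriv φ) x := by
    rw [(h.hasDerivAt_deriv x hx.ne').deriv, hd]
    exact div_pos (by linarith) (by linarith)
  filter_upwards [nhdsWithin_le_nhds (eventually_nhdsWithin_sign_eq_of_deriv_pos hsecond hd),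
    self_mem_nhdsWithin] with y hy hxy
  rwa [sign_pos (sub_pos.2 hxy), sign_eq_one_iff] at hy

lemma not_bddAbove_of_deriv_ne_zero (h : SolvesOff μ c a φ) (hx : c < φ x) (hd : deriv φ x ≠ 0)
    (hpos : ∀ t, φ x < t → 0 < 2 * μ * t ^ 2 - a * t + firstIntegral μ c a φ x) :
    ¬ BddAbove (range φ) := by
  have hpos' (t : ℝ) (ht : φ x ≤ t) :
      0 < 2 * μ * t ^ 2 - a * t + firstIntegral μ c a φ x := by
    obtain rfl | ht := ht.eq_or_lt
    · rw [← sub_mul_deriv_sq]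
      exact mul_pos (sub_pos.2 hx) (by positivity)
    · exact hpos t ht
  obtain hneg | hd := hd.lt_or_gt
  · have hderiv : deriv (fun y => φ (-y)) (-x) = -deriv φ x := by rw [deriv_comp_neg, neg_neg]
    have hunbdd := h.comp_neg.not_bddAbove_of_deriv_pos (x := -x) (by rwa [neg_neg])
      (by rwa [hderiv, neg_pos]) (by rw [firstIntegral, hderiv, neg_neg, neg_sq]; exact hpos')
    exact fun hbdd => hunbdd (hbdd.mono (range_comp_subset_range (fun y => -y) φ))
  · exact h.not_bddAbove_of_deriv_pos hx hd hpos'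

lemma not_bddAbove (h : SolvesOff μ c a φ) (hx : c < φ x)
    (hd : deriv φ x ≠ 0 ∨ a < 4 * μ * φ x)
    (hpos : ∀ t, φ x < t → 0 < 2 * μ * t ^ 2 - a * t + firstIntegral μ c a φ x) :
    ¬ BddAbove (range φ) := by
  by_cases hd0 : deriv φ x = 0
  · have hev := h.eventually_deriv_pos_of_critical hx hd0 (hd.resolve_left (not_not.2 hd0))
    obtain ⟨y, hy, hlt, hfi⟩ := (hev.and (h.eventually_lt_and_firstIntegral_eq hx hev)).exists
    refine h.not_bddAbove_of_deriv_ne_zero (hx.trans hlt) hy.ne' fun t ht => ?_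
    rw [hfi]
    exact hpos t (hlt.trans ht)
  · exact h.not_bddAbove_of_deriv_ne_zero hx hd0 hpos

end SolvesOff

end Growth

/-! ### Classification -/

section Classification

variable {μ c a m M v d x : ℝ} {φ : ℝ → ℝ}

lemma exists_roots_or_pos (hμ : 0 < μ) (a b : ℝ) :
    (∃ m M, m ≤ M ∧ a = 2 * μ * (m + M) ∧ b = 2 * μ * m * M) ∨
      ∀ t, 0 < 2 * μ * t ^ 2 - a * t + b := by
  obtain hdisc | hdisc := le_or_gt 0 (a ^ 2 - 8 * μ * b)
  · have hsq := Real.sq_sqrt hdisc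
    have hnonneg := Real.sqrt_nonneg (a ^ 2 - 8 * μ * b)
    set s := √(a ^ 2 - 8 * μ * b)
    refine Or.inl ⟨(a - s) / (4 * μ), (a + s) / (4 * μ), ?_, ?_, ?_⟩
    · gcongr
      linarith
    · field_simp
      ring
    · field_simp
      linarith
  · refine Or.inr fun t => pos_of_mul_pos_right (a := 8 * μ) ?_ (by positivity)
    calc 0 < (4 * μ * t - a) ^ 2 + (8 * μ * b - a ^ 2) := by
          linarith [sq_nonneg (4 * μ * t - a)]
      _ = 8 * μ * (2 * μ * t ^ 2 - a * t + b) := by ring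

lemma mem_Icc_of_mul_sq_eq (hμ : 0 < μ) (hmM : m ≤ M) (hv : v < c)
    (hd : (c - v) * d ^ 2 = 2 * μ * (M - v) * (v - m)) : v ∈ Icc m M := by
  have hprod : 0 ≤ (M - v) * (v - m) := by
    refine nonneg_of_mul_nonneg_right (b := (M - v) * (v - m)) (a := 2 * μ) ?_ (by positivity)
    rw [← mul_assoc, ← hd]
    exact mul_nonneg (sub_pos.2 hv).le (sq_nonneg d)
  constructor <;> by_contra! hlt <;> nlinarith

lemma notMem_Ioo_of_mul_sq_eq (hμ : 0 < μ) (hv : c < v)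
    (hd : (c - v) * d ^ 2 = 2 * μ * (M - v) * (v - m)) : v ∉ Ioo m M := by
  rintro ⟨hm, hM⟩
  have hpos : 0 < 2 * μ * (M - v) * (v - m) :=
    mul_pos (mul_pos (by positivity) (sub_pos.2 hM)) (sub_pos.2 hm)
  exact hpos.not_ge (hd ▸ mul_nonpos_of_nonpos_of_nonneg (sub_neg.2 hv).le (sq_nonneg d))

lemma firstIntegral_eq_mul_iff :
    firstIntegral μ c (2 * μ * (m + M)) φ x = 2 * μ * m * M ↔
      (c - φ x) * deriv φ x ^ 2 = 2 * μ * (M - φ x) * (φ x - m) := by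
  rw [firstIntegral]
  constructor <;> intro h <;> linarith

lemma IsArch.exists_through {s e x₀ T p : ℝ} (h : IsArch μ c (2 * μ * (m + M)) s e m φ x₀ T p)
    (he : e = c ∨ e = M) (hv : v ∈ uIcc e m) (hvc : v ≠ c)
    (hd : (c - v) * d ^ 2 = 2 * μ * (M - v) * (v - m)) (x : ℝ) :
    ∃ w x₁ q, IsArch μ c (2 * μ * (m + M)) s e m w x₁ T q ∧ w x = v ∧ deriv w x = d := by
  obtain ⟨z, rfl, rfl⟩ := h.exists_data he hv hvc hd
  refine ⟨_, _, _, h.comp_add_const (z - x), ?_, ?_⟩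
  · rw [add_sub_cancel]
  · rw [deriv_comp_add_const, add_sub_cancel]

lemma IsLineArch.exists_through (hμ : 0 < μ) {x₀ : ℝ} (h : IsLineArch μ c a m φ x₀)
    (hv : v ∈ Ioo c m) (hd : (c - v) * d ^ 2 = 2 * μ * (m - v) * (v - m)) (x : ℝ) :
    ∃ w x₁, IsLineArch μ c a m w x₁ ∧ w x = v ∧ deriv w x = d := by
  obtain ⟨z, rfl, rfl⟩ := h.exists_data hμ hv hd
  refine ⟨_, _, h.comp_add_const (z - x), ?_, ?_⟩
  · rw [add_sub_cancel]
  · rw [deriv_comp_add_const, add_sub_cancel]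

lemma exists_isElementaryWave_below (hμ : 0 < μ) (hm : m ≤ v) (hv : v < c) (hM : c ≤ M)
    (hd : (c - v) * d ^ 2 = 2 * μ * (M - v) * (v - m)) (x : ℝ) :
    ∃ w, IsElementaryWave μ c m M w ∧ w x = v ∧ deriv w x = d := by
  have hmc : m < c := hm.trans_lt hv
  obtain ⟨φ, x₀, T, p, hφ⟩ := exists_isArch_below hμ hmc hM
  obtain ⟨w, x₁, q, hw, hwx⟩ :=
    hφ.exists_through (Or.inl rfl) (mem_uIcc.2 (Or.inr ⟨hm, hv.le⟩)) hv.ne hd x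
  refine ⟨w, ?_, hwx⟩
  obtain rfl | hcM := hM.eq_or_lt
  · exact Or.inl ⟨hmc, rfl, hw.isPeakedPeriodicWave hμ hmc⟩
  · exact Or.inr (Or.inl ⟨hmc, hcM, hw.isCuspedPeriodicWave hμ.ne' hcM.ne'⟩)

lemma exists_isElementaryWave_above (hμ : 0 < μ) (hv : c < v) (hm : v ≤ m) (hmM : m ≤ M)
    (hM : v < M) (hd : (c - v) * d ^ 2 = 2 * μ * (M - v) * (v - m)) (x : ℝ) :
    ∃ w, IsElementaryWave μ c m M w ∧ w x = v ∧ deriv w x = d := by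
  have hcm : c < m := hv.trans_le hm
  obtain rfl | hmM := hmM.eq_or_lt
  · obtain ⟨φ, x₀, hφ⟩ := exists_isLineArch hμ hcm
    obtain ⟨w, x₁, hw, hwx⟩ := hφ.exists_through hμ ⟨hv, hM⟩ hd x
    exact ⟨w, Or.inr (Or.inr (Or.inr ⟨hcm, rfl, hw.isAnticuspedLineWave hμ.ne' hcm.ne'⟩)), hwx⟩
  · obtain ⟨φ, x₀, T, p, hφ⟩ := exists_isArch_above hμ hcm hmM
    obtain ⟨w, x₁, q, hw, hwx⟩ :=
      hφ.exists_through (Or.inl rfl) (mem_uIcc.2 (Or.inl ⟨hv.le, hm⟩)) hv.ne' hd x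
    exact ⟨w, Or.inr (Or.inr (Or.inl ⟨hcm, hmM,
      hw.isAnticuspedPeriodicWave hμ.ne' (hcm.trans hmM).ne'⟩)), hwx⟩

lemma solvesOff_const (μ c k : ℝ) : SolvesOff μ c (4 * μ * k) fun _ => k := by
  refine ⟨continuous_const, fun _ _ => differentiableAt_const _, fun x _ => ?_⟩
  simpa only [deriv_const', sub_self, zero_pow two_ne_zero, zero_div] using hasDerivAt_const x 0

theorem isTravelingWave_const (μ c k : ℝ) : IsTravelingWave μ c fun _ => k := by
  refine (solvesOff_const μ c k).isTravelingWave ?_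
  obtain rfl | hk := eq_or_ne k c
  · exact Or.inr rfl
  · simp [hk]

namespace SolvesOff

lemma eq_const_of_critical (h : SolvesOff μ c a φ) (hx : φ x ≠ c) (hd : deriv φ x = 0)
    (ha : a = 4 * μ * φ x) : ∃ k, ∀ y, φ y = k := by
  have hconst := ha ▸ solvesOff_const μ c (φ x)
  exact ⟨φ x, fun y => (hconst.eqOn h isPreconnected_univ (mem_univ x) (fun _ _ => hx) rfl
    (by rw [hd, deriv_const]) (mem_univ y)).symm⟩

lemma eq_const_of_double_root (h : SolvesOff μ c (2 * μ * (φ x + φ x)) φ) (hx : φ x ≠ c)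
    (hd : (c - φ x) * deriv φ x ^ 2 = 2 * μ * (φ x - φ x) * (φ x - φ x)) :
    ∃ k, ∀ y, φ y = k := by
  rw [sub_self, mul_zero, mul_eq_zero, or_iff_right (sub_ne_zero.2 hx.symm)] at hd
  exact h.eq_const_of_critical hx (pow_eq_zero_iff two_ne_zero |>.1 hd) (by ring)

lemma isSmoothPeriodicWave (hμ : 0 < μ) (h : SolvesOff μ c (2 * μ * (m + M)) φ) (hmM : m < M)
    (hM : M < c) (hx : φ x ∈ Icc m M)
    (hd : (c - φ x) * deriv φ x ^ 2 = 2 * μ * (M - φ x) * (φ x - m)) :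
    IsSmoothPeriodicWave μ c m M φ := by
  obtain ⟨ψ, x₀, T, p, hψ⟩ := exists_isArch_smooth hμ hmM hM
  obtain ⟨w, x₁, q, hw, hwx, hwx'⟩ := hψ.exists_through (Or.inr rfl)
    (uIcc_of_ge hmM.le ▸ hx) (hx.2.trans_lt hM).ne hd x
  have heq : w = φ := eqOn_univ w φ |>.1 <| hw.solves.eqOn h isPreconnected_univ (mem_univ x)
    (fun y _ => hw.ne_height hM.ne y) hwx hwx'
  exact heq ▸ hw.isSmoothPeriodicWave hM

lemma exists_parameters (hμ : 0 < μ) (h : SolvesOff μ c a φ) (hbdd : BddAbove (range φ)) (x : ℝ) :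
    ∃ m M, m ≤ M ∧ a = 2 * μ * (m + M) ∧
      (c - φ x) * deriv φ x ^ 2 = 2 * μ * (M - φ x) * (φ x - m) := by
  obtain ⟨m, M, hmM, rfl, hb⟩ | hpos := exists_roots_or_pos hμ a (firstIntegral μ c a φ x)
  · exact ⟨m, M, hmM, rfl, firstIntegral_eq_mul_iff.1 hb⟩
  · have hprod := hpos (φ x)
    rw [← sub_mul_deriv_sq] at hprod
    have hd : deriv φ x ≠ 0 := fun hzero => by simp [hzero] at hprod
    have hcx : c < φ x := sub_pos.1 (pos_of_mul_pos_left hprod (sq_nonneg _))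
    exact absurd hbdd (h.not_bddAbove hcx (Or.inl hd) fun t _ => hpos t)

lemma not_bddAbove_of_root_lt (hμ : 0 < μ) (h : SolvesOff μ c (2 * μ * (m + M)) φ)
    (hx : c < φ x) (hm : m < φ x) (hM : M ≤ φ x)
    (hd : (c - φ x) * deriv φ x ^ 2 = 2 * μ * (M - φ x) * (φ x - m)) :
    ¬ BddAbove (range φ) := by
  refine h.not_bddAbove hx (Or.inr ?_) fun t ht => ?_
  · have : 2 * μ * (m + M) < 2 * μ * (2 * φ x) := by
      gcongr
      linarith
    linarith
  · have hfactor : 2 * μ * t ^ 2 - 2 * μ * (m + M) * t + firstIntegral μ c (2 * μ * (m + M)) φ x =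
        2 * μ * ((t - m) * (t - M)) := by
      rw [firstIntegral_eq_mul_iff.2 hd]
      ring
    rw [hfactor]
    exact mul_pos (by positivity) (mul_pos (sub_pos.2 (hm.trans ht)) (sub_pos.2 (hM.trans_lt ht)))

lemma constant_or_smooth_or_elementary_of_lt (hμ : 0 < μ)
    (h : SolvesOff μ c (2 * μ * (m + M)) φ) (hmM : m ≤ M) (hx : φ x < c)
    (hd : (c - φ x) * deriv φ x ^ 2 = 2 * μ * (M - φ x) * (φ x - m)) :
    (∃ k, ∀ y, φ y = k) ∨ (m < M ∧ M < c ∧ IsSmoothPeriodicWave μ c m M φ) ∨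
      ∃ w, IsElementaryWave μ c m M w ∧ w x = φ x ∧ deriv w x = deriv φ x := by
  have hmem := mem_Icc_of_mul_sq_eq hμ hmM hx hd
  obtain rfl | hlt := hmM.eq_or_lt
  · obtain rfl : φ x = m := le_antisymm hmem.2 hmem.1
    exact Or.inl (h.eq_const_of_double_root hx.ne hd)
  obtain hM | hM := lt_or_ge M c
  · exact Or.inr (Or.inl ⟨hlt, hM, h.isSmoothPeriodicWave hμ hlt hM hmem hd⟩)
  · exact Or.inr (Or.inr (exists_isElementaryWave_below hμ hmem.1 hx hM hd x))

lemma constant_or_elementary_of_gt (hμ : 0 < μ) (h : SolvesOff μ c (2 * μ * (m + M)) φ)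
    (hbdd : BddAbove (range φ)) (hmM : m ≤ M) (hx : c < φ x)
    (hd : (c - φ x) * deriv φ x ^ 2 = 2 * μ * (M - φ x) * (φ x - m)) :
    (∃ k, ∀ y, φ y = k) ∨
      ∃ w, IsElementaryWave μ c m M w ∧ w x = φ x ∧ deriv w x = deriv φ x := by
  obtain hm | hm := lt_or_ge m (φ x)
  · have hM : M ≤ φ x := not_lt.1 fun hM => notMem_Ioo_of_mul_sq_eq hμ hx hd ⟨hm, hM⟩
    exact absurd hbdd (h.not_bddAbove_of_root_lt hμ hx hm hM hd)
  obtain hM | hM := lt_or_ge (φ x) M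
  · exact Or.inr (exists_isElementaryWave_above hμ hx hm hmM hM hd x)
  · obtain rfl : φ x = m := le_antisymm hm (hmM.trans hM)
    obtain rfl : φ x = M := le_antisymm hmM hM
    exact Or.inl (h.eq_const_of_double_root hx.ne' hd)

theorem constant_or_smooth_or_elementary (hμ : 0 < μ) (h : SolvesOff μ c a φ)
    (hbdd : BddAbove (range φ)) (hx : φ x ≠ c) :
    (∃ k, ∀ y, φ y = k) ∨ (∃ m M, m < M ∧ M < c ∧ IsSmoothPeriodicWave μ c m M φ) ∨
      ∃ m M w, a = 2 * μ * (m + M) ∧ IsElementaryWave μ c m M w ∧ w x = φ x ∧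
        deriv w x = deriv φ x := by
  obtain ⟨m, M, hmM, rfl, hd⟩ := h.exists_parameters hμ hbdd x
  obtain hlt | hgt := hx.lt_or_gt
  · exact (h.constant_or_smooth_or_elementary_of_lt hμ hmM hlt hd).imp_right
      (Or.imp (fun hw => ⟨m, M, hw⟩) fun ⟨w, hw⟩ => ⟨m, M, w, rfl, hw⟩)
  · exact (h.constant_or_elementary_of_gt hμ hbdd hmM hgt hd).imp_right fun ⟨w, hw⟩ =>
      Or.inr ⟨m, M, w, rfl, hw⟩

end SolvesOff

theorem isTravelingWave_iff_of_bddAbove (hμ : 0 < μ) (hbdd : BddAbove (range φ)) :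
    IsTravelingWave μ c φ ↔ ((∃ k, ∀ x, φ x = k) ∨
      (∃ m M, m < M ∧ M < c ∧ IsSmoothPeriodicWave μ c m M φ) ∨
      (∃ S, IsComposite μ c S φ ∧ (volume {x | φ x = c} = 0 ∨ S = 2 * c))) := by
  constructor
  · intro hw
    obtain ⟨a, h, hvol⟩ := hw.exists_solvesOff
    obtain ⟨S, rfl⟩ : ∃ S, a = 2 * μ * S := ⟨a / (2 * μ), by field_simp⟩
    by_contra! hcon
    obtain ⟨hconst, hsmooth, hcomposite⟩ := hcon
    refine absurd (hvol.imp_right (mul_eq_four_mul_mul_iff hμ.ne').1)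
      (not_or.2 (hcomposite S fun x hx => ?_))
    obtain ⟨k, hk⟩ | ⟨m, M, hmM, hM, hφ⟩ | ⟨m, M, w, hS, hw, hwx, hwx'⟩ :=
      h.constant_or_smooth_or_elementary hμ hbdd hx
    · exact absurd (hk _) (hconst k).choose_spec
    · exact absurd hφ (hsmooth m M hmM hM)
    · exact ⟨m, M, w, (mul_left_cancel₀ (by positivity) hS).symm, hw,
        h.connectedComponentIn_eq (hS ▸ hw.solvesOff hμ) hx hwx.symm hwx'.symm⟩
  · rintro (⟨k, hk⟩ | ⟨m, M, -, -, h⟩ | ⟨S, h, hS⟩)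
    · exact funext hk ▸ isTravelingWave_const μ c k
    · exact h.wave
    · exact h.isTravelingWave hμ hS

end Classification

end MuHS

theorem mainTheorem7_general (μ c : ℝ) (hμ : 0 < μ) :
    (∀ m M : ℝ, m < M → M < c →
      MuHS.ExistsUniqueUpToTranslation (MuHS.IsSmoothPeriodicWave μ c m M)) ∧
    (∀ m : ℝ, m < c →
      MuHS.ExistsUniqueUpToTranslation (MuHS.IsPeakedPeriodicWave μ c m)) ∧
    (∀ m M : ℝ, m < c → c < M →
      MuHS.ExistsUniqueUpToTranslation (MuHS.IsCuspedPeriodicWave μ c m M)) ∧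
    (∀ m M : ℝ, c < m → m < M →
      MuHS.ExistsUniqueUpToTranslation (MuHS.IsAnticuspedPeriodicWave μ c m M)) ∧
    (∀ m : ℝ, c < m →
      MuHS.ExistsUniqueUpToTranslation (MuHS.IsAnticuspedLineWave μ c m)) ∧
    (∀ (S : ℝ) (φ : ℝ → ℝ), MuHS.IsComposite μ c S φ → (∃ x, φ x ≠ c) →
      (MuHS.IsTravelingWave μ c φ ↔ (volume {x | φ x = c} = 0 ∨ S = 2 * c))) ∧
    (∀ φ : ℝ → ℝ, BddAbove (range φ) →
      (MuHS.IsTravelingWave μ c φ ↔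
        ((∃ k : ℝ, ∀ x, φ x = k) ∨
         (∃ m M : ℝ, m < M ∧ M < c ∧ MuHS.IsSmoothPeriodicWave μ c m M φ) ∨
         (∃ S : ℝ, MuHS.IsComposite μ c S φ ∧
            (volume {x | φ x = c} = 0 ∨ S = 2 * c))))) :=
  ⟨fun _ _ => MuHS.existsUnique_smooth hμ, fun _ => MuHS.existsUnique_peaked hμ,
    fun _ _ => MuHS.existsUnique_cusped hμ, fun _ _ => MuHS.existsUnique_anticusped hμ,
    fun _ => MuHS.existsUnique_line hμ, fun _ _ h hne => h.isTravelingWave_iff hμ hne,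
    fun _ hbdd => MuHS.isTravelingWave_iff_of_bddAbove hμ hbdd⟩

theorem mainTheorem7 (μ c : ℝ) (hμ : 0 < μ) :
    -- smooth periodic waves
    (∀ m M : ℝ, m < M → M < c →
      MuHS.ExistsUniqueUpToTranslation (MuHS.IsSmoothPeriodicWave μ c m M)) ∧
    -- peaked periodic waves, the borderline case `M = c`
    (∀ m : ℝ, m < c →
      MuHS.ExistsUniqueUpToTranslation (MuHS.IsPeakedPeriodicWave μ c m)) ∧
    -- cusped periodic waves
    (∀ m M : ℝ, m < c → c < M →
      MuHS.ExistsUniqueUpToTranslation (MuHS.IsCuspedPeriodicWave μ c m M)) ∧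
    -- anticusped periodic waves
    (∀ m M : ℝ, c < m → m < M →
      MuHS.ExistsUniqueUpToTranslation (MuHS.IsAnticuspedPeriodicWave μ c m M)) ∧
    -- anticusped waves on the line
    (∀ m : ℝ, c < m →
      MuHS.ExistsUniqueUpToTranslation (MuHS.IsAnticuspedLineWave μ c m)) ∧
    -- composite waves, and plateaus
    (∀ (S : ℝ) (φ : ℝ → ℝ), MuHS.IsComposite μ c S φ → (∃ x, φ x ≠ c) →
      (MuHS.IsTravelingWave μ c φ ↔ (volume {x | φ x = c} = 0 ∨ S = 2 * c))) ∧
    -- the list is complete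
    (∀ φ : ℝ → ℝ, (∃ K : ℝ, ∀ x, |φ x| ≤ K) →
      (MuHS.IsTravelingWave μ c φ ↔
        ((∃ k : ℝ, ∀ x, φ x = k) ∨
         (∃ m M : ℝ, m < M ∧ M < c ∧ MuHS.IsSmoothPeriodicWave μ c m M φ) ∨
         (∃ S : ℝ, MuHS.IsComposite μ c S φ ∧
            (volume {x | φ x = c} = 0 ∨ S = 2 * c))))) := by
  obtain ⟨hsmooth, hpeaked, hcusped, hanticusped, hline, hcomposite, hcomplete⟩ :=
    mainTheorem7_general μ c hμ
  exact ⟨hsmooth, hpeaked, hcusped, hanticusped, hline, hcomposite, fun φ ⟨K, hK⟩ =>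
    hcomplete φ ⟨K, forall_mem_range.2 fun x => (le_abs_self _).trans (hK x)⟩⟩
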